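/- For an irrational number $\alpha$ let $(q_n)_{n\ge 0}$ ($q_0=1$) be the denominators of its continued fraction convergents, $K_\alpha=\{n: q_{n+1}\le q_n\log^{7/8}q_n\}$, and let $$\mathcal D=\{\alpha\in\mathbb R\setminus\mathbb Q:\ \exists C\ \forall n\ge 2\ \ q_{n+1}\le C\,q_n\log q_n\,(\log n)^2\},\qquad \mathcal E=\Big\{\alpha\in\mathbb R\setminus\mathbb Q:\ \sum_{i\ge 2,\ i\notin K_\alpha}\log^{-7/8}q_i<\infty\Big\}.$$ Let $f:\mathbb T=\mathbb R/\mathbb Z\to(0,\infty)$ be of class $C^2$ on $\mathbb T\setminus\{0\}$ (identified with $(0,1)$), with $\int_{\mathbb T}f\,d\lambda=1$, and suppose that there are $A_i,B_i>0$ with $A_i\neq B_i$ ($i=1,2,3$) such that $$\frac{f(x)}{-\log x}\to A_1,\quad x f'(x)\to -A_2,\quad x^2f''(x)\to A_3\quad (x\to 0^+),$$ $$\frac{f(x)}{-\log(1-x)}\to B_1,\quad (1-x) f'(x)\to B_2,\quad (1-x)^2f''(x)\to B_3\quad (x\to 1^-).$$ Let $Tx=x+\alpha$ on $\mathbb T$,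 let $f^{(n)}$, $n\in\mathbb Z$, be the Birkhoff sums of $f$ over $T$ (so $f^{(0)}=0$ and $f^{(n+1)}(x)=f^{(n)}(x)+f(T^nx)$), and let $(T^f_t)_{t\in\mathbb R}$ be the special flow over $T$ under $f$ (the Arnol'd flow): on $\mathbb T^f=\{(x,s): 0\le s<f(x)\}$ with the measure $\mu^f=\lambda\times\lambda_{\mathbb R}$, $$T^f_t(x,s)=(T^{N}x,\ s+t-f^{(N)}(x)),\qquad f^{(N)}(x)\le s+t<f^{(N+1)}(x).$$ Put $$d^f((x,s),(y,s'))=\min\big(\|x-y\|+|s-s'|,\ \|x+\alpha-y\|+|f(x)-s+s'|,\ \|x-(y+\alpha)\|+|f(y)-s'+s|\big),$$ where $\|\cdot\|$ is the distance to the nearest integer. For $p,q\in\mathbb T^f$ with $d^f(p,q)<10^{-2}$ let $I_{p,q}$ be the maximal time interval containing $0$ on which $d^f(T^f_tp,T^f_tq)<10^{-2}$. Let $\alpha\in\mathcal D\cap\mathcal E$. Then: 1. $(T^f_t)$ has the parabolic divergence (PD) property with respect to $d^f$: there are $c_0,c_1\in(0,1)$ such that for every $\epsilon>0$ there are a measurable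 set $Z\subset\mathbb T^f$ with $\mu^f(Z)>1-\epsilon$ and $\delta>0$ such that for all $p,q\in Z$ with $d^f(p,q)<\delta$ and $q\neq T^f_tp$ for all $|t|<\delta$, $$\big|\{t\in I_{p,q}:\ d^f(T^f_tp,T^f_tq)>c_0\}\big|>c_1|I_{p,q}|.$$ 2. For every $\epsilon>0$ there are a measurable set $Z_1\subset\mathbb T$ with $\lambda(Z_1)>1-\epsilon$ and $\delta''>0$ such that for all distinct $x,y\in Z_1$ with $\|x-y\|<\delta''$ there is an interval of integers $K\subset J_{x,y}$ with $|K|\ge |J_{x,y}|/300$ and $|f^{(n)}(x)-f^{(n)}(y)|>\frac1{400}$ for every $n\in K$. Here $J_{x,y}\subset\mathbb Z$ is the maximal interval of integers containing $0$ on which $|f^{(n)}(x)-f^{(n)}(y)|<\frac1{50}$. -/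

import Mathlib

open MeasureTheory Filter Topology Set

noncomputable section

/-! ### Special flows -/

namespace SpecialFlow

variable {X : Type*}

/-- Birkhoff sums `f^(n)` of `f` over an invertible map `T`, for `n : ℤ`:
`f x + ⋯ + f (T^(n-1) x)` for `n ≥ 0`, and `-(f (T^n x) + ⋯ + f (T^(-1) x))` for `n < 0`. -/
def birkhoff (T : Equiv.Perm X) (f : X → ℝ) (n : ℤ) (x : X) : ℝ :=
  ∑ k ∈ Finset.Ico 0 n, f ((T ^ k) x) - ∑ k ∈ Finset.Ico n 0, f ((T ^ k) x)

theorem birkhoff_add_one (T : Equiv.Perm X) (f : X → ℝ) (n : ℤ) (x : X) :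
    birkhoff T f (n + 1) x = birkhoff T f n x + f ((T ^ n) x) := by
  unfold birkhoff
  rcases lt_or_ge n 0 with h | h
  · have h1 : Finset.Ico 0 (n + 1) = ∅ := Finset.Ico_eq_empty (by omega)
    have h2 : Finset.Ico 0 n = ∅ := Finset.Ico_eq_empty (by omega)
    have h3 : Finset.Ico n 0 = insert n (Finset.Ico (n + 1) 0) := by
      ext k; simp only [Finset.mem_insert, Finset.mem_Ico]; omega
    rw [h1, h2, h3, Finset.sum_insert (by simp)]
    simp
  · have h1 : Finset.Ico (n + 1) 0 = ∅ := Finset.Ico_eq_empty (by omega)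
    have h2 : Finset.Ico n 0 = ∅ := Finset.Ico_eq_empty (by omega)
    have h3 : Finset.Ico 0 (n + 1) = insert n (Finset.Ico 0 n) := by
      ext k; simp only [Finset.mem_insert, Finset.mem_Ico]; omega
    rw [h1, h2, h3, Finset.sum_insert (by simp)]
    simp [add_comm]

/-- The space `X^f = {(x, s) : 0 ≤ s < f x}` under the graph of the roof function. -/
abbrev Space (f : X → ℝ) : Type _ := {p : X × ℝ // 0 ≤ p.2 ∧ p.2 < f p.1}

/-- `n` is the number `N(x,t)` of fibres the point `(x, s)` has crossed at time `t`, where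
`u = s + t`: `f^(n)(x) ≤ u < f^(n+1)(x)`. -/
def IsIndex (T : Equiv.Perm X) (f : X → ℝ) (x : X) (u : ℝ) (n : ℤ) : Prop :=
  birkhoff T f n x ≤ u ∧ u < birkhoff T f (n + 1) x

open Classical in
/-- The special flow `T_t^f (x, s) = (T^N x, s + t - f^(N)(x))`, `N = N(x,t)`. For a roof function
bounded below by a positive constant the index `N` exists and is unique
(`existsUnique_isIndex`), so that the second branch never occurs. -/
def flow (T : Equiv.Perm X) (f : X → ℝ) (t : ℝ) (p : Space f) : Space f :=
  if h : ∃ n : ℤ, IsIndex T f p.1.1 (p.1.2 + t) n then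
    ⟨((T ^ h.choose) p.1.1, p.1.2 + t - birkhoff T f h.choose p.1.1), by
      have h1 : birkhoff T f h.choose p.1.1 ≤ p.1.2 + t := h.choose_spec.1
      have h2 : p.1.2 + t < birkhoff T f (h.choose + 1) p.1.1 := h.choose_spec.2
      rw [birkhoff_add_one] at h2
      exact ⟨by linarith, by linarith⟩⟩
  else p

theorem existsUnique_isIndex (T : Equiv.Perm X) (f : X → ℝ) {c : ℝ} (hc : 0 < c)
    (hf : ∀ x, c ≤ f x) (x : X) (u : ℝ) : ∃! n : ℤ, IsIndex T f x u n := by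
  have step : ∀ n : ℤ, birkhoff T f n x + c ≤ birkhoff T f (n + 1) x := fun n => by
    rw [birkhoff_add_one]; linarith [hf ((T ^ n) x)]
  have grow : ∀ (n : ℤ) (k : ℕ), birkhoff T f n x + k * c ≤ birkhoff T f (n + k) x := by
    intro n k
    induction k with
    | zero => simp
    | succ k ih =>
      have := step (n + k)
      push_cast
      rw [← add_assoc]
      linarith
  have mono : ∀ m n : ℤ, m ≤ n → birkhoff T f m x ≤ birkhoff T f n x := by
    intro m n h
    have := grow m (n - m).toNat
    rw [Int.toNat_of_nonneg (by omega), add_sub_cancel] at this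
    have h0 : (0 : ℝ) ≤ ((n - m).toNat : ℝ) * c := by positivity
    linarith
  have zero : birkhoff T f 0 x = 0 := by simp [birkhoff]
  obtain ⟨K, hK⟩ := exists_nat_gt (|u| / c)
  rw [div_lt_iff₀ hc] at hK
  have hbd : ∀ z : ℤ, birkhoff T f z x ≤ u → z ≤ K := by
    intro z hz
    by_contra hlt
    have h1 := mono K z (by omega)
    have h2 := grow 0 K
    rw [zero, zero_add, zero_add] at h2
    linarith [le_abs_self u]
  have hex : ∃ z : ℤ, birkhoff T f z x ≤ u := by
    refine ⟨-K, ?_⟩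
    have h2 := grow (-K) K
    rw [neg_add_cancel, zero] at h2
    linarith [neg_abs_le u]
  obtain ⟨n, hn, hmax⟩ := Int.exists_greatest_of_bdd ⟨(K : ℤ), hbd⟩ hex
  refine ⟨n, ⟨hn, ?_⟩, ?_⟩
  · by_contra h
    have := hmax (n + 1) (not_lt.mp h)
    omega
  · rintro m ⟨h1, h2⟩
    apply le_antisymm (hmax m h1)
    by_contra h
    have := mono (m + 1) n (by omega)
    linarith

/-- The measure `μ^f`: the restriction of `μ × Lebesgue` to `X^f`. -/
def measure [MeasurableSpace X] (μ : Measure X) (f : X → ℝ) : Measure (Space f) :=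
  (μ.prod volume).comap Subtype.val

/-- The product metric `ρ^f((x,s),(y,s')) = d(x,y) + |s - s'|`. -/
def rho [MetricSpace X] {f : X → ℝ} (p q : Space f) : ℝ :=
  dist p.1.1 q.1.1 + |p.1.2 - q.1.2|

/-- The pseudo-metric `d^f`, the minimum of `ρ^f((x,s),(y,s'))`,
`d(Tx,y) + |f(x) - s + s'|` and `d(x,Ty) + |f(y) - s' + s|`. -/
def pseudoDist [MetricSpace X] (T : Equiv.Perm X) {f : X → ℝ} (p q : Space f) : ℝ :=
  min (rho p q)
    (min (dist (T p.1.1) q.1.1 + |f p.1.1 - p.1.2 + q.1.2|)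
      (dist p.1.1 (T q.1.1) + |f q.1.1 - q.1.2 + p.1.2|))

/-- `J_{x,y}`: the maximal interval of integers containing `0` on which
`|f^(n)(x) - f^(n)(y)| < 1/50`. -/
def closeTimes (T : Equiv.Perm X) (f : X → ℝ) (x y : X) : Set ℤ :=
  {n | ∀ m ∈ uIcc 0 n, |birkhoff T f m x - birkhoff T f m y| < 1 / 50}

/-- Divergence of Birkhoff sums: for every `ε > 0`, on a set of measure `> 1 - ε`, any two distinct
points that are close enough have Birkhoff sums which differ by more than `1/400` on an interval
`K ⊆ J_{x,y}` with `|K| ≥ |J_{x,y}| / 300`. -/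
def CocycleDivergence [MetricSpace X] [MeasurableSpace X] (T : Equiv.Perm X) (f : X → ℝ)
    (μ : Measure X) : Prop :=
  ∀ ε : ℝ, 0 < ε → ∃ Z : Set X, MeasurableSet Z ∧ 1 - ε < μ.real Z ∧ ∃ δ : ℝ, 0 < δ ∧
    ∀ x ∈ Z, ∀ y ∈ Z, x ≠ y → dist x y < δ →
      ∃ K : Set ℤ, K.OrdConnected ∧ K ⊆ closeTimes T f x y ∧
        (closeTimes T f x y).encard ≤ 300 * K.encard ∧
        ∀ n ∈ K, 1 / 400 < |birkhoff T f n x - birkhoff T f n y|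

end SpecialFlow

/-! ### Parabolic divergence -/

/-- `I_{x,y}`: the maximal interval of times containing `0` on which `d (T_t x) (T_t y) < 10⁻²`. -/
def closeInterval {Ω : Type*} (φ : ℝ → Ω → Ω) (d : Ω → Ω → ℝ) (x y : Ω) : Set ℝ :=
  {t | ∀ u ∈ uIcc 0 t, d (φ u x) (φ u y) < 1 / 100}

/-- Parabolic divergence (PD-property) of a flow `φ` on `(Ω, μ)` with respect to `d`. Pairs
`y = φ t x` with `|t| < δ` are left out: such points never separate. -/
def HasPD {Ω : Type*} [MeasurableSpace Ω] (μ : Measure Ω) (φ : ℝ → Ω → Ω) (d : Ω → Ω → ℝ) :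
    Prop :=
  ∃ c₀ ∈ Ioo (0 : ℝ) 1, ∃ c₁ ∈ Ioo (0 : ℝ) 1, ∀ ε : ℝ, 0 < ε →
    ∃ Z : Set Ω, MeasurableSet Z ∧ 1 - ε < μ.real Z ∧ ∃ δ : ℝ, 0 < δ ∧
      ∀ x ∈ Z, ∀ y ∈ Z, d x y < δ → (∀ t : ℝ, |t| < δ → φ t x ≠ y) →
        ENNReal.ofReal c₁ * volume (closeInterval φ d x y) <
          volume {t ∈ closeInterval φ d x y | c₀ < d (φ t x) (φ t y)}

/-! ### Arnol'd flows -/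

/-- The rotation `x ↦ x + α` of the circle `ℝ/ℤ`. -/
def circleRotation (α : ℝ) : Equiv.Perm UnitAddCircle := Equiv.addRight (α : UnitAddCircle)

/-- The denominators `q_n` (`q_0 = 1`) of the continued fraction convergents of `α`. -/
def cfDenom (α : ℝ) (n : ℕ) : ℝ := (GenContFract.of α).dens n

/-- The set `𝒟` of irrational `α` with `q_{n+1} ≤ C(α) q_n log q_n (log n)²` for `n ≥ 2`. -/
def diophD : Set ℝ :=
  {α | Irrational α ∧ ∃ C : ℝ, ∀ n : ℕ, 2 ≤ n →
    cfDenom α (n + 1) ≤ C * (cfDenom α n * Real.log (cfDenom α n) * Real.log n ^ 2)}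

/-- `K_α = {n : q_{n+1} ≤ q_n (log q_n)^(7/8)}`. -/
def goodIndices (α : ℝ) : Set ℕ :=
  {n | cfDenom α (n + 1) ≤ cfDenom α n * Real.log (cfDenom α n) ^ (7 / 8 : ℝ)}

/-- The set `ℰ` of irrational `α` with `∑_{i ∉ K_α} (log q_i)^(-7/8) < ∞`
(over `i ≥ 2`, so that `log q_i > 0`). -/
def diophE : Set ℝ :=
  {α | Irrational α ∧ Summable fun i : {i : ℕ // 2 ≤ i ∧ i ∉ goodIndices α} =>
    Real.log (cfDenom α i) ^ (-(7 / 8) : ℝ)}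

/-- Roof functions of Arnol'd flows: `f > 0` on the circle with integral `1`, of class `C²` off `0`,
with an asymmetric logarithmic singularity at `0`. The value at the point `0` is an arbitrary
positive number. `fun x : ℝ => f x` is the lift of `f` to the line. -/
structure IsArnoldRoof (f : UnitAddCircle → ℝ) : Prop where
  pos : ∀ x, 0 < f x
  contDiffOn : ContDiffOn ℝ 2 (fun x : ℝ => f x) (Ioo 0 1)
  integral_eq_one : ∫ x, f x = 1
  singularity : ∃ A₁ A₂ A₃ B₁ B₂ B₃ : ℝ,
    (0 < A₁ ∧ 0 < A₂ ∧ 0 < A₃ ∧ 0 < B₁ ∧ 0 < B₂ ∧ 0 < B₃) ∧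
    (A₁ ≠ B₁ ∧ A₂ ≠ B₂ ∧ A₃ ≠ B₃) ∧
    Tendsto (fun x : ℝ => f x / (-Real.log x)) (𝓝[>] 0) (𝓝 A₁) ∧
    Tendsto (fun x : ℝ => f x / (-Real.log (1 - x))) (𝓝[<] 1) (𝓝 B₁) ∧
    Tendsto (fun x : ℝ => deriv (fun z : ℝ => f z) x / (1 / x)) (𝓝[>] 0) (𝓝 (-A₂)) ∧
    Tendsto (fun x : ℝ => deriv (fun z : ℝ => f z) x / (1 / (1 - x))) (𝓝[<] 1) (𝓝 B₂) ∧
    Tendsto (fun x : ℝ => deriv (deriv fun z : ℝ => f z) x / (1 / x ^ 2)) (𝓝[>] 0) (𝓝 A₃) ∧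
    Tendsto (fun x : ℝ => deriv (deriv fun z : ℝ => f z) x / (1 / (1 - x) ^ 2)) (𝓝[<] 1)
      (𝓝 B₃)

end

/-!
The reason for both kinds of divergence is the asymmetry of the singularity. By the mean value
theorem the difference `D n = f^(n)(x) - f^(n)(y)` of Birkhoff sums is `x - y` times a Birkhoff sum
of `f'`, and `f'(t)` behaves like `-A / t` to the right and like `B / (1 - t)` to the left of the
singularity, with `A ≠ B`. As `q` consecutive points of a rotation are distributed like the
fractions `j / q`, the Birkhoff sums of `f'` up to time `n ≈ N` are
`(B - A) n log N + o(N log N)`, up to the contribution of the very close visits to the singularity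
(`IsArnoldRoof.abs_sum_deriv_sub_le`). For `N` with `|x - y| N log N ≈ const`, `D` is therefore
almost linear on `|n| ≤ R N`, with a total variation bounded away from `0`, as long as there are no
such visits.

The arithmetic conditions control these visits. Let `q_s ≤ 4 R N < q_{s+1}`. If `q_{s+1}` is at most
`N (log N)^(15/16)`, then two of the times `|k| ≤ R N` at which `x + k α` is closer to `0` than a
constant times `1 / (N log N)` would give a multiple of `α` too close to an integer: there is at
most one such time `b` (`IsScale.exists_exceptional`). Otherwise `s ∉ K_α`. By the summability
condition the points whose orbits come too close to `0` in the times `0 ≤ k < q_i` for some large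
`i ∉ K_α` form a set of small measure; for all others the whole orbit segment `|k| ≤ R N` stays away
from `0`, since it is within small multiples of `‖q_s α‖` of its first `q_s` points
(`IsScale.distInt_ge_of_slow`). Altogether `D` is almost linear except for a jump at a single
exceptional index `b` (`exists_isAlmostLinear`). Forward time is free of this index if `b < 0`, and
backward time if `b ≥ 0`, so that on one side `D` drifts away from `0` linearly; on the other side
`D` cannot stay small either, since one of two adjacent windows avoids `b`. This is the divergence
of Birkhoff sums (`cocycleDivergence_of_arnold`).

For the flow, the `d^f`-distance of two orbits that started at heights `s` and `s'` is governed by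
`|D n - (s - s')|`, where `n` is the larger of the two numbers of crossed fibres
(`SpecialFlow.pseudoDist_flow_bounds`); the three terms in the definition of `d^f` correspond to
fibre counts that are equal or differ by one. On the good side this gives a time interval of length
comparable to `N` on which the orbits are close but more than `c₀` apart
(`SpecialFlow.exists_far_interval`). It remains to see that they do not stay close for longer than
`O(N)` in either direction. At the jump the orbits could a priori change to another relative
position with different fibre counts. They are therefore compared at the times when one of them is
in the middle of a very high fibre: the other one must then be in a high fibre too, hence close to
the singularity. Two points of an orbit that are both so close to the singularity cannot be
`k = O(log N)` steps apart, because `‖k α‖ ≥ c / k⁴`; but the fibre counts differ by `O(log N)`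
only, so that they agree (`IsArnoldRoof.eventually_abs_birkhoffDiff_sub_lt`). Two such times in a
window that avoids `b` contradict the linear growth of `D`. Finally `O(N)` fibres are crossed in time `O(N)`
(`IsArnoldRoof.exists_birkhoff_le`), with a constant that does not depend on `ε`.
-/

noncomputable section

/-! ### Convergents of an irrational number -/

/-- `p n / q n` are the convergents of `α`: reduced fractions with increasing denominators and
`|q_n α - p_n| ≤ 1 / q_{n+1}`. -/
structure IsConvergents (α : ℝ) (p : ℕ → ℤ) (q : ℕ → ℕ) : Prop where
  pos : ∀ n, 0 < q n
  mono : Monotone q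
  le_add_one : ∀ n, n ≤ q n + 1
  coprime : ∀ n, IsCoprime (p n) (q n : ℤ)
  approx : ∀ n, |q n * α - p n| ≤ 1 / q (n + 1)

theorem exists_int_contsAux (α : ℝ) (n : ℕ) :
    (∃ a b : ℤ, (GenContFract.of α).contsAux n = ⟨(a : ℝ), (b : ℝ)⟩) ∧
      ∃ a b : ℤ, (GenContFract.of α).contsAux (n + 1) = ⟨(a : ℝ), (b : ℝ)⟩ := by
  induction n with
  | zero =>
    refine ⟨⟨1, 0, by simp⟩, ⌊α⌋, 1, ?_⟩
    rw [GenContFract.first_contAux_eq_h_one, GenContFract.of_h_eq_floor]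
    simp
  | succ n ih =>
    refine ⟨ih.2, ?_⟩
    obtain ⟨⟨a, b, h1⟩, a', b', h2⟩ := ih
    rcases h : (GenContFract.of α).s.get? n with _ | gp
    · refine ⟨a', b', ?_⟩
      rw [← h2]
      exact GenContFract.contsAux_stable_step_of_terminated h
    · obtain ⟨h3, z, h4⟩ := GenContFract.of_partNum_eq_one_and_exists_int_partDen_eq h
      refine ⟨z * a' + a, z * b' + b, ?_⟩
      rw [GenContFract.contsAux_recurrence h h1 h2, h3, h4]
      simp

theorem exists_isConvergents {α : ℝ} (hα : Irrational α) :
    ∃ (p : ℕ → ℤ) (q : ℕ → ℕ), (∀ n, cfDenom α n = q n) ∧ IsConvergents α p q := by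
  have hterm : ∀ n, ¬(GenContFract.of α).TerminatedAt n := by
    intro n hn
    obtain ⟨r, hr⟩ := (GenContFract.terminates_iff_rat α).1 ⟨n, hn⟩
    exact hα ⟨r, hr.symm⟩
  have hint : ∀ n, ∃ a b : ℤ, (GenContFract.of α).nums n = a ∧ (GenContFract.of α).dens n = b := by
    intro n
    obtain ⟨a, b, h⟩ := (exists_int_contsAux α n).2
    refine ⟨a, b, ?_, ?_⟩
    · rw [GenContFract.num_eq_conts_a, GenContFract.nth_cont_eq_succ_nth_contAux, h]
    · rw [GenContFract.den_eq_conts_b, GenContFract.nth_cont_eq_succ_nth_contAux, h]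
  choose p b hp hb using hint
  have hfib : ∀ n, (Nat.fib (n + 1) : ℤ) ≤ b n := by
    intro n
    have := GenContFract.succ_nth_fib_le_of_nth_den (v := α) (n := n) (Or.inr (hterm _))
    rw [hb] at this
    exact_mod_cast this
  have hb0 : ∀ n, 0 < b n := fun n =>
    lt_of_lt_of_le (by exact_mod_cast Nat.fib_pos.2 n.succ_pos) (hfib n)
  have hq : ∀ n, ((b n).toNat : ℤ) = b n := fun n => Int.toNat_of_nonneg (hb0 n).le
  have hqr : ∀ n, ((b n).toNat : ℝ) = b n := fun n => by exact_mod_cast hq n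
  refine ⟨p, fun n => (b n).toNat, fun n => ?_, ?_, ?_, ?_, ?_, ?_⟩
  · rw [hqr, ← hb]; rfl
  · intro n; have := hb0 n; simp only [Int.lt_toNat]; exact_mod_cast this
  · refine monotone_nat_of_le_succ fun n => ?_
    have h := GenContFract.of_den_mono (v := α) (n := n)
    rw [hb, hb] at h
    exact Int.toNat_le_toNat (by exact_mod_cast h)
  · intro n
    have h1 := hfib n
    rw [← hq] at h1
    have h2 : Nat.fib (n + 1) ≤ (b n).toNat := by exact_mod_cast h1
    have h3 := Nat.le_fib_add_one n
    have h4 := Nat.fib_le_fib_succ (n := n)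
    omega
  · intro n
    have h : (GenContFract.of α).nums n * (GenContFract.of α).dens (n + 1) -
      (GenContFract.of α).dens n * (GenContFract.of α).nums (n + 1) = (-1) ^ (n + 1) :=
      SimpContFract.determinant (s := SimpContFract.of α) (hterm n)
    rw [hb, hb, hp, hp] at h
    have h' : p n * b (n + 1) - b n * p (n + 1) = (-1) ^ (n + 1) := by exact_mod_cast h
    rw [hq]
    refine ⟨(-1) ^ (n + 1) * b (n + 1), -((-1) ^ (n + 1) * p (n + 1)), ?_⟩
    have h5 : ((-1 : ℤ) ^ (n + 1)) * (-1) ^ (n + 1) = 1 := by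
      rw [← mul_pow]; simp
    linear_combination (-1) ^ (n + 1) * h' + h5
  · intro n
    have h := GenContFract.abs_sub_convs_le (hterm n)
    rw [GenContFract.conv_eq_num_div_den, hb, hb, hp] at h
    have h1 : (0 : ℝ) < b n := by exact_mod_cast hb0 n
    have h2 : (0 : ℝ) < b (n + 1) := by exact_mod_cast hb0 (n + 1)
    rw [hqr, hqr]
    have e : (b n : ℝ) * α - p n = b n * (α - p n / b n) := by field_simp
    rw [e, abs_mul, abs_of_pos h1]
    calc (b n : ℝ) * |α - p n / b n| ≤ b n * (1 / (b n * b (n + 1))) := by gcongr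
      _ = 1 / b (n + 1) := by field_simp

theorem IsConvergents.one_le {α : ℝ} {p : ℕ → ℤ} {q : ℕ → ℕ} (h : IsConvergents α p q) (n : ℕ) :
    (1 : ℝ) ≤ q n := by exact_mod_cast h.pos n

theorem IsConvergents.abs_le {α : ℝ} {p : ℕ → ℤ} {q : ℕ → ℕ} (h : IsConvergents α p q) (n : ℕ) :
    |q n * α - p n| ≤ 1 / q n :=
  (h.approx n).trans (one_div_le_one_div_of_le (by exact_mod_cast h.pos n)
    (by exact_mod_cast h.mono n.le_succ))

theorem IsConvergents.exists_lt_le {α : ℝ} {p : ℕ → ℤ} {q : ℕ → ℕ} (h : IsConvergents α p q)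
    {X : ℝ} (h0 : q 0 ≤ X) : ∃ n, q n ≤ X ∧ X < q (n + 1) := by
  have hex : ∃ n, X < q n := by
    obtain ⟨n, hn⟩ := exists_nat_gt (X + 1)
    refine ⟨n, ?_⟩
    have : (n : ℝ) ≤ q n + 1 := by exact_mod_cast h.le_add_one n
    linarith
  classical
  have hpos : Nat.find hex ≠ 0 := fun h1 => by
    have := Nat.find_spec hex; rw [h1] at this; linarith
  refine ⟨Nat.find hex - 1, ?_, ?_⟩
  · exact not_lt.1 (Nat.find_min hex (by omega))
  · have := Nat.find_spec hex
    rwa [Nat.sub_add_cancel (by omega)]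

/-- The Diophantine condition in the form in which it is used: the denominators grow by at most
logarithmic factors. -/
theorem exists_growth_of_mem_diophD {α : ℝ} (hD : α ∈ diophD) {p : ℕ → ℤ} {q : ℕ → ℕ}
    (hq : ∀ n, cfDenom α n = q n) (h : IsConvergents α p q) :
    ∃ C : ℝ, 1 ≤ C ∧ ∀ n, 3 ≤ n → (q (n + 1) : ℝ) ≤ C * (q n * Real.log (q n) ^ 3) := by
  obtain ⟨C, hC⟩ := hD.2
  refine ⟨4 * max C 1, by linarith [le_max_right C 1], fun n hn => ?_⟩
  have h1 := hC n (by omega)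
  rw [hq, hq] at h1
  have h2 : (n : ℝ) ≤ q n + 1 := by exact_mod_cast h.le_add_one n
  have h3 : (3 : ℝ) ≤ n := by exact_mod_cast hn
  have hq2 : (2 : ℝ) ≤ q n := by linarith
  have hl : 0 ≤ Real.log (q n) := Real.log_nonneg (by linarith)
  have hn0 : 0 ≤ Real.log n := Real.log_nonneg (by linarith)
  have h4 : Real.log n ≤ 2 * Real.log (q n) := by
    have h5 : Real.log ((q n : ℝ) ^ 2) = 2 * Real.log (q n) := by rw [Real.log_pow]; norm_num
    rw [← h5]
    exact Real.log_le_log (by linarith) (by nlinarith)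
  have h5 : Real.log n ^ 2 ≤ 4 * Real.log (q n) ^ 2 := by nlinarith
  have hpos : 0 ≤ (q n : ℝ) * Real.log (q n) := by positivity
  calc (q (n + 1) : ℝ) ≤ C * (q n * Real.log (q n) * Real.log n ^ 2) := h1
    _ ≤ max C 1 * (q n * Real.log (q n) * Real.log n ^ 2) := by
        gcongr; exact le_max_left _ _
    _ ≤ max C 1 * (q n * Real.log (q n) * (4 * Real.log (q n) ^ 2)) := by gcongr
    _ = _ := by ring

/-! ### Distance to the nearest integer and rational rotations -/

/-- The distance from a real number to the nearest integer, as a norm on the circle. -/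
def distInt (t : ℝ) : ℝ := ‖(t : UnitAddCircle)‖

theorem distInt_nonneg (t : ℝ) : 0 ≤ distInt t := norm_nonneg _

theorem distInt_eq (t : ℝ) : distInt t = |t - round t| := UnitAddCircle.norm_eq

theorem distInt_le (t : ℝ) (z : ℤ) : distInt t ≤ |t - z| := by
  rw [distInt_eq]; exact round_le t z

theorem distInt_le_abs (t : ℝ) : distInt t ≤ |t| := by simpa using distInt_le t 0

theorem distInt_le_half (t : ℝ) : distInt t ≤ 1 / 2 := by
  rw [distInt_eq]; exact abs_sub_round t

theorem distInt_neg (t : ℝ) : distInt (-t) = distInt t := by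
  unfold distInt; rw [AddCircle.coe_neg, norm_neg]

theorem distInt_add_le (s t : ℝ) : distInt (s + t) ≤ distInt s + distInt t := by
  unfold distInt; rw [AddCircle.coe_add]; exact norm_add_le _ _

theorem distInt_sub_le (s t : ℝ) : distInt (s - t) ≤ distInt s + distInt t := by
  unfold distInt; rw [AddCircle.coe_sub]; exact norm_sub_le _ _

theorem distInt_mul_le (m : ℤ) (t : ℝ) : distInt (m * t) ≤ |(m : ℝ)| * distInt t := by
  rw [distInt_eq t, ← abs_mul]
  have := distInt_le (m * t) (m * round t)
  push_cast at this
  rwa [mul_sub]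

theorem distInt_eq_min (t : ℝ) : distInt t = min (Int.fract t) (1 - Int.fract t) := by
  rw [distInt_eq]; exact abs_sub_round_eq_min t

theorem fract_pos_of_distInt_pos {t : ℝ} (h : 0 < distInt t) : 0 < Int.fract t := by
  rw [distInt_eq_min] at h; exact (lt_min_iff.1 h).1

/-- Multiples `m α` with `2 |m| ≤ q` stay `1 / (2q)` away from the integers, `p / q` being a
convergent of `α`: the rational numbers `m p / q` are not integers. -/
theorem distInt_mul_ge {α : ℝ} {p : ℤ} {q : ℕ} (hq : 0 < q) (hc : IsCoprime p (q : ℤ))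
    (ha : |q * α - p| ≤ 1 / q) {m : ℤ} (hm : m ≠ 0) (hmq : 2 * |m| ≤ q) :
    1 / (2 * q) ≤ distInt (m * α) := by
  have hq' : (0 : ℝ) < q := by exact_mod_cast hq
  rw [distInt_eq]
  set z := round (m * α)
  have h1 : m * p - z * q ≠ 0 := by
    intro h
    have h2 : (q : ℤ) ∣ m * p := ⟨z, by linarith⟩
    have h3 : (q : ℤ) ∣ m := hc.symm.dvd_of_dvd_mul_right h2
    have h4 := Int.le_of_dvd (abs_pos.2 hm) ((dvd_abs _ _).2 h3)
    have := abs_pos.2 hm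
    omega
  have h2 : (1 : ℝ) ≤ |((m * p - z * q : ℤ) : ℝ)| := by
    rw [← Int.cast_abs]; exact_mod_cast Int.one_le_abs h1
  have h3 : |(m : ℝ) * (q * α - p)| ≤ 1 / 2 := by
    rw [abs_mul]
    have : 2 * |(m : ℝ)| ≤ q := by rw [← Int.cast_abs]; exact_mod_cast hmq
    calc |(m : ℝ)| * |q * α - p| ≤ (q / 2) * (1 / q) := by
          gcongr; linarith
      _ = 1 / 2 := by field_simp
  have h4 : (q : ℝ) * (m * α - z) = ((m * p - z * q : ℤ) : ℝ) + m * (q * α - p) := by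
    push_cast; ring
  have h5 : 1 / 2 ≤ |(q : ℝ) * (m * α - z)| := by
    rw [h4]
    have := abs_sub_abs_le_abs_add ((m * p - z * q : ℤ) : ℝ) (m * (q * α - p))
    linarith
  rw [abs_mul, abs_of_pos hq'] at h5
  rw [div_le_iff₀ (by positivity)]
  linarith

/-- `q` consecutive orbit points of the rotation by `α` are in bijection with the fractions `j / q`,
each at distance `O(1/q)` from its partner. -/
theorem exists_bijOn_rotation {α : ℝ} {p : ℤ} {q : ℕ} (hq : 0 < q) (hc : IsCoprime p (q : ℤ))
    (ha : |q * α - p| ≤ 1 / q) (x : ℝ) :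
    ∃ σ : ℕ → ℕ, BijOn σ (Finset.range q : Set ℕ) (Finset.range q : Set ℕ) ∧
      ∀ k < q, ∃ z : ℤ, (σ k : ℝ) - 1 < q * (x + k * α - z) ∧
        q * (x + k * α - z) < σ k + 2 := by
  have hq' : (0 : ℝ) < q := by exact_mod_cast hq
  have hqz : (0 : ℤ) < q := by exact_mod_cast hq
  set i := ⌊q * x⌋ with hi
  have hmod : ∀ k : ℕ, (((i + k * p) % q).toNat : ℤ) = (i + k * p) % q := fun k =>
    Int.toNat_of_nonneg (Int.emod_nonneg _ hqz.ne')
  have hmaps : MapsTo (fun k : ℕ => ((i + k * p) % q).toNat) (Finset.range q : Set ℕ)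
      (Finset.range q : Set ℕ) := by
    intro k _
    have h1 := Int.emod_lt_of_pos (i + k * p) hqz
    have h2 := hmod k
    simp only [Finset.coe_range, mem_Iio]
    omega
  have hinj : InjOn (fun k : ℕ => ((i + k * p) % q).toNat) (Finset.range q : Set ℕ) := by
    intro k hk l hl h
    simp only [Finset.coe_range, mem_Iio] at hk hl
    have h1 : (i + k * p) % q = (i + l * p) % q := by
      rw [← hmod k, ← hmod l]; exact_mod_cast h
    have h2 : (q : ℤ) ∣ (k - l) * p := by
      have := Int.ModEq.dvd (show i + l * p ≡ i + k * p [ZMOD q] from h1.symm)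
      have e : i + k * p - (i + l * p) = ((k : ℤ) - l) * p := by ring
      rwa [e] at this
    have h3 : (q : ℤ) ∣ k - l := hc.symm.dvd_of_dvd_mul_right h2
    by_contra hne
    have h4 := Int.le_of_dvd (abs_pos.2 (sub_ne_zero.2 (by exact_mod_cast hne : (k : ℤ) ≠ l)))
      ((dvd_abs _ _).2 h3)
    have h5 : |(k : ℤ) - l| < q := by rw [abs_lt]; constructor <;> omega
    omega
  refine ⟨_, ⟨hmaps, hinj, ?_⟩, fun k hk => ⟨(i + k * p) / q, ?_⟩⟩
  · exact Finset.surjOn_of_injOn_of_card_le _ hmaps hinj le_rfl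
  · have h1 : ((((i + k * p) % q).toNat : ℕ) : ℝ) = (((i + k * p) % q : ℤ) : ℝ) := by
      exact_mod_cast hmod k
    have h2 : (((i + k * p) % q : ℤ) : ℝ) + q * (((i + k * p) / q : ℤ) : ℝ) = i + k * p := by
      exact_mod_cast Int.emod_add_mul_ediv (i + k * p) q
    have h3 : |(k : ℝ) * (q * α - p)| < 1 := by
      rw [abs_mul, Nat.abs_cast]
      calc (k : ℝ) * |q * α - p| ≤ k * (1 / q) := by gcongr
        _ < q * (1 / q) := by
          have : (k : ℝ) < q := by exact_mod_cast hk
          gcongr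
        _ = 1 := by field_simp
    have h4 : (i : ℝ) ≤ q * x := Int.floor_le _
    have h5 : q * x < i + 1 := Int.lt_floor_add_one _
    have h6 := abs_lt.1 h3
    have e : q * (x + k * α - (((i + k * p) / q : ℤ) : ℝ)) = (((i + k * p) % q : ℤ) : ℝ) +
      (q * x - i) + k * (q * α - p) := by linear_combination - h2
    simp only [h1, e]
    constructor <;> linarith [h6.1, h6.2]

/-- Every `q` consecutive orbit points contain one at distance at most `2 / q` from `0`. -/
theorem exists_distInt_le {α : ℝ} {p : ℤ} {q : ℕ} (hq : 0 < q) (hc : IsCoprime p (q : ℤ))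
    (ha : |q * α - p| ≤ 1 / q) (x : ℝ) : ∃ k < q, distInt (x + k * α) ≤ 2 / q := by
  obtain ⟨σ, hσ, h⟩ := exists_bijOn_rotation hq hc ha x
  have hq' : (0 : ℝ) < q := by exact_mod_cast hq
  obtain ⟨k, hk, hk0⟩ := hσ.surjOn (show 0 ∈ (Finset.range q : Set ℕ) by simpa using hq)
  have hk' : k < q := by simpa using hk
  obtain ⟨z, h1, h2⟩ := h k hk'
  rw [hk0] at h1 h2
  refine ⟨k, hk', (distInt_le _ z).trans ?_⟩
  rw [le_div_iff₀ hq', ← abs_of_pos hq', ← abs_mul, mul_comm, abs_le]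
  push_cast at h1 h2
  constructor <;> linarith

/-- An orbit point whose partner `j / q` is away from `0` and `1` has a fractional part near
`j / q`. -/
theorem fract_bounds {t : ℝ} {q j : ℕ} (hq : 0 < q) {z : ℤ} (h1 : (j : ℝ) - 1 < q * (t - z))
    (h2 : q * (t - z) < j + 2) (hj1 : 2 ≤ j) (hj2 : j + 2 ≤ q) :
    ((j : ℝ) - 1) / q < Int.fract t ∧ Int.fract t < (j + 2) / q := by
  have hq' : (0 : ℝ) < q := by exact_mod_cast hq
  have hj1' : (2 : ℝ) ≤ j := by exact_mod_cast hj1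
  have hj2' : (j : ℝ) + 2 ≤ q := by exact_mod_cast hj2
  have h3 : 0 < t - z := by
    by_contra h
    have : q * (t - z) ≤ 0 := mul_nonpos_of_nonneg_of_nonpos hq'.le (by linarith)
    linarith
  have h4 : t - z < 1 := by
    by_contra h
    have : (q : ℝ) * 1 ≤ q * (t - z) := by gcongr; linarith
    linarith
  have h5 : Int.fract t = t - z := by
    rw [Int.fract_eq_iff]; exact ⟨h3.le, h4, z, by ring⟩
  rw [h5, div_lt_iff₀ hq', lt_div_iff₀ hq']
  constructor <;> linarith

/-! ### Birkhoff sums over a block of length `q` -/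

theorem sum_range_fract_le {α : ℝ} {p : ℤ} {q : ℕ} (hq : 0 < q) (hc : IsCoprime p (q : ℤ))
    (ha : |q * α - p| ≤ 1 / q) (x : ℝ) {φ : ℝ → ℝ} {h : ℕ → ℝ} {B : ℝ} (hB : 0 ≤ B)
    (hh : ∀ j, 1 ≤ j → j ≤ q → 0 ≤ h j)
    (hφ : ∀ j : ℕ, 1 ≤ j → j ≤ q → ∀ s : ℝ, (j : ℝ) / q < s → s < 1 → φ s ≤ h j)
    (hφB : ∀ k < q, φ (Int.fract (x + k * α)) ≤ B) :
    ∑ k ∈ Finset.range q, φ (Int.fract (x + k * α)) ≤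
      3 * B + ∑ j ∈ Finset.range q, h (j + 1) := by
  obtain ⟨σ, hσ, hz⟩ := exists_bijOn_rotation hq hc ha x
  set g : ℕ → ℝ := fun j => (if j = 0 then B else 0) + (if j = 1 then B else 0) +
    (if j = q - 1 then B else 0) + if 2 ≤ j then h (j - 1) else 0 with hg
  have h0 : ∀ j, j < q → 0 ≤ (if 2 ≤ j then h (j - 1) else 0) := by
    intro j hj
    split_ifs with h2
    · exact hh _ (by omega) (by omega)
    · exact le_rfl
  have hB' : ∀ (P : Prop) [Decidable P], 0 ≤ (if P then B else 0) := by
    intro P _; split_ifs <;> simp [hB]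
  have h1 : ∀ k ∈ Finset.range q, φ (Int.fract (x + k * α)) ≤ g (σ k) := by
    intro k hk
    have hk' : k < q := by simpa using hk
    have hσk : σ k < q := by simpa using hσ.mapsTo (by simpa using hk')
    have hb := hφB k hk'
    have e0 := hB' (σ k = 0)
    have e1 := hB' (σ k = 1)
    have e2 := hB' (σ k = q - 1)
    have e3 := h0 _ hσk
    by_cases c0 : σ k = 0
    · simp only [hg, if_pos c0]; linarith
    by_cases c1 : σ k = 1
    · simp only [hg, if_pos c1]; linarith
    by_cases c2 : σ k = q - 1
    · simp only [hg, if_pos c2]; linarith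
    obtain ⟨z, hz1, hz2⟩ := hz k hk'
    have hf := (fract_bounds hq hz1 hz2 (by omega) (by omega)).1
    have := hφ (σ k - 1) (by omega) (by omega) _
      (by rw [Nat.cast_sub (by omega)]; simpa using hf) (Int.fract_lt_one _)
    simp only [hg, if_neg c0, if_neg c1, if_neg c2, if_pos (show 2 ≤ σ k by omega)]
    linarith
  have h2 : ∑ k ∈ Finset.range q, g (σ k) = ∑ j ∈ Finset.range q, g j :=
    Finset.sum_nbij σ hσ.mapsTo hσ.injOn hσ.surjOn (fun _ _ => rfl)
  have h3 : ∑ j ∈ Finset.range q, (if 2 ≤ j then h (j - 1) else 0) ≤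
      ∑ j ∈ Finset.range q, h (j + 1) := by
    obtain ⟨r, rfl⟩ : ∃ r, q = r + 1 := ⟨q - 1, by omega⟩
    rw [Finset.sum_range_succ']
    simp only [add_tsub_cancel_right]
    rw [if_neg (by norm_num), add_zero]
    rcases r with _ | r
    · simpa using hh 1 le_rfl le_rfl
    rw [Finset.sum_range_succ', if_neg (by norm_num), add_zero]
    calc ∑ k ∈ Finset.range r, (if 2 ≤ k + 1 + 1 then h (k + 1) else 0)
        = ∑ k ∈ Finset.range r, h (k + 1) :=
          Finset.sum_congr rfl fun k _ => if_pos (by omega)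
      _ ≤ ∑ k ∈ Finset.range (r + 1 + 1), h (k + 1) := by
          apply Finset.sum_le_sum_of_subset_of_nonneg
          · intro k hk; simp at hk ⊢; omega
          · intro k hk _; simp at hk; exact hh _ (by omega) (by omega)
  have hs : ∀ i, ∑ j ∈ Finset.range q, (if j = i then B else 0) ≤ B := by
    intro i
    rw [Finset.sum_ite_eq']
    exact (by split_ifs <;> simp [hB])
  calc _ ≤ ∑ k ∈ Finset.range q, g (σ k) := Finset.sum_le_sum h1
    _ = ∑ j ∈ Finset.range q, g j := h2
    _ ≤ _ := by
      simp only [hg, Finset.sum_add_distrib]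
      linarith [hs 0, hs 1, hs (q - 1)]

/-- The function `1 / {t}`, cut off to `0` where `{t} < 1 / q`. -/
def truncInv (q : ℕ) (t : ℝ) : ℝ := if 1 / (q : ℝ) ≤ Int.fract t then 1 / Int.fract t else 0

theorem truncInv_nonneg (q : ℕ) (t : ℝ) : 0 ≤ truncInv q t := by
  unfold truncInv; split_ifs
  · exact one_div_nonneg.2 (Int.fract_nonneg t)
  · exact le_rfl

theorem truncInv_fract (q : ℕ) (t : ℝ) : truncInv q (Int.fract t) = truncInv q t := by
  unfold truncInv; rw [Int.fract_fract]

theorem sum_inv_add_one (q : ℕ) :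
    ∑ j ∈ Finset.range q, 1 / ((j : ℝ) + 1) = harmonic q := by
  unfold harmonic; push_cast; simp

theorem sum_range_truncInv_le {α : ℝ} {p : ℤ} {q : ℕ} (hq : 0 < q) (hc : IsCoprime p (q : ℤ))
    (ha : |q * α - p| ≤ 1 / q) (x : ℝ) :
    ∑ k ∈ Finset.range q, truncInv q (x + k * α) ≤ q * (Real.log q + 4) := by
  have hq' : (0 : ℝ) < q := by exact_mod_cast hq
  have h := sum_range_fract_le hq hc ha x (φ := truncInv q) (h := fun j => q / j) (B := q) hq'.le
    (fun j _ _ => by positivity) ?_ ?_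
  · simp only [truncInv_fract] at h
    have e : ∑ j ∈ Finset.range q, (q : ℝ) / ((j + 1 : ℕ) : ℝ) = q * harmonic q := by
      rw [← sum_inv_add_one, Finset.mul_sum]
      refine Finset.sum_congr rfl fun j _ => ?_
      push_cast; ring
    rw [e] at h
    have h2 := harmonic_le_one_add_log q
    have : (q : ℝ) * harmonic q ≤ q * (1 + Real.log q) := by gcongr
    linarith
  · intro j hj _ s hs1 hs2
    have hj' : (0 : ℝ) < j := by exact_mod_cast hj
    have hs0 : 0 < s := lt_trans (by positivity) hs1
    have hfs : Int.fract s = s := Int.fract_eq_self.2 ⟨hs0.le, hs2⟩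
    unfold truncInv
    rw [hfs]
    split_ifs with h
    · rw [div_le_div_iff₀ hs0 hj']
      rw [div_lt_iff₀ hq'] at hs1
      linarith
    · positivity
  · intro k _
    rw [truncInv_fract]
    unfold truncInv
    split_ifs with h
    · have := one_div_le_one_div_of_le (by positivity) h
      simpa using this
    · positivity

theorem le_sum_range_truncInv {α : ℝ} {p : ℤ} {q : ℕ} (hq : 0 < q) (hc : IsCoprime p (q : ℤ))
    (ha : |q * α - p| ≤ 1 / q) (x : ℝ) :
    q * (Real.log q - 2) ≤ ∑ k ∈ Finset.range q, truncInv q (x + k * α) := by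
  have hq' : (0 : ℝ) < q := by exact_mod_cast hq
  obtain ⟨σ, hσ, hz⟩ := exists_bijOn_rotation hq hc ha x
  set g : ℕ → ℝ := fun j => if 2 ≤ j ∧ j + 2 ≤ q then (q : ℝ) / (j + 2) else 0 with hg
  have h1 : ∀ k ∈ Finset.range q, g (σ k) ≤ truncInv q (x + k * α) := by
    intro k hk
    have hk' : k < q := by simpa using hk
    simp only [hg]
    split_ifs with h
    · obtain ⟨z, hz1, hz2⟩ := hz k hk'
      obtain ⟨f1, f2⟩ := fract_bounds hq hz1 hz2 h.1 h.2
      have hj : (2 : ℝ) ≤ σ k := by exact_mod_cast h.1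
      have h3 : 1 / (q : ℝ) ≤ ((σ k : ℝ) - 1) / q := by gcongr; linarith
      have hf0 : 0 < Int.fract (x + k * α) := lt_of_lt_of_le (by positivity) (h3.trans f1.le)
      unfold truncInv
      rw [if_pos (h3.trans f1.le), div_le_div_iff₀ (by positivity) hf0]
      rw [lt_div_iff₀ hq'] at f2
      linarith
    · exact truncInv_nonneg _ _
  have h2 : ∑ k ∈ Finset.range q, g (σ k) = ∑ j ∈ Finset.range q, g j :=
    Finset.sum_nbij σ hσ.mapsTo hσ.injOn hσ.surjOn (fun _ _ => rfl)
  refine le_trans ?_ (Finset.sum_le_sum h1)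
  rw [h2]
  -- the sum is `q (1/4 + ⋯ + 1/q)`
  have h3 : (q : ℝ) * (harmonic q - 11 / 6) ≤ ∑ j ∈ Finset.range q, g j := by
    rcases le_or_gt q 3 with hq3 | hq3
    · have h0 : ∑ j ∈ Finset.range q, g j = 0 := by
        apply Finset.sum_eq_zero
        intro j hj
        simp only [hg]
        rw [if_neg (by omega)]
      rw [h0]
      have : (harmonic q : ℝ) ≤ 11 / 6 := by
        rw [← sum_inv_add_one]
        interval_cases q <;> simp [Finset.sum_range_succ] <;> norm_num
      nlinarith
    · obtain ⟨r, rfl⟩ : ∃ r, q = r + 3 := ⟨q - 3, by omega⟩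
      have e1 : (harmonic (r + 3) : ℝ) = ∑ j ∈ Finset.range r, 1 / ((j : ℝ) + 4) + 11 / 6 := by
        rw [← sum_inv_add_one, Finset.sum_range_succ', Finset.sum_range_succ',
          Finset.sum_range_succ']
        rw [show (11 / 6 : ℝ) = 1 / 3 + 1 / 2 + 1 by norm_num, ← add_assoc, ← add_assoc]
        congr 1
        · congr 1
          · congr 1
            · refine Finset.sum_congr rfl fun j _ => ?_
              push_cast; ring
            · norm_num
          · norm_num
        · norm_num
      rw [e1, add_sub_cancel_right, Finset.sum_range_succ', Finset.sum_range_succ',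
          Finset.sum_range_succ, Finset.mul_sum]
      have e2 : g 0 = 0 := by simp [hg]
      have e3 : g (0 + 1) = 0 := by simp [hg]
      have e4 : g (r + 1 + 1) = 0 := by simp [hg]
      rw [e2, e3, e4, add_zero, add_zero, add_zero]
      refine Finset.sum_le_sum fun j hj => ?_
      have hj' : j < r := by simpa using hj
      simp only [hg]
      rw [if_pos (by omega)]
      push_cast
      apply le_of_eq; ring
  have h4 : Real.log q ≤ harmonic q := by
    refine le_trans ?_ (log_add_one_le_harmonic q)
    exact Real.log_le_log hq' (by push_cast; linarith)
  refine le_trans ?_ h3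
  gcongr; linarith

theorem sum_log_div_le (q : ℕ) (hq : 0 < q) :
    ∑ j ∈ Finset.range q, Real.log (q / ((j + 1 : ℕ) : ℝ)) ≤ q := by
  have hq' : (0 : ℝ) < q := by exact_mod_cast hq
  rw [← Real.log_prod (fun j _ => by positivity), Finset.prod_div_distrib,
    Finset.prod_const, Finset.card_range, ← Nat.cast_prod, Finset.prod_range_add_one_eq_factorial,
    Real.log_le_iff_le_exp (by positivity)]
  exact Real.pow_div_factorial_le_exp _ hq'.le q

theorem sum_range_neg_log_le {α : ℝ} {p : ℤ} {q : ℕ} (hq : 0 < q) (hc : IsCoprime p (q : ℤ))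
    (ha : |q * α - p| ≤ 1 / q) (x : ℝ) {B : ℝ} (hB : 0 ≤ B)
    (h : ∀ k < q, -Real.log (Int.fract (x + k * α)) ≤ B) :
    ∑ k ∈ Finset.range q, -Real.log (Int.fract (x + k * α)) ≤ 3 * B + q := by
  have hq' : (0 : ℝ) < q := by exact_mod_cast hq
  have h' := sum_range_fract_le hq hc ha x (φ := fun s => -Real.log s)
    (h := fun j => Real.log (q / (j : ℝ))) hB ?_ ?_ h
  · linarith [sum_log_div_le q hq]
  · intro j h1 h2
    have : (0 : ℝ) < j := by exact_mod_cast h1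
    apply Real.log_nonneg
    rw [le_div_iff₀ this, one_mul]; exact_mod_cast h2
  · intro j h1 _ s hs1 _
    have hj : (0 : ℝ) < j := by exact_mod_cast h1
    have hs0 : 0 < s := lt_trans (by positivity) hs1
    rw [← Real.log_inv]
    apply Real.log_le_log (by positivity)
    rw [inv_le_comm₀ hs0 (by positivity), inv_div]
    exact hs1.le

/-! ### Birkhoff sums over long windows -/

theorem sum_range_le_of_blocks {u : ℕ → ℝ} (hu : ∀ k, 0 ≤ u k) {q : ℕ} (hq : 0 < q) {H : ℝ}
    (hH0 : 0 ≤ H)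
    {n : ℕ} (hH : ∀ i, i * q < n → ∑ k ∈ Finset.range q, u (i * q + k) ≤ H) :
    ∑ k ∈ Finset.range n, u k ≤ ((n : ℝ) / q + 1) * H := by
  have key : ∀ i, (i - 1) * q < n → ∑ k ∈ Finset.range (i * q), u k ≤ i * H := by
    intro i
    induction i with
    | zero => intro _; simp
    | succ i ih =>
      intro hi
      rw [add_mul, one_mul, Finset.sum_range_add]
      have h1 := ih (lt_of_le_of_lt (Nat.mul_le_mul_right _ (by omega)) hi)
      have h2 := hH i hi
      push_cast
      linarith
  have hq' : (0 : ℝ) < q := by exact_mod_cast hq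
  rcases Nat.eq_zero_or_pos n with rfl | hn
  · simpa using hH0
  set j := (n - 1) / q + 1 with hj
  have h1 : n ≤ j * q := by
    have := Nat.lt_div_mul_add (a := n - 1) hq
    rw [hj, add_mul, one_mul]; omega
  have h2 : (j - 1) * q < n := by
    have := Nat.div_mul_le_self (n - 1) q
    simp only [hj, Nat.add_sub_cancel]; omega
  calc ∑ k ∈ Finset.range n, u k ≤ ∑ k ∈ Finset.range (j * q), u k :=
        Finset.sum_le_sum_of_subset_of_nonneg (by simpa using h1) fun k _ _ => hu k
    _ ≤ j * H := key j h2
    _ ≤ _ := by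
      gcongr
      have : ((j - 1 : ℕ) : ℝ) * q ≤ n := by exact_mod_cast h2.le
      have e : (j : ℝ) = ((j - 1 : ℕ) : ℝ) + 1 := by simp [hj]
      rw [e]
      gcongr
      rwa [le_div_iff₀ hq']

theorem le_sum_range_of_blocks {u : ℕ → ℝ} (hu : ∀ k, 0 ≤ u k) {q : ℕ} {H : ℝ} (n : ℕ)
    (hH : ∀ i, H ≤ ∑ k ∈ Finset.range q, u (i * q + k)) :
    ((n / q : ℕ) : ℝ) * H ≤ ∑ k ∈ Finset.range n, u k := by
  have key : ∀ i : ℕ, i * H ≤ ∑ k ∈ Finset.range (i * q), u k := by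
    intro i
    induction i with
    | zero => simp
    | succ i ih =>
      rw [add_mul, one_mul, Finset.sum_range_add]
      have h2 := hH i
      push_cast
      linarith
  exact (key _).trans (Finset.sum_le_sum_of_subset_of_nonneg
    (by simpa using Nat.div_mul_le_self n q) fun k _ _ => hu k)

theorem abs_sum_truncInv_sub_le {α : ℝ} {p : ℤ} {q : ℕ} (hq : 0 < q) (hc : IsCoprime p (q : ℤ))
    (ha : |q * α - p| ≤ 1 / q) (x : ℝ) (n : ℕ) :
    |∑ k ∈ Finset.range n, truncInv q (x + k * α) - n * Real.log q| ≤
      4 * n + q * (Real.log q + 4) := by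
  have hq' : (0 : ℝ) < q := by exact_mod_cast hq
  have hl : 0 ≤ Real.log q := Real.log_natCast_nonneg q
  have e : ∀ i k : ℕ, x + ((i * q + k : ℕ) : ℝ) * α = (x + ((i * q : ℕ) : ℝ) * α) + k * α := by
    intro i k; push_cast; ring
  have h1 := sum_range_le_of_blocks (u := fun k => truncInv q (x + k * α))
    (fun k => truncInv_nonneg _ _) hq (n := n) (H := q * (Real.log q + 4)) (by positivity)
    (fun i _ => by
      simp only [e]; exact sum_range_truncInv_le hq hc ha _)
  have h2 := le_sum_range_of_blocks (u := fun k => truncInv q (x + k * α))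
    (fun k => truncInv_nonneg _ _) (q := q) n (H := q * (Real.log q - 2)) (fun i => by
      simp only [e]; exact le_sum_range_truncInv hq hc ha _)
  have e1 : ((n : ℝ) / q + 1) * (q * (Real.log q + 4)) =
      n * Real.log q + 4 * n + q * (Real.log q + 4) := by field_simp
  rw [e1] at h1
  have h3 : ((n / q : ℕ) : ℝ) * q ≤ n := by exact_mod_cast Nat.div_mul_le_self n q
  have h4 : (n : ℝ) ≤ ((n / q : ℕ) : ℝ) * q + q := by
    exact_mod_cast (Nat.lt_div_mul_add (a := n) hq).le
  have h5 : (n : ℝ) * Real.log q ≤ (((n / q : ℕ) : ℝ) * q + q) * Real.log q := by gcongr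
  have hn : (0 : ℝ) ≤ n := Nat.cast_nonneg n
  rw [abs_le]
  constructor <;> nlinarith

/-! ### Sums of inverse distances of separated orbit points -/

theorem sum_inv_le_of_separated {T : Finset ℤ} {v : ℤ → ℝ} {ρ d D : ℝ} (hρ : 0 < ρ) (hd : 0 < d)
    (hρD : ρ ≤ D) (hsep : ∀ k ∈ T, ∀ l ∈ T, k ≠ l → ρ ≤ |v k - v l|)
    (hv : ∀ k ∈ T, d ≤ v k ∧ v k ≤ D) :
    ∑ k ∈ T, 1 / v k ≤ 1 / d + 1 / ρ * (1 + Real.log (D / ρ)) := by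
  set g : ℕ → ℝ := fun j => if j = 0 then 1 / d else 1 / (ρ * j) with hg
  set J := ⌊D / ρ⌋₊ with hJ
  have hinj : InjOn (fun k => ⌊v k / ρ⌋₊) (T : Set ℤ) := by
    intro k hk l hl h
    by_contra hne
    have hk0 : 0 ≤ v k / ρ := div_nonneg (hd.le.trans (hv k hk).1) hρ.le
    have hl0 : 0 ≤ v l / ρ := div_nonneg (hd.le.trans (hv l hl).1) hρ.le
    simp only at h
    have h1 := Nat.floor_le hk0
    have h2 := Nat.lt_floor_add_one (v k / ρ)
    have h3 := Nat.floor_le hl0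
    have h4 := Nat.lt_floor_add_one (v l / ρ)
    rw [h] at h1 h2
    have h5 : |v k / ρ - v l / ρ| < 1 := by rw [abs_lt]; constructor <;> linarith
    rw [← sub_div, abs_div, abs_of_pos hρ, div_lt_one hρ] at h5
    linarith [hsep k hk l hl hne]
  have hle : ∀ k ∈ T, 1 / v k ≤ g ⌊v k / ρ⌋₊ := by
    intro k hk
    obtain ⟨h1, h2⟩ := hv k hk
    have hk0 : 0 ≤ v k / ρ := div_nonneg (hd.le.trans h1) hρ.le
    simp only [hg]
    split_ifs with h
    · exact one_div_le_one_div_of_le hd h1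
    · have h3 : (0 : ℝ) < ⌊v k / ρ⌋₊ := by exact_mod_cast Nat.pos_of_ne_zero h
      apply one_div_le_one_div_of_le (by positivity)
      have := Nat.floor_le hk0
      rw [le_div_iff₀ hρ] at this
      linarith
  have hg0 : ∀ j, 0 ≤ g j := by intro j; simp only [hg]; split_ifs <;> positivity
  calc ∑ k ∈ T, 1 / v k ≤ ∑ k ∈ T, g ⌊v k / ρ⌋₊ := Finset.sum_le_sum hle
    _ = ∑ j ∈ T.image fun k => ⌊v k / ρ⌋₊, g j := (Finset.sum_image hinj).symm
    _ ≤ ∑ j ∈ Finset.range (J + 1), g j := by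
      apply Finset.sum_le_sum_of_subset_of_nonneg
      · intro j hj
        obtain ⟨k, hk, rfl⟩ := Finset.mem_image.1 hj
        rw [Finset.mem_range, Nat.lt_succ_iff]
        exact Nat.floor_le_floor (by have := (hv k hk).2; gcongr)
      · intro j _ _; exact hg0 j
    _ = 1 / ρ * harmonic J + 1 / d := by
      rw [Finset.sum_range_succ', ← sum_inv_add_one, Finset.mul_sum]
      congr 1
      refine Finset.sum_congr rfl fun j _ => ?_
      simp only [hg]
      rw [if_neg (by omega)]
      push_cast
      rw [one_div_mul_one_div]
    _ ≤ _ := by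
      rw [add_comm]
      have := harmonic_floor_le_one_add_log (D / ρ) (by rwa [le_div_iff₀ hρ, one_mul])
      gcongr

theorem sum_inv_distInt_le_of_separated {S : Finset ℤ} {τ : ℤ → ℝ} {ρ d D : ℝ} (hρ : 0 < ρ)
    (hd : 0 < d) (hρD : ρ ≤ D)
    (hsep : ∀ k ∈ S, ∀ l ∈ S, k ≠ l → ρ ≤ distInt (τ k - τ l))
    (hS : ∀ k ∈ S, d ≤ distInt (τ k) ∧ distInt (τ k) ≤ D) :
    ∑ k ∈ S, 1 / distInt (τ k) ≤ 2 / d + 2 / ρ * (1 + Real.log (D / ρ)) := by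
  classical
  -- points on the same side of `0` are at least `ρ` apart as real numbers
  have hside : ∀ k ∈ S, ∀ l ∈ S, k ≠ l →
      (0 ≤ τ k - round (τ k) ↔ 0 ≤ τ l - round (τ l)) →
      ρ ≤ |distInt (τ k) - distInt (τ l)| := by
    intro k hk l hl hne hs
    have h1 := hsep k hk l hl hne
    have h2 := distInt_le (τ k - τ l) (round (τ k) - round (τ l))
    push_cast at h2
    have e : τ k - τ l - ((round (τ k) : ℝ) - round (τ l)) =
      (τ k - round (τ k)) - (τ l - round (τ l)) := by ring
    rw [e] at h2
    rw [distInt_eq (τ k), distInt_eq (τ l)]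
    by_cases h : 0 ≤ τ k - round (τ k)
    · rw [abs_of_nonneg h, abs_of_nonneg (hs.1 h)]
      linarith
    · have h' : ¬ 0 ≤ τ l - round (τ l) := fun h3 => h (hs.2 h3)
      rw [abs_of_neg (not_le.1 h), abs_of_neg (not_le.1 h'), neg_sub_neg, abs_sub_comm]
      linarith
  rw [← Finset.sum_filter_add_sum_filter_not S (fun k => 0 ≤ τ k - round (τ k))]
  have h1 := sum_inv_le_of_separated (T := S.filter fun k => 0 ≤ τ k - round (τ k))
    (v := fun k => distInt (τ k)) hρ hd hρD
    (fun k hk l hl hne => by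
      rw [Finset.mem_filter] at hk hl
      exact hside k hk.1 l hl.1 hne ⟨fun _ => hl.2, fun _ => hk.2⟩)
    (fun k hk => hS k (Finset.mem_filter.1 hk).1)
  have h2 := sum_inv_le_of_separated (T := S.filter fun k => ¬ 0 ≤ τ k - round (τ k))
    (v := fun k => distInt (τ k)) hρ hd hρD
    (fun k hk l hl hne => by
      rw [Finset.mem_filter] at hk hl
      exact hside k hk.1 l hl.1 hne ⟨fun h => absurd h hk.2, fun h => absurd h hl.2⟩)
    (fun k hk => hS k (Finset.mem_filter.1 hk).1)
  have e : 2 / d + 2 / ρ * (1 + Real.log (D / ρ)) =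
    (1 / d + 1 / ρ * (1 + Real.log (D / ρ))) + (1 / d + 1 / ρ * (1 + Real.log (D / ρ))) := by ring
  rw [e]
  exact add_le_add h1 h2

/-- Orbit points in a window shorter than `q / 2` are `1 / (2q)`-separated. -/
theorem sum_inv_distInt_le_of_short {α : ℝ} {p : ℤ} {q : ℕ} (hq : 0 < q)
    (hc : IsCoprime p (q : ℤ)) (ha : |q * α - p| ≤ 1 / q) (x : ℝ) {S : Finset ℤ} {d D : ℝ}
    (hshort : ∀ k ∈ S, ∀ l ∈ S, 2 * |k - l| ≤ q) (hd : 0 < d) (hD : 1 / (2 * q) ≤ D)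
    (hS : ∀ k ∈ S, d ≤ distInt (x + k * α) ∧ distInt (x + k * α) ≤ D) :
    ∑ k ∈ S, 1 / distInt (x + k * α) ≤ 2 / d + 4 * q * (1 + Real.log (2 * q * D)) := by
  have hq' : (0 : ℝ) < q := by exact_mod_cast hq
  have h := sum_inv_distInt_le_of_separated (S := S) (τ := fun k => x + k * α)
    (ρ := 1 / (2 * q)) (by positivity) hd hD (fun k hk l hl hne => by
      have := distInt_mul_ge hq hc ha (sub_ne_zero.2 hne) (hshort k hk l hl)
      have e : x + k * α - (x + l * α) = ((k - l : ℤ) : ℝ) * α := by push_cast; ring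
      rwa [e]) hS
  have e1 : 2 / (1 / (2 * (q : ℝ))) = 4 * q := by field_simp; norm_num
  have e2 : D / (1 / (2 * (q : ℝ))) = 2 * q * D := by field_simp
  rwa [e1, e2] at h

/-- A window of length `n` consists of at most `2n/q + 1` windows shorter than `q / 2`. -/
theorem sum_inv_distInt_le_of_window {α : ℝ} {p : ℤ} {q : ℕ} (hq : 0 < q)
    (hc : IsCoprime p (q : ℤ)) (ha : |q * α - p| ≤ 1 / q) (x : ℝ) {S : Finset ℤ} {a : ℤ} {n : ℕ}
    (hSW : S ⊆ Finset.Ico a (a + n)) {d D : ℝ} (hd : 0 < d) (hD : 1 / (2 * q) ≤ D)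
    (hS : ∀ k ∈ S, d ≤ distInt (x + k * α) ∧ distInt (x + k * α) ≤ D) :
    ∑ k ∈ S, 1 / distInt (x + k * α) ≤
      (2 * n / q + 1) * (2 / d + 4 * q * (1 + Real.log (2 * q * D))) := by
  have hq' : (0 : ℝ) < q := by exact_mod_cast hq
  set h := q / 2 + 1 with hh
  have hmaps : ∀ k ∈ S, ((k - a) / h).toNat ∈ Finset.range (n / h + 1) := by
    intro k hk
    have h1 := Finset.mem_Ico.1 (hSW hk)
    rw [Finset.mem_range, Nat.lt_succ_iff]
    have h2 : (k - a) / (h : ℤ) ≤ (n : ℤ) / h :=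
      Int.ediv_le_ediv (by positivity) (by linarith)
    have h3 : ((n : ℤ) / h) = ((n / h : ℕ) : ℤ) := by push_cast; rfl
    rw [h3] at h2
    exact Int.toNat_le.2 h2
  rw [← Finset.sum_fiberwise_of_maps_to hmaps]
  have hlog : 0 ≤ Real.log (2 * q * D) := by
    apply Real.log_nonneg
    rw [div_le_iff₀ (by positivity)] at hD
    linarith
  calc _ ≤ ∑ _j ∈ Finset.range (n / h + 1), (2 / d + 4 * q * (1 + Real.log (2 * q * D))) := by
        refine Finset.sum_le_sum fun j _ => ?_
        refine sum_inv_distInt_le_of_short hq hc ha x (fun k hk l hl => ?_) hd hD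
          (fun k hk => hS k (Finset.mem_filter.1 hk).1)
        obtain ⟨hk1, hk2⟩ := Finset.mem_filter.1 hk
        obtain ⟨hl1, hl2⟩ := Finset.mem_filter.1 hl
        have hk3 := Finset.mem_Ico.1 (hSW hk1)
        have hl3 := Finset.mem_Ico.1 (hSW hl1)
        have hpos : (0 : ℤ) < h := by positivity
        have e : (k - a) / (h : ℤ) = (l - a) / h := by
          have h1 : 0 ≤ (k - a) / (h : ℤ) := Int.ediv_nonneg (by linarith) hpos.le
          have h2 : 0 ≤ (l - a) / (h : ℤ) := Int.ediv_nonneg (by linarith) hpos.le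
          omega
        have h1 := Int.emod_add_mul_ediv (k - a) h
        have h2 := Int.emod_add_mul_ediv (l - a) h
        have h3 := Int.emod_lt_of_pos (k - a) hpos
        have h4 := Int.emod_lt_of_pos (l - a) hpos
        have h5 := Int.emod_nonneg (k - a) hpos.ne'
        have h6 := Int.emod_nonneg (l - a) hpos.ne'
        rw [e] at h1
        have h7 : |k - l| < h := by rw [abs_lt]; constructor <;> linarith
        omega
    _ = ((n / h : ℕ) + 1 : ℝ) * (2 / d + 4 * q * (1 + Real.log (2 * q * D))) := by
        rw [Finset.sum_const, Finset.card_range, nsmul_eq_mul]; push_cast; ring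
    _ ≤ _ := by
        gcongr
        have h1 : ((n / h : ℕ) : ℝ) ≤ n / h := Nat.cast_div_le
        refine h1.trans ?_
        have h2 : (q : ℝ) / 2 ≤ h := by
          have : q ≤ 2 * h := by omega
          have : (q : ℝ) ≤ 2 * h := by exact_mod_cast this
          linarith
        calc (n : ℝ) / h ≤ n / (q / 2) := by gcongr
          _ = 2 * n / q := by field_simp

/-! ### Asymptotics of the roof function and of its derivative -/

theorem exists_bound_of_continuousOn_Ioo {g : ℝ → ℝ} (hg : ContinuousOn g (Ioo 0 1)) {u l : ℝ}
    (hu : 0 < u) (hl : l < 1) : ∃ C : ℝ, 0 ≤ C ∧ ∀ t, u ≤ t → t ≤ l → |g t| ≤ C := by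
  obtain ⟨C, hC⟩ := (isCompact_Icc (a := u) (b := l)).exists_bound_of_continuousOn
    (hg.mono fun t ht => ⟨hu.trans_le ht.1, ht.2.trans_lt hl⟩)
  exact ⟨max C 0, le_max_right _ _, fun t h1 h2 => (hC t ⟨h1, h2⟩).trans (le_max_left _ _)⟩

theorem apply_fract (f : UnitAddCircle → ℝ) (t : ℝ) :
    f ((Int.fract t : ℝ) : UnitAddCircle) = f (t : UnitAddCircle) := by
  rw [AddCircle.coe_fract]

namespace IsArnoldRoof

variable {f : UnitAddCircle → ℝ}

theorem continuousOn_lift (hf : IsArnoldRoof f) : ContinuousOn (fun x : ℝ => f x) (Ioo 0 1) :=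
  hf.contDiffOn.continuousOn

theorem continuousOn_deriv (hf : IsArnoldRoof f) :
    ContinuousOn (deriv fun x : ℝ => f x) (Ioo 0 1) :=
  hf.contDiffOn.continuousOn_deriv_of_isOpen isOpen_Ioo (by norm_num)

theorem deriv_lift_fract (f : UnitAddCircle → ℝ) (t : ℝ) :
    deriv (fun x : ℝ => f x) t = deriv (fun x : ℝ => f x) (Int.fract t) := by
  have h : (fun x : ℝ => f x) = fun x : ℝ => (fun y : ℝ => f y) (x - ⌊t⌋) := by
    funext x
    show f x = f ((x - ⌊t⌋ : ℝ) : UnitAddCircle)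
    rw [← apply_fract f x, ← apply_fract f (x - ⌊t⌋), Int.fract_sub_intCast]
  have h1 := deriv_comp_sub_const (f := fun y : ℝ => f y) (⌊t⌋ : ℝ) t
  rw [← h] at h1
  exact h1

theorem differentiableAt_lift (hf : IsArnoldRoof f) {t : ℝ} (ht : 0 < distInt t) :
    DifferentiableAt ℝ (fun x : ℝ => f x) t := by
  have h : (fun x : ℝ => f x) = fun x : ℝ => (fun y : ℝ => f y) (x - ⌊t⌋) := by
    funext x
    show f x = f ((x - ⌊t⌋ : ℝ) : UnitAddCircle)
    rw [← apply_fract f x, ← apply_fract f (x - ⌊t⌋), Int.fract_sub_intCast]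
  rw [h]
  have h0 := fract_pos_of_distInt_pos ht
  have h1 : DifferentiableAt ℝ (fun y : ℝ => f y) (t - ⌊t⌋) :=
    (hf.contDiffOn.contDiffAt (isOpen_Ioo.mem_nhds ⟨h0, Int.fract_lt_one t⟩)).differentiableAt
      (by norm_num)
  exact DifferentiableAt.comp (g := fun y : ℝ => f y) t h1 (differentiableAt_id.sub_const _)

/-- Near the singularity `f'(t) = -A / t + B / (1 - t)` up to a small relative error. -/
theorem exists_deriv_asymptotics (hf : IsArnoldRoof f) :
    ∃ A B : ℝ, 0 < A ∧ 0 < B ∧ A ≠ B ∧ ∀ η : ℝ, 0 < η → ∃ C : ℝ, 0 ≤ C ∧ ∀ t, 0 < t → t < 1 →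
      |deriv (fun x : ℝ => f x) t + A / t - B / (1 - t)| ≤ η * (1 / t + 1 / (1 - t)) + C := by
  obtain ⟨A₁, A, A₃, B₁, B, B₃, ⟨-, hA, -, -, hB, -⟩, ⟨-, hAB, -⟩, -, -, h1, h2, -, -⟩ :=
    hf.singularity
  refine ⟨A, B, hA, hB, hAB, fun η hη => ?_⟩
  have e1 := (Metric.tendsto_nhds.1 h1) η hη
  have e2 := (Metric.tendsto_nhds.1 h2) η hη
  obtain ⟨u, hu, hu'⟩ := mem_nhdsGT_iff_exists_Ioo_subset.1 e1
  obtain ⟨l, hl, hl'⟩ := mem_nhdsLT_iff_exists_Ioo_subset.1 e2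
  have hu0 : (0 : ℝ) < u := hu
  have hl0 : l < 1 := hl
  have hg : ContinuousOn (fun t => deriv (fun x : ℝ => f x) t + A / t - B / (1 - t))
      (Ioo 0 1) := by
    refine (hf.continuousOn_deriv.add (continuousOn_const.div continuousOn_id
      fun t ht => ht.1.ne')).sub (continuousOn_const.div (continuousOn_const.sub continuousOn_id)
      fun t ht => (sub_pos.2 ht.2).ne')
  obtain ⟨C, hC0, hC⟩ := exists_bound_of_continuousOn_Ioo hg (u := min u (1 / 2))
    (l := max l (1 / 2)) (lt_min hu0 (by norm_num)) (max_lt hl0 (by norm_num))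
  refine ⟨C + 2 * A + 2 * B, by positivity, fun t ht0 ht1 => ?_⟩
  have hp : 0 < 1 - t := by linarith
  have hq1 : 0 ≤ η * (1 / t) := by positivity
  have hq2 : 0 ≤ η * (1 / (1 - t)) := by positivity
  rcases lt_or_ge t (min u (1 / 2)) with h | h
  · have h3 : dist (deriv (fun z : ℝ => f z) t / (1 / t)) (-A) < η :=
      hu' ⟨ht0, h.trans_le (min_le_left _ _)⟩
    have ht2 : t < 1 / 2 := h.trans_le (min_le_right _ _)
    rw [Real.dist_eq, div_div_eq_mul_div, div_one, sub_neg_eq_add] at h3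
    have h4 : |deriv (fun z : ℝ => f z) t + A / t| ≤ η * (1 / t) := by
      have e : deriv (fun z : ℝ => f z) t + A / t =
        (deriv (fun z : ℝ => f z) t * t + A) * (1 / t) := by field_simp
      rw [e, abs_mul, abs_of_pos (show 0 < 1 / t by positivity)]
      gcongr
    have h5 : |B / (1 - t)| ≤ 2 * B := by
      rw [abs_of_pos (by positivity), div_le_iff₀ hp]; nlinarith
    have := abs_sub (deriv (fun z : ℝ => f z) t + A / t) (B / (1 - t))
    linarith
  rcases lt_or_ge (max l (1 / 2)) t with h' | h'
  · have h3 : dist (deriv (fun z : ℝ => f z) t / (1 / (1 - t))) B < η :=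
      hl' ⟨(le_max_left _ _).trans_lt h', ht1⟩
    have ht2 : 1 / 2 < t := (le_max_right _ _).trans_lt h'
    rw [Real.dist_eq, div_div_eq_mul_div, div_one] at h3
    have h4 : |deriv (fun z : ℝ => f z) t - B / (1 - t)| ≤ η * (1 / (1 - t)) := by
      have e : deriv (fun z : ℝ => f z) t - B / (1 - t) =
        (deriv (fun z : ℝ => f z) t * (1 - t) - B) * (1 / (1 - t)) := by field_simp
      rw [e, abs_mul, abs_of_pos (show 0 < 1 / (1 - t) by positivity)]
      gcongr
    have h5 : |A / t| ≤ 2 * A := by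
      rw [abs_of_pos (by positivity), div_le_iff₀ ht0]; nlinarith
    have e : deriv (fun z : ℝ => f z) t + A / t - B / (1 - t) =
      (deriv (fun z : ℝ => f z) t - B / (1 - t)) + A / t := by ring
    rw [e]
    have := abs_add_le (deriv (fun z : ℝ => f z) t - B / (1 - t)) (A / t)
    linarith
  · have := hC t h h'
    linarith

/-- Near the singularity `f` is comparable to the logarithm of the distance to it. -/
theorem exists_log_bounds (hf : IsArnoldRoof f) :
    ∃ a b r : ℝ, 0 < a ∧ 0 < b ∧ 0 < r ∧ r ≤ 1 / 3 ∧ ∀ t, 0 < distInt t → distInt t < r →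
      a * -Real.log (distInt t) ≤ f t ∧ f t ≤ b * -Real.log (distInt t) := by
  obtain ⟨A, A₂, A₃, B, B₂, B₃, ⟨hA, -, -, hB, -, -⟩, -, h1, h2, -, -, -, -⟩ := hf.singularity
  have e1 := (Metric.tendsto_nhds.1 h1) (A / 2) (by positivity)
  have e2 := (Metric.tendsto_nhds.1 h2) (B / 2) (by positivity)
  obtain ⟨u, hu, hu'⟩ := mem_nhdsGT_iff_exists_Ioo_subset.1 e1
  obtain ⟨l, hl, hl'⟩ := mem_nhdsLT_iff_exists_Ioo_subset.1 e2
  have hu0 : (0 : ℝ) < u := hu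
  have hl0 : l < 1 := hl
  refine ⟨min (A / 2) (B / 2), 2 * A + 2 * B, min (min u (1 - l)) (1 / 3),
    lt_min (by positivity) (by positivity), by positivity,
    lt_min (lt_min hu0 (by linarith)) (by norm_num), min_le_right _ _, fun t ht0 htr => ?_⟩
  have hr1 : distInt t < u := htr.trans_le ((min_le_left _ _).trans (min_le_left _ _))
  have hr2 : distInt t < 1 - l := htr.trans_le ((min_le_left _ _).trans (min_le_right _ _))
  have hr3 : distInt t < 1 / 3 := htr.trans_le (min_le_right _ _)
  have hlog : 0 < -Real.log (distInt t) := by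
    have := Real.log_neg ht0 (by linarith); linarith
  have hf0 := fract_pos_of_distInt_pos ht0
  have key : ∀ a' : ℝ, 0 < a' → dist (f t / -Real.log (distInt t)) a' < a' / 2 →
      a' / 2 * -Real.log (distInt t) ≤ f t ∧ f t ≤ 2 * a' * -Real.log (distInt t) := by
    intro a' ha' h
    rw [Real.dist_eq, abs_lt] at h
    constructor
    · rw [← le_div_iff₀ hlog]; linarith [h.1]
    · rw [← div_le_iff₀ hlog]; linarith [h.2]
  rcases le_total (Int.fract t) (1 - Int.fract t) with h | h
  · have e : distInt t = Int.fract t := by rw [distInt_eq_min, min_eq_left h]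
    have h3 : dist (f ((Int.fract t : ℝ) : UnitAddCircle) / -Real.log (Int.fract t)) A < A / 2 :=
      hu' ⟨hf0, e ▸ hr1⟩
    rw [apply_fract f, ← e] at h3
    obtain ⟨h4, h5⟩ := key A hA h3
    refine ⟨le_trans ?_ h4, h5.trans ?_⟩
    · gcongr; exact min_le_left _ _
    · gcongr; linarith
  · have e : distInt t = 1 - Int.fract t := by rw [distInt_eq_min, min_eq_right h]
    have h3 : dist (f ((Int.fract t : ℝ) : UnitAddCircle) / -Real.log (1 - Int.fract t)) B
        < B / 2 := hl' ⟨by linarith, Int.fract_lt_one t⟩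
    rw [apply_fract f, ← e] at h3
    obtain ⟨h4, h5⟩ := key B hB h3
    refine ⟨le_trans ?_ h4, h5.trans ?_⟩
    · gcongr; exact min_le_right _ _
    · gcongr; linarith

theorem exists_pos_le (hf : IsArnoldRoof f) : ∃ c : ℝ, 0 < c ∧ ∀ x, c ≤ f x := by
  obtain ⟨a, b, r, ha, hb, hr, hr3, h⟩ := hf.exists_log_bounds
  obtain ⟨C, hC0, hC⟩ := exists_bound_of_continuousOn_Ioo (g := fun t : ℝ => (f t)⁻¹)
    (hf.continuousOn_lift.inv₀ fun t _ => (hf.pos _).ne') hr (show 1 - r < 1 by linarith)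
  have hlr : 0 < -Real.log r := by have := Real.log_neg hr (by linarith); linarith
  refine ⟨min (min (1 / (C + 1)) (f 0)) (a * -Real.log r),
    lt_min (lt_min (by positivity) (hf.pos 0)) (by positivity), fun x => ?_⟩
  induction x using QuotientAddGroup.induction_on with
  | H t =>
  rcases (distInt_nonneg t).eq_or_lt with h0 | h0
  · have : (t : UnitAddCircle) = 0 := by
      rw [← norm_eq_zero]; exact h0.symm
    rw [this]
    exact (min_le_left _ _).trans (min_le_right _ _)
  rcases lt_or_ge (distInt t) r with h1 | h1
  · refine (min_le_right _ _).trans (le_trans ?_ (h t h0 h1).1)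
    have := Real.log_le_log h0 h1.le
    gcongr
  · refine (min_le_left _ _).trans ((min_le_left _ _).trans ?_)
    rw [distInt_eq_min, le_min_iff] at h1
    have h2 := hC (Int.fract t) h1.1 (by linarith [h1.2])
    simp only [apply_fract] at h2
    rw [abs_of_pos (inv_pos.2 (hf.pos _))] at h2
    rw [div_le_iff₀ (by positivity)]
    have h3 : 1 ≤ f t * C := by
      rw [inv_le_iff_one_le_mul₀ (hf.pos _)] at h2; linarith
    have := hf.pos (t : UnitAddCircle)
    nlinarith

theorem exists_le_log (hf : IsArnoldRoof f) :
    ∃ C : ℝ, 0 < C ∧ ∀ t, 0 < distInt t → f t ≤ C * (1 - Real.log (distInt t)) := by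
  obtain ⟨a, b, r, ha, hb, hr, hr3, h⟩ := hf.exists_log_bounds
  obtain ⟨C, hC0, hC⟩ := exists_bound_of_continuousOn_Ioo hf.continuousOn_lift hr
    (show 1 - r < 1 by linarith)
  refine ⟨C + b, by positivity, fun t h0 => ?_⟩
  have hl : 0 ≤ -Real.log (distInt t) := by
    have := Real.log_nonpos h0.le (by linarith [distInt_le_half t]); linarith
  have p1 := mul_nonneg hC0 hl
  have p2 := mul_nonneg hb.le hl
  rcases lt_or_ge (distInt t) r with h1 | h1
  · have := (h t h0 h1).2
    nlinarith
  · rw [distInt_eq_min, le_min_iff] at h1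
    have h2 := hC (Int.fract t) h1.1 (by linarith [h1.2])
    simp only [apply_fract] at h2
    have := le_abs_self (f t)
    nlinarith

theorem measurable (hf : IsArnoldRoof f) : Measurable f := by
  refine measurable_of_continuousOn_compl_singleton 0 fun x (hx : x ≠ 0) => ?_
  refine ContinuousAt.continuousWithinAt ?_
  obtain ⟨t, ht, rfl⟩ := AddCircle.eq_coe_Ico x
  have ht0 : 0 < distInt t := norm_pos_iff.2 hx
  have h1 : ContinuousAt (fun y : ℝ => f y) t := (hf.differentiableAt_lift ht0).continuousAt
  have hq : IsOpenQuotientMap ((↑) : ℝ → UnitAddCircle) := QuotientAddGroup.isOpenQuotientMap_mk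
  exact hq.continuousAt_comp_iff.1 h1

theorem integrable (hf : IsArnoldRoof f) : Integrable f := by
  by_contra h
  have := hf.integral_eq_one
  rw [integral_undef h] at this
  norm_num at this

end IsArnoldRoof

/-! ### Points whose orbits do not approach the singularity too fast -/

theorem volume_ball_le (x : UnitAddCircle) {r : ℝ} :
    volume (Metric.ball x r) ≤ ENNReal.ofReal (2 * r) := by
  refine (measure_mono Metric.ball_subset_closedBall).trans ?_
  rw [AddCircle.volume_closedBall]
  exact ENNReal.ofReal_le_ofReal (min_le_right _ _)

theorem mem_ball_neg_iff (x t r : ℝ) :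
    (x : UnitAddCircle) ∈ Metric.ball ((-t : ℝ) : UnitAddCircle) r ↔ distInt (x + t) < r := by
  rw [Metric.mem_ball, dist_eq_norm, ← AddCircle.coe_sub, sub_neg_eq_add]; rfl

theorem summable_int_inv_sq : Summable fun k : ℤ => 1 / (|(k : ℝ)| + 1) ^ 2 := by
  have h : Summable fun n : ℕ => 1 / ((n : ℝ) + 1) ^ 2 := by
    have := (summable_nat_add_iff 1).2 (Real.summable_one_div_nat_pow.2 (one_lt_two))
    simpa using this
  refine Summable.of_nat_of_neg ?_ ?_ <;> simpa using h

/-- The points whose orbits are never closer to `0` than `c / (|k| + 1)²` at time `k`, and, for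
large `i ∉ K_α`, than `1 / (q_i (log q_i)^(7/8))` at the times `0 ≤ k < q_i`. -/
def slowPoints (α : ℝ) (q : ℕ → ℕ) (c : ℝ) (s₀ : ℕ) : Set UnitAddCircle :=
  (⋃ k : ℤ, Metric.ball ((-(k * α) : ℝ) : UnitAddCircle) (c / (|(k : ℝ)| + 1) ^ 2))ᶜ ∩
    (⋃ i ∈ {i | s₀ ≤ i ∧ i ∉ goodIndices α}, ⋃ k ∈ Finset.range (q i),
      Metric.ball ((-(k * α) : ℝ) : UnitAddCircle)
        (1 / (q i * Real.log (q i) ^ (7 / 8 : ℝ))))ᶜ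

theorem measurableSet_slowPoints (α : ℝ) (q : ℕ → ℕ) (c : ℝ) (s₀ : ℕ) :
    MeasurableSet (slowPoints α q c s₀) := by
  refine (IsOpen.measurableSet ?_).compl.inter (IsOpen.measurableSet ?_).compl
  · exact isOpen_iUnion fun k => Metric.isOpen_ball
  · exact isOpen_biUnion fun i _ => isOpen_biUnion fun k _ => Metric.isOpen_ball

theorem mem_slowPoints_iff {α : ℝ} {q : ℕ → ℕ} {c : ℝ} {s₀ : ℕ} {x : ℝ} :
    (x : UnitAddCircle) ∈ slowPoints α q c s₀ ↔
      (∀ k : ℤ, c / (|(k : ℝ)| + 1) ^ 2 ≤ distInt (x + k * α)) ∧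
      ∀ i, s₀ ≤ i → i ∉ goodIndices α → ∀ k : ℕ, k < q i →
        1 / (q i * Real.log (q i) ^ (7 / 8 : ℝ)) ≤ distInt (x + k * α) := by
  simp only [slowPoints, mem_inter_iff, mem_compl_iff, mem_iUnion, mem_ball_neg_iff, not_exists,
    not_lt, mem_ofPred_eq, Finset.mem_range, and_imp, exists_prop, not_and]

theorem exists_slowPoints_compl_le {α : ℝ} (hE : α ∈ diophE) {p : ℕ → ℤ} {q : ℕ → ℕ}
    (hq : ∀ n, cfDenom α n = q n) (h : IsConvergents α p q) {ε : ℝ} (hε : 0 < ε) :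
    ∃ c : ℝ, 0 < c ∧ ∃ s₀ : ℕ, volume (slowPoints α q c s₀)ᶜ ≤ ENNReal.ofReal ε := by
  set S := ∑' k : ℤ, 1 / (|(k : ℝ)| + 1) ^ 2 with hS
  have hS0 : 0 ≤ S := tsum_nonneg fun k => by positivity
  set c := ε / (4 * (S + 1)) with hc
  have hc0 : 0 < c := by positivity
  set g : {i : ℕ // 2 ≤ i ∧ i ∉ goodIndices α} → ℝ :=
    fun i => Real.log (cfDenom α i) ^ (-(7 / 8) : ℝ) with hg
  have hg0 : ∀ i, 0 ≤ g i := fun i =>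
    Real.rpow_nonneg (by rw [hq]; exact Real.log_natCast_nonneg _) _
  have htail := tendsto_tsum_compl_atTop_zero g
  obtain ⟨s, hs⟩ := (htail.eventually (gt_mem_nhds (show (0 : ℝ) < ε / 4 by positivity))).exists
  set s₀ := s.sup (fun i => (i : ℕ)) + 3 with hs₀
  refine ⟨c, hc0, s₀, ?_⟩
  have h1 : volume (⋃ k : ℤ, Metric.ball ((-(k * α) : ℝ) : UnitAddCircle)
      (c / (|(k : ℝ)| + 1) ^ 2)) ≤ ENNReal.ofReal (ε / 2) := by
    calc _ ≤ ∑' k : ℤ, volume (Metric.ball ((-(k * α) : ℝ) : UnitAddCircle)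
          (c / (|(k : ℝ)| + 1) ^ 2)) := measure_iUnion_le _
      _ ≤ ∑' k : ℤ, ENNReal.ofReal (2 * c * (1 / (|(k : ℝ)| + 1) ^ 2)) := by
          refine ENNReal.tsum_le_tsum fun k => (volume_ball_le _).trans (le_of_eq ?_)
          congr 1; ring
      _ = ENNReal.ofReal (2 * c * S) := by
          rw [← ENNReal.ofReal_tsum_of_nonneg (fun k => by positivity)
            (summable_int_inv_sq.mul_left _), tsum_mul_left]
      _ ≤ _ := by
          apply ENNReal.ofReal_le_ofReal
          rw [hc]
          have : S / (S + 1) ≤ 1 := by rw [div_le_one (by linarith)]; linarith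
          calc 2 * (ε / (4 * (S + 1))) * S = ε / 2 * (S / (S + 1)) := by field_simp; norm_num
            _ ≤ ε / 2 * 1 := by gcongr
            _ = ε / 2 := mul_one _
  have h2 : volume (⋃ i ∈ {i | s₀ ≤ i ∧ i ∉ goodIndices α}, ⋃ k ∈ Finset.range (q i),
      Metric.ball ((-(k * α) : ℝ) : UnitAddCircle)
        (1 / (q i * Real.log (q i) ^ (7 / 8 : ℝ)))) ≤ ENNReal.ofReal (ε / 2) := by
    have hsub : (⋃ i ∈ {i | s₀ ≤ i ∧ i ∉ goodIndices α}, ⋃ k ∈ Finset.range (q i),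
      Metric.ball ((-(k * α) : ℝ) : UnitAddCircle)
        (1 / (q i * Real.log (q i) ^ (7 / 8 : ℝ)))) ⊆ ⋃ i : {i // i ∉ s},
        ⋃ k ∈ Finset.range (q (i : {i : ℕ // 2 ≤ i ∧ i ∉ goodIndices α})),
      Metric.ball ((-(k * α) : ℝ) : UnitAddCircle)
        (1 / (q (i : {i : ℕ // 2 ≤ i ∧ i ∉ goodIndices α}) *
          Real.log (q (i : {i : ℕ // 2 ≤ i ∧ i ∉ goodIndices α})) ^ (7 / 8 : ℝ))) := by
      refine iUnion₂_subset fun i hi => ?_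
      have hi' : (⟨i, by have := hi.1; omega, hi.2⟩ :
          {i : ℕ // 2 ≤ i ∧ i ∉ goodIndices α}) ∉ s := by
        intro hmem
        have := Finset.le_sup (f := fun i : {i : ℕ // 2 ≤ i ∧ i ∉ goodIndices α} => (i : ℕ)) hmem
        have h3 := hi.1
        simp only at this
        omega
      exact subset_iUnion_of_subset ⟨_, hi'⟩ subset_rfl
    refine (measure_mono hsub).trans ((measure_iUnion_le _).trans ?_)
    calc _ ≤ ∑' i : {i // i ∉ s}, ENNReal.ofReal (2 * g i) := by
          refine ENNReal.tsum_le_tsum fun i => ?_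
          refine (measure_biUnion_finset_le _ _).trans ?_
          refine (Finset.sum_le_sum fun k _ => volume_ball_le _).trans ?_
          rw [Finset.sum_const, Finset.card_range, nsmul_eq_mul,
            ← ENNReal.ofReal_natCast, ← ENNReal.ofReal_mul (by positivity)]
          apply ENNReal.ofReal_le_ofReal
          have hpos : (0 : ℝ) < q (i : {i : ℕ // 2 ≤ i ∧ i ∉ goodIndices α}) := by
            exact_mod_cast h.pos _
          simp only [hg]
          rw [hq, Real.rpow_neg (Real.log_natCast_nonneg _)]
          apply le_of_eq
          field_simp
      _ = ENNReal.ofReal (2 * ∑' i : {i // i ∉ s}, g i) := by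
          rw [← tsum_mul_left, ENNReal.ofReal_tsum_of_nonneg
            (fun i => mul_nonneg zero_le_two (hg0 _))
            ((hE.2.subtype _).mul_left 2)]
      _ ≤ _ := ENNReal.ofReal_le_ofReal (by linarith)
  rw [slowPoints, compl_inter, compl_compl, compl_compl]
  refine (measure_union_le _ _).trans ((add_le_add h1 h2).trans (le_of_eq ?_))
  rw [← ENNReal.ofReal_add (by positivity) (by positivity), add_halves]

/-! ### Birkhoff sums of the derivative -/

theorem one_div_le_truncInv_add {q : ℕ} {t : ℝ} (ht : 0 < distInt t) :
    truncInv q t ≤ 1 / Int.fract t ∧ 1 / Int.fract t ≤ truncInv q t +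
      if distInt t < 1 / q then 1 / distInt t else 0 := by
  have h0 := fract_pos_of_distInt_pos ht
  have h1 : distInt t ≤ Int.fract t := by rw [distInt_eq_min]; exact min_le_left _ _
  have h2 := one_div_le_one_div_of_le ht h1
  have h3 : 0 < 1 / Int.fract t := by positivity
  have h4 : 0 < 1 / distInt t := by positivity
  unfold truncInv
  by_cases c1 : 1 / (q : ℝ) ≤ Int.fract t
  · rw [if_pos c1]
    refine ⟨le_rfl, ?_⟩
    split_ifs <;> linarith
  · rw [if_neg c1, if_pos (h1.trans_lt (not_le.1 c1))]
    constructor <;> linarith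

theorem IsArnoldRoof.abs_deriv_add_truncInv_le {f : UnitAddCircle → ℝ} {A B η C : ℝ} (hA : 0 < A)
    (hB : 0 < B) (hη : 0 < η)
    (hC : ∀ t, 0 < t → t < 1 →
      |deriv (fun x : ℝ => f x) t + A / t - B / (1 - t)| ≤ η * (1 / t + 1 / (1 - t)) + C)
    (q : ℕ) {t : ℝ} (ht : 0 < distInt t) :
    |deriv (fun x : ℝ => f x) t + A * truncInv q t - B * truncInv q (-t)| ≤
      η * (truncInv q t + truncInv q (-t)) + C +
        (A + B + 2 * η) * if distInt t < 1 / q then 1 / distInt t else 0 := by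
  have h0 := fract_pos_of_distInt_pos ht
  have h1 := hC (Int.fract t) h0 (Int.fract_lt_one t)
  rw [← IsArnoldRoof.deriv_lift_fract] at h1
  have e : 1 - Int.fract t = Int.fract (-t) := (Int.fract_neg h0.ne').symm
  rw [e] at h1
  obtain ⟨a1, a2⟩ := one_div_le_truncInv_add (q := q) ht
  obtain ⟨b1, b2⟩ := one_div_le_truncInv_add (q := q) (t := -t) (by rwa [distInt_neg])
  rw [distInt_neg] at b2
  set nr : ℝ := if distInt t < 1 / q then 1 / distInt t else 0
  rw [div_eq_mul_one_div A, div_eq_mul_one_div B] at h1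
  set X := 1 / Int.fract t
  set Y := 1 / Int.fract (-t)
  have h2 := abs_le.1 h1
  have p1 : A * X ≤ A * (truncInv q t + nr) := by gcongr
  have p2 : A * truncInv q t ≤ A * X := by gcongr
  have p3 : B * Y ≤ B * (truncInv q (-t) + nr) := by gcongr
  have p4 : B * truncInv q (-t) ≤ B * Y := by gcongr
  have p5 : η * X ≤ η * (truncInv q t + nr) := by gcongr
  have p6 : η * Y ≤ η * (truncInv q (-t) + nr) := by gcongr
  have hnr : 0 ≤ nr := by
    simp only [nr]; split_ifs
    · positivity
    · exact le_rfl
  have q1 : 0 ≤ A * nr := by positivity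
  have q2 : 0 ≤ B * nr := by positivity
  rw [abs_le]
  constructor <;> nlinarith [h2.1, h2.2]

theorem sum_Ico_add_natCast (g : ℤ → ℝ) (a : ℤ) (n : ℕ) :
    ∑ k ∈ Finset.Ico a (a + n), g k = ∑ i ∈ Finset.range n, g (a + i) := by
  symm
  refine Finset.sum_nbij (fun i : ℕ => a + i) (fun i hi => ?_) (fun i _ j _ h => ?_)
    (fun k hk => ?_) (fun i _ => rfl)
  · have := Finset.mem_range.1 hi
    rw [Finset.mem_Ico]; omega
  · simpa using h
  · have := Finset.mem_Ico.1 (Finset.mem_coe.1 hk)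
    exact ⟨(k - a).toNat, by simp; omega, by simp; omega⟩

/-- The Birkhoff sums of `f'` over `n` steps are `(B - A) n log q`, up to the contribution of the
times at which the orbit is `1/q`-close to the singularity. -/
theorem IsArnoldRoof.abs_sum_deriv_sub_le {f : UnitAddCircle → ℝ} {A B η C : ℝ} (hA : 0 < A)
    (hB : 0 < B) (hη : 0 < η)
    (hC : ∀ t, 0 < t → t < 1 →
      |deriv (fun x : ℝ => f x) t + A / t - B / (1 - t)| ≤ η * (1 / t + 1 / (1 - t)) + C)
    {α : ℝ} {p : ℤ} {q : ℕ} (hq : 0 < q) (hc : IsCoprime p (q : ℤ))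
    (ha : |q * α - p| ≤ 1 / q) (θ : ℝ) (a : ℤ) (n : ℕ)
    (hpos : ∀ k ∈ Finset.Ico a (a + n), 0 < distInt (θ + k * α)) :
    |∑ k ∈ Finset.Ico a (a + n), deriv (fun x : ℝ => f x) (θ + k * α) - (B - A) * (n * Real.log q)|
      ≤ (A + B + 2 * η) * (4 * n + q * (Real.log q + 4)) + 2 * η * (n * Real.log q) + C * n +
        (A + B + 2 * η) * ∑ k ∈ (Finset.Ico a (a + n)).filter
          (fun k : ℤ => distInt (θ + k * α) < 1 / q), 1 / distInt (θ + k * α) := by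
  set W := Finset.Ico a (a + n) with hW
  set E := 4 * (n : ℝ) + q * (Real.log q + 4) with hE
  have t1 : |∑ k ∈ W, truncInv q (θ + k * α) - n * Real.log q| ≤ E := by
    have := abs_sum_truncInv_sub_le hq hc ha (θ + a * α) n
    rw [hW, sum_Ico_add_natCast (fun k => truncInv q (θ + k * α))]
    convert this using 5
    push_cast; ring
  have t2 : |∑ k ∈ W, truncInv q (-(θ + k * α)) - n * Real.log q| ≤ E := by
    have := abs_sum_truncInv_sub_le (α := -α) (p := -p) hq hc.neg_left
      (by push_cast; rwa [mul_neg, ← neg_add', ← sub_eq_add_neg, abs_neg]) (-(θ + a * α)) n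
    rw [hW, sum_Ico_add_natCast (fun k => truncInv q (-(θ + k * α)))]
    convert this using 5
    push_cast; ring
  have h1 : |∑ k ∈ W, (deriv (fun x : ℝ => f x) (θ + k * α) + A * truncInv q (θ + k * α) -
      B * truncInv q (-(θ + k * α)))| ≤ ∑ k ∈ W, (η * (truncInv q (θ + k * α) +
        truncInv q (-(θ + k * α))) + C + (A + B + 2 * η) *
        if distInt (θ + k * α) < 1 / q then 1 / distInt (θ + k * α) else 0) :=
    (Finset.abs_sum_le_sum_abs _ _).trans (Finset.sum_le_sum fun k hk =>
      IsArnoldRoof.abs_deriv_add_truncInv_le hA hB hη hC q (hpos k hk))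
  have hcard : (W.card : ℝ) = n := by rw [hW]; simp
  simp only [Finset.sum_add_distrib, Finset.sum_sub_distrib, ← Finset.mul_sum,
    Finset.sum_const, nsmul_eq_mul, hcard, ← Finset.sum_filter] at h1
  set T1 := ∑ k ∈ W, truncInv q (θ + k * α)
  set T2 := ∑ k ∈ W, truncInv q (-(θ + k * α))
  set nr := ∑ k ∈ W.filter (fun k : ℤ => distInt (θ + k * α) < 1 / q), 1 / distInt (θ + k * α)
  have h2 := abs_le.1 h1
  have h3 := abs_le.1 t1
  have h4 := abs_le.1 t2
  have p1 : A * T1 ≤ A * (n * Real.log q + E) := by gcongr; linarith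
  have p2 : A * (n * Real.log q - E) ≤ A * T1 := by gcongr; linarith
  have p3 : B * T2 ≤ B * (n * Real.log q + E) := by gcongr; linarith
  have p4 : B * (n * Real.log q - E) ≤ B * T2 := by gcongr; linarith
  have p5 : η * T1 ≤ η * (n * Real.log q + E) := by gcongr; linarith
  have p6 : η * T2 ≤ η * (n * Real.log q + E) := by gcongr; linarith
  rw [abs_le]
  constructor <;> nlinarith [h2.1, h2.2]

/-! ### The choice of scales -/

/-- The parameters of the estimates at time `N`: `ℓ = log N` is so large that `K + 3 log ℓ` is
small compared to a small power of `ℓ`; `q_s` and `q_{s+1}` are the consecutive denominators around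
`4RN`, so that multiples `m α` with `|m| ≤ 2RN` are controlled by `q_{s+1}`; `q_u` is a denominator
below `ζ N` whose logarithm is almost that of `N`. -/
structure IsScale (q : ℕ → ℕ) (C K ζ : ℝ) (R N s u : ℕ) : Prop where
  one_le_log : 1 ≤ Real.log N
  log_large : K + 3 * Real.log (Real.log N) ≤ ζ * Real.log N ^ (1 / 16 : ℝ)
  R_le : 4 * R ≤ N
  le_s : u ≤ s
  three_le : 3 ≤ u
  q_s_le : (q s : ℝ) ≤ 4 * R * N
  lt_q_succ : 4 * R * N < (q (s + 1) : ℝ)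
  q_u_le : (q u : ℝ) ≤ ζ * N
  le_log_q_u : (1 - ζ) * Real.log N ≤ Real.log (q u)

theorem eventually_isScale {α : ℝ} {p : ℕ → ℤ} {q : ℕ → ℕ} (h : IsConvergents α p q) {C : ℝ}
    (hC1 : 1 ≤ C) (hC : ∀ n, 3 ≤ n → (q (n + 1) : ℝ) ≤ C * (q n * Real.log (q n) ^ 3))
    {K ζ : ℝ} (hζ : 0 < ζ) (hζ1 : ζ ≤ 1) (hK : Real.log C - Real.log ζ ≤ K) {R : ℕ} (hR : 1 ≤ R)
    (s₀ : ℕ) : ∀ᶠ N : ℕ in atTop, ∃ s u, s₀ ≤ s ∧ IsScale q C K ζ R N s u := by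
  have hlog : Tendsto (fun N : ℕ => Real.log N) atTop atTop :=
    Real.tendsto_log_atTop.comp tendsto_natCast_atTop_atTop
  have h1 : ∀ᶠ ℓ : ℝ in atTop, 3 * Real.log ℓ ≤ ζ / 2 * ℓ ^ (1 / 16 : ℝ) := by
    have := (isLittleO_log_rpow_atTop (show (0 : ℝ) < 1 / 16 by norm_num)).bound
      (show 0 < ζ / 6 by positivity)
    filter_upwards [this, eventually_ge_atTop 1] with ℓ h2 h3
    rw [Real.norm_of_nonneg (Real.log_nonneg h3), Real.norm_of_nonneg (by positivity)] at h2
    linarith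
  have h2 : ∀ᶠ ℓ : ℝ in atTop, K ≤ ζ / 2 * ℓ ^ (1 / 16 : ℝ) :=
    ((tendsto_rpow_atTop (show (0 : ℝ) < 1 / 16 by norm_num)).const_mul_atTop
      (show 0 < ζ / 2 by positivity)).eventually_ge_atTop K
  have hN : Tendsto (fun N : ℕ => ζ * (N : ℝ)) atTop atTop :=
    tendsto_natCast_atTop_atTop.const_mul_atTop hζ
  filter_upwards [hlog.eventually h1, hlog.eventually h2, hlog.eventually_ge_atTop 1,
    eventually_ge_atTop (4 * R), hN.eventually_ge_atTop ((q (max 3 s₀) : ℕ) : ℝ)]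
    with N e1 e2 e3 e4 e5
  have hR' : (1 : ℝ) ≤ R := by exact_mod_cast hR
  have hN0 : (0 : ℝ) ≤ N := Nat.cast_nonneg N
  have hqm : ∀ i j, i ≤ j → (q i : ℝ) ≤ q j := fun i j hij => by exact_mod_cast h.mono hij
  have h45 : ζ * N ≤ 4 * R * N := by nlinarith
  obtain ⟨u, hu1, hu2⟩ := h.exists_lt_le (X := ζ * N) ((hqm _ _ (Nat.zero_le _)).trans e5)
  obtain ⟨s, hs1, hs2⟩ := h.exists_lt_le (X := 4 * R * N)
    (((hqm _ _ (Nat.zero_le _)).trans e5).trans h45)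
  have hlt : ∀ i j, (q i : ℝ) < q j → i < j := fun i j hij => by
    by_contra hcon
    exact absurd (hqm _ _ (not_lt.1 hcon)) (not_le.2 hij)
  have hu3 : max 3 s₀ < u + 1 := hlt _ _ (e5.trans_lt hu2)
  have hus : u < s + 1 := hlt _ _ ((hu1.trans h45).trans_lt hs2)
  have h3u : 3 ≤ u := by have := le_max_left 3 s₀; omega
  have hNpos : (0 : ℝ) < N := by
    have : (0 : ℝ) < q (max 3 s₀) := by exact_mod_cast h.pos _
    by_contra hcon
    have : (N : ℝ) = 0 := le_antisymm (not_lt.1 hcon) hN0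
    rw [this] at e5; linarith
  refine ⟨s, u, by have := le_max_right 3 s₀; omega, e3, by linarith, e4, by omega, h3u, hs1, hs2,
    hu1, ?_⟩
  -- `ζ N < q_{u+1} ≤ C q_u (log q_u)³ ≤ C q_u ℓ³`
  set ℓ := Real.log N with hℓ
  have hqu : (1 : ℝ) ≤ q u := h.one_le u
  have h6 : Real.log (q u) ≤ ℓ := Real.log_le_log (by linarith) (by nlinarith)
  have h7 : 0 ≤ Real.log (q u) := Real.log_nonneg hqu
  have h8 : ζ * N ≤ C * (q u * ℓ ^ 3) := hu2.le.trans ((hC u h3u).trans (by gcongr))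
  have h9 := Real.log_le_log (by positivity) h8
  rw [Real.log_mul hζ.ne' hNpos.ne', Real.log_mul (by linarith) (by positivity),
    Real.log_mul (by linarith) (by positivity), Real.log_pow] at h9
  push_cast at h9
  have h10 : ℓ ^ (1 / 16 : ℝ) ≤ ℓ := by
    have := Real.rpow_le_rpow_of_exponent_le e3 (show (1 / 16 : ℝ) ≤ 1 by norm_num)
    rwa [Real.rpow_one] at this
  have h11 : ζ * ℓ ^ (1 / 16 : ℝ) ≤ ζ * ℓ := by gcongr
  nlinarith

namespace IsScale

variable {q : ℕ → ℕ} {C K ζ : ℝ} {R N s u : ℕ}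

theorem N_pos (H : IsScale q C K ζ R N s u) : (0 : ℝ) < N := by
  by_contra h
  have h0 : (N : ℝ) = 0 := le_antisymm (not_lt.1 h) (Nat.cast_nonneg N)
  have := H.one_le_log
  rw [h0, Real.log_zero] at this
  linarith

theorem le_rpow (H : IsScale q C K ζ R N s u) : K ≤ ζ * Real.log N ^ (1 / 16 : ℝ) := by
  have := H.log_large
  have := Real.log_nonneg H.one_le_log
  linarith

theorem rpow_le (H : IsScale q C K ζ R N s u) (hζ : 0 < ζ) :
    ζ * Real.log N ^ (1 / 16 : ℝ) ≤ ζ * Real.log N := by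
  have := Real.rpow_le_rpow_of_exponent_le H.one_le_log (show (1 / 16 : ℝ) ≤ 1 by norm_num)
  rw [Real.rpow_one] at this
  gcongr

theorem le_mul_log (H : IsScale q C K ζ R N s u) (hζ : 0 < ζ) : K ≤ ζ * Real.log N :=
  H.le_rpow.trans (H.rpow_le hζ)

theorem log_q_s_le (H : IsScale q C K ζ R N s u) (hq : ∀ n, 0 < q n) :
    Real.log (q s) ≤ 2 * Real.log N := by
  have h0 := H.N_pos
  have h1 : (q s : ℝ) ≤ (N : ℝ) ^ 2 := by
    have h2 : (4 * R : ℝ) ≤ N := by exact_mod_cast H.R_le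
    calc (q s : ℝ) ≤ 4 * R * N := H.q_s_le
      _ ≤ N * N := by gcongr
      _ = _ := by ring
  have h2 := Real.log_le_log (by exact_mod_cast hq s) h1
  rw [Real.log_pow] at h2
  exact_mod_cast h2

theorem one_add_log_le (H : IsScale q C K ζ R N s u) (hq : ∀ n, 0 < q n) (hR : 1 ≤ R) (hζ : 0 < ζ)
    (hK : 1 + Real.log (8 * R) ≤ K) : 1 + Real.log (2 * q s * (1 / q u)) ≤ 2 * ζ * Real.log N := by
  have h0 := H.N_pos
  have hR' : (1 : ℝ) ≤ R := by exact_mod_cast hR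
  have hs : (0 : ℝ) < q s := by exact_mod_cast hq s
  have hu : (0 : ℝ) < q u := by exact_mod_cast hq u
  have h1 : 2 * (q s : ℝ) * (1 / q u) ≤ 8 * R * N / q u := by
    rw [mul_one_div]
    have := H.q_s_le
    exact div_le_div_of_nonneg_right (by linarith) hu.le
  have h2 := Real.log_le_log (by positivity) h1
  rw [Real.log_div (by positivity) hu.ne', Real.log_mul (by positivity) h0.ne'] at h2
  have := H.le_log_q_u
  have := H.le_mul_log hζ
  linarith

end IsScale

/-- If the window stays away from `0` at the scale of `1 / (q_s log N)`, then the near visits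
contribute little. -/
theorem IsScale.near_sum_le_of_far {q : ℕ → ℕ} {C K ζ : ℝ} {R N s u : ℕ}
    (H : IsScale q C K ζ R N s u) {α : ℝ} {p : ℕ → ℤ} (h : IsConvergents α p q) (hR : 1 ≤ R)
    (hζ : 0 < ζ) (hK : 1 + Real.log (8 * R) ≤ K) {θ : ℝ} {a : ℤ} {n : ℕ} (hn : n ≤ 2 * R * N)
    (hfar : ∀ k ∈ Finset.Ico a (a + n), 1 / (4 * ζ * q s * Real.log N) ≤ distInt (θ + k * α)) :
    ∑ k ∈ (Finset.Ico a (a + n)).filter (fun k : ℤ => distInt (θ + k * α) < 1 / q u),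
      1 / distInt (θ + k * α) ≤ 132 * R * ζ * (N * Real.log N) := by
  have hN := H.N_pos
  have hl : 0 < Real.log N := by linarith [H.one_le_log]
  have hs : (0 : ℝ) < q s := by exact_mod_cast h.pos s
  have hu : (0 : ℝ) < q u := by exact_mod_cast h.pos u
  have hus : (q u : ℝ) ≤ q s := by exact_mod_cast h.mono H.le_s
  have h1 := sum_inv_distInt_le_of_window (h.pos s) (h.coprime s) (h.abs_le s) θ
    (S := (Finset.Ico a (a + n)).filter (fun k : ℤ => distInt (θ + k * α) < 1 / q u))
    (a := a) (n := n) (Finset.filter_subset _ _) (d := 1 / (4 * ζ * q s * Real.log N))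
    (D := 1 / q u) (by positivity) (one_div_le_one_div_of_le hu (by linarith))
    (fun k hk => ⟨hfar k (Finset.mem_filter.1 hk).1, (Finset.mem_filter.1 hk).2.le⟩)
  refine h1.trans ?_
  have h2 := H.one_add_log_le h.pos hR hζ hK
  have hn' : (n : ℝ) ≤ 2 * R * N := by exact_mod_cast hn
  have h3 : 2 * (n : ℝ) / q s + 1 ≤ 8 * R * N / q s := by
    rw [← sub_nonneg]
    have : 8 * R * N / q s - (2 * (n : ℝ) / q s + 1) = (8 * R * N - 2 * n - q s) / q s := by
      field_simp; ring
    rw [this]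
    have := H.q_s_le
    apply div_nonneg _ hs.le
    linarith
  have h4 : 2 / (1 / (4 * ζ * q s * Real.log N)) = 8 * ζ * q s * Real.log N := by
    field_simp; norm_num
  rw [h4]
  have hR0 : (0 : ℝ) < R := by exact_mod_cast hR
  calc _ ≤ (8 * R * N / q s) * (8 * ζ * q s * Real.log N + 4 * q s * (2 * ζ * Real.log N)) := by
        have : 0 ≤ 1 + Real.log (2 * q s * (1 / q u)) := by
          have : 0 ≤ Real.log (2 * q s * (1 / q u)) := by
            apply Real.log_nonneg
            rw [mul_one_div, le_div_iff₀ hu]; linarith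
          linarith
        gcongr
    _ = 128 * (R * ζ * (N * Real.log N)) := by field_simp; norm_num
    _ ≤ _ := by
        have : 0 < R * ζ * (N * Real.log N) := by positivity
        linarith

theorem IsScale.near_sum_le_of_dense {q : ℕ → ℕ} {C K ζ : ℝ} {R N s u : ℕ}
    (H : IsScale q C K ζ R N s u) {α : ℝ} {p : ℕ → ℤ} (h : IsConvergents α p q) (hC1 : 1 ≤ C)
    (hC : ∀ n, 3 ≤ n → (q (n + 1) : ℝ) ≤ C * (q n * Real.log (q n) ^ 3)) (hR : 1 ≤ R)
    (hζ : 0 < ζ) (hK : 1 + Real.log (8 * R) ≤ K) (hK' : 1 + Real.log (16 * C) ≤ K)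
    (hd : (q (s + 1) : ℝ) ≤ N * Real.log N ^ (15 / 16 : ℝ))
    {θ : ℝ} {a : ℤ} {n : ℕ} (hn : n ≤ 2 * R * N) {d : ℝ} (hd0 : 0 < d)
    (hfar : ∀ k ∈ Finset.Ico a (a + n), d ≤ distInt (θ + k * α)) :
    ∑ k ∈ (Finset.Ico a (a + n)).filter (fun k : ℤ => distInt (θ + k * α) < 1 / q u),
      1 / distInt (θ + k * α) ≤ 2 / d + 132 * R * ζ * (N * Real.log N) := by
  have hN := H.N_pos
  have hl : 0 < Real.log N := by linarith [H.one_le_log]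
  have hs : (0 : ℝ) < q s := by exact_mod_cast h.pos s
  have hs1 : (0 : ℝ) < q (s + 1) := by exact_mod_cast h.pos (s + 1)
  have hss : (q s : ℝ) ≤ q (s + 1) := by exact_mod_cast h.mono s.le_succ
  have hu : (0 : ℝ) < q u := by exact_mod_cast h.pos u
  have hus : (q u : ℝ) ≤ q s := by exact_mod_cast h.mono H.le_s
  have hR0 : (1 : ℝ) ≤ R := by exact_mod_cast hR
  have hn' : (n : ℝ) ≤ 2 * R * N := by exact_mod_cast hn
  set S := (Finset.Ico a (a + n)).filter (fun k : ℤ => distInt (θ + k * α) < 1 / q u) with hS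
  rw [← Finset.sum_filter_add_sum_filter_not S (fun k => distInt (θ + k * α) ≤ 1 / q s)]
  have h1 := sum_inv_distInt_le_of_short (h.pos (s + 1)) (h.coprime (s + 1)) (h.abs_le (s + 1)) θ
    (S := S.filter (fun k => distInt (θ + k * α) ≤ 1 / q s)) (d := d) (D := 1 / q s)
    (fun k hk l hl => by
      have hk1 := Finset.mem_Ico.1 (Finset.mem_filter.1 (Finset.mem_filter.1 hk).1).1
      have hl1 := Finset.mem_Ico.1 (Finset.mem_filter.1 (Finset.mem_filter.1 hl).1).1
      have h2 : (2 * n : ℝ) ≤ q (s + 1) := by linarith [H.lt_q_succ]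
      have h3 : 2 * n ≤ q (s + 1) := by exact_mod_cast h2
      have h4 : |k - l| ≤ n := by rw [abs_le]; constructor <;> linarith
      have h5 : (2 * n : ℤ) ≤ q (s + 1) := by exact_mod_cast h3
      linarith) hd0 (one_div_le_one_div_of_le hs (by linarith))
    (fun k hk => ⟨hfar k (Finset.mem_filter.1 (Finset.mem_filter.1 hk).1).1,
      (Finset.mem_filter.1 hk).2⟩)
  have h2 := sum_inv_distInt_le_of_window (h.pos s) (h.coprime s) (h.abs_le s) θ
    (S := S.filter (fun k => ¬ distInt (θ + k * α) ≤ 1 / q s))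
    (a := a) (n := n) ((Finset.filter_subset _ _).trans (Finset.filter_subset _ _))
    (d := 1 / q s) (D := 1 / q u) (by positivity) (one_div_le_one_div_of_le hu (by linarith))
    (fun k hk => ⟨(not_le.1 (Finset.mem_filter.1 hk).2).le,
      (Finset.mem_filter.1 (Finset.mem_filter.1 hk).1).2.le⟩)
  have h3 := H.one_add_log_le h.pos hR hζ hK
  have h4 : 2 * (n : ℝ) / q s + 1 ≤ 8 * R * N / q s := by
    rw [← sub_nonneg]
    have : 8 * R * N / q s - (2 * (n : ℝ) / q s + 1) = (8 * R * N - 2 * n - q s) / q s := by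
      field_simp; ring
    rw [this]
    have := H.q_s_le
    apply div_nonneg _ hs.le
    linarith
  have h5 : 2 / (1 / (q s : ℝ)) = 2 * q s := by field_simp
  rw [h5] at h2
  have hlog0 : 0 ≤ Real.log (2 * q s * (1 / q u)) := by
    apply Real.log_nonneg
    rw [mul_one_div, le_div_iff₀ hu]; linarith
  have h6 : (2 * (n : ℝ) / q s + 1) * (2 * q s + 4 * q s * (1 + Real.log (2 * q s * (1 / q u)))) ≤
      128 * (R * ζ * (N * Real.log N)) := by
    calc _ ≤ (8 * R * N / q s) * (2 * q s * (2 * ζ * Real.log N) +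
          4 * q s * (2 * ζ * Real.log N)) := by
          have e1 : (1 : ℝ) ≤ 2 * ζ * Real.log N := by linarith
          have e2 : 2 * (q s : ℝ) * 1 ≤ 2 * q s * (2 * ζ * Real.log N) := by gcongr
          have e3 : 0 ≤ 4 * (q s : ℝ) * (1 + Real.log (2 * q s * (1 / q u))) := by positivity
          exact mul_le_mul h4 (add_le_add (by linarith)
            (mul_le_mul_of_nonneg_left h3 (by positivity))) (by positivity) (by positivity)
      _ = 96 * (R * ζ * (N * Real.log N)) := by field_simp; norm_num
      _ ≤ _ := by
          have : 0 < R * ζ * (N * Real.log N) := by positivity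
          linarith
  have h7 : 1 + Real.log (2 * q (s + 1) * (1 / q s)) ≤ ζ * Real.log N ^ (1 / 16 : ℝ) := by
    have e1 : 2 * (q (s + 1) : ℝ) * (1 / q s) ≤ 16 * C * Real.log N ^ 3 := by
      rw [mul_one_div, div_le_iff₀ hs]
      have := hC s (H.three_le.trans H.le_s)
      have h8 := H.log_q_s_le h.pos
      have h9 : 0 ≤ Real.log (q s) := Real.log_natCast_nonneg _
      have h10 : Real.log (q s) ^ 3 ≤ (2 * Real.log N) ^ 3 := by gcongr
      have h11 : C * (q s * Real.log (q s) ^ 3) ≤ C * (q s * (2 * Real.log N) ^ 3) := by gcongr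
      nlinarith
    have e2 := Real.log_le_log (by positivity) e1
    rw [Real.log_mul (x := 16 * C) (by positivity) (by positivity), Real.log_pow] at e2
    push_cast at e2
    have := H.log_large
    linarith
  have h8 : 4 * (q (s + 1) : ℝ) * (1 + Real.log (2 * q (s + 1) * (1 / q s))) ≤
      4 * (R * ζ * (N * Real.log N)) := by
    have e1 : 0 ≤ Real.log (2 * q (s + 1) * (1 / q s)) := by
      apply Real.log_nonneg
      rw [mul_one_div, le_div_iff₀ hs]; linarith
    calc _ ≤ 4 * (N * Real.log N ^ (15 / 16 : ℝ)) * (ζ * Real.log N ^ (1 / 16 : ℝ)) := by gcongr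
      _ = 4 * (ζ * (N * (Real.log N ^ (15 / 16 : ℝ) * Real.log N ^ (1 / 16 : ℝ)))) := by ring
      _ = 4 * (1 * ζ * (N * Real.log N)) := by
          rw [← Real.rpow_add hl]; norm_num
      _ ≤ _ := by gcongr
  linarith

/-! ### Close visits to the singularity -/

/-- If `q_{s+1}` is much larger than `N`, then during the times `|k| ≤ RN` a slow point moves away
from its position at a time in `[0, q_s)` by small multiples of `‖q_s α‖ ≤ 1 / q_{s+1}` only, so
that it has no close visits to `0` at all. -/
theorem IsScale.distInt_ge_of_slow {q : ℕ → ℕ} {C K ζ : ℝ} {R N s u : ℕ}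
    (H : IsScale q C K ζ R N s u) {α : ℝ} {p : ℕ → ℤ} (h : IsConvergents α p q)
    (hq : ∀ n, cfDenom α n = q n) (hR : 1 ≤ R) (hζ : 0 < ζ) (hζ1 : ζ ≤ 1) (hK : 20 * R ≤ K)
    (hd : N * Real.log N ^ (15 / 16 : ℝ) < (q (s + 1) : ℝ)) {c : ℝ} {s₀ : ℕ} (hs₀ : s₀ ≤ s) {x : ℝ}
    (hx : (x : UnitAddCircle) ∈ slowPoints α q c s₀) {k : ℤ} (hk : |k| ≤ R * N) :
    1 / (2 * ζ * q s * Real.log N) ≤ distInt (x + k * α) := by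
  have hN := H.N_pos
  have hl1 := H.one_le_log
  set ℓ := Real.log N with hℓ
  have hl : 0 < ℓ := by linarith
  have hs : (0 : ℝ) < q s := by exact_mod_cast h.pos s
  have hs1 : (0 : ℝ) < q (s + 1) := by exact_mod_cast h.pos (s + 1)
  have hR0 : (1 : ℝ) ≤ R := by exact_mod_cast hR
  have hlq : Real.log (q s) ≤ 2 * ℓ := H.log_q_s_le h.pos
  have hlq0 : 0 < Real.log (q s) := by
    apply Real.log_pos
    have h1 := h.le_add_one s
    have h2 := H.three_le.trans H.le_s
    have : 2 ≤ q s := by omega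
    exact_mod_cast this
  set P := Real.log (q s) ^ (7 / 8 : ℝ) with hP
  have hP0 : 0 < P := by positivity
  -- all powers of `ℓ` are compared through `Q = ℓ^(1/16)`
  set Q := ℓ ^ (1 / 16 : ℝ) with hQ
  have hQ1 : 1 ≤ Q := Real.one_le_rpow hl1 (by norm_num)
  have hKQ : 20 * R ≤ ζ * Q := hK.trans H.le_rpow
  have e14 : ℓ ^ (7 / 8 : ℝ) = Q ^ 14 := by
    rw [hQ, ← Real.rpow_natCast, ← Real.rpow_mul hl.le]; norm_num
  have e15 : ℓ ^ (15 / 16 : ℝ) = Q ^ 15 := by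
    rw [hQ, ← Real.rpow_natCast, ← Real.rpow_mul hl.le]; norm_num
  have e16 : ℓ = Q ^ 16 := by
    rw [hQ, ← Real.rpow_natCast, ← Real.rpow_mul hl.le]; norm_num
  have hPle : P ≤ 2 * Q ^ 14 := by
    calc P ≤ (2 * ℓ) ^ (7 / 8 : ℝ) := Real.rpow_le_rpow hlq0.le hlq (by norm_num)
      _ = 2 ^ (7 / 8 : ℝ) * ℓ ^ (7 / 8 : ℝ) := Real.mul_rpow (by norm_num) hl.le
      _ ≤ 2 * ℓ ^ (7 / 8 : ℝ) := by
        gcongr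
        calc (2 : ℝ) ^ (7 / 8 : ℝ) ≤ 2 ^ (1 : ℝ) :=
              Real.rpow_le_rpow_of_exponent_le (by norm_num) (by norm_num)
          _ = 2 := Real.rpow_one 2
      _ = _ := by rw [e14]
  have hζQ : ζ * Q ≤ Q := by nlinarith
  have h10 : 10 * R * P ≤ Q ^ 15 := by
    calc 10 * R * P ≤ 10 * R * (2 * Q ^ 14) := by gcongr
      _ = 20 * R * Q ^ 14 := by ring
      _ ≤ Q * Q ^ 14 := by gcongr; linarith
      _ = _ := by ring
  have hPζ : P ≤ ζ * ℓ := by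
    have h2 : (2 : ℝ) ≤ ζ * Q := by linarith
    calc P ≤ 2 * Q ^ 14 := hPle
      _ ≤ (ζ * Q) * Q ^ 15 := by gcongr; norm_num
      _ = ζ * ℓ := by rw [e16]; ring
  rw [e15] at hd
  have hnot : s ∉ goodIndices α := by
    intro hmem
    simp only [goodIndices, mem_ofPred_eq, hq] at hmem
    have h3 : (q s : ℝ) * P ≤ 4 * R * N * P := by gcongr; exact H.q_s_le
    have h4 : N * (4 * R * P) ≤ N * Q ^ 15 := by gcongr; nlinarith
    linarith
  have hx2 := (mem_slowPoints_iff.1 hx).2 s hs₀ hnot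
  have hqz : (0 : ℤ) < q s := by exact_mod_cast h.pos s
  set k₀ := (k % q s).toNat with hk₀
  have hk₀' : (k₀ : ℤ) = k % q s := Int.toNat_of_nonneg (Int.emod_nonneg _ hqz.ne')
  have hk₀lt : k₀ < q s := by have := Int.emod_lt_of_pos k hqz; omega
  set i := k / (q s : ℤ) with hi
  have hki : k = k₀ + q s * i := by rw [hk₀', hi]; exact (Int.emod_add_mul_ediv k (q s)).symm
  have h5 := hx2 k₀ hk₀lt
  have h6 : distInt (i * (q s * α)) ≤ |(i : ℝ)| * (1 / q (s + 1)) := by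
    refine (distInt_mul_le i _).trans ?_
    gcongr
    exact (distInt_le _ (p s)).trans (h.approx s)
  have h7 : |(i : ℝ)| * q s ≤ 5 * R * N := by
    have e : (i : ℝ) * q s = k - k₀ := by
      have : (k : ℝ) = k₀ + q s * i := by exact_mod_cast hki
      rw [this]; ring
    have h8 : |(k : ℝ)| ≤ R * N := by exact_mod_cast hk
    have h9 : (k₀ : ℝ) ≤ 4 * R * N := by
      have : (k₀ : ℝ) ≤ q s := by exact_mod_cast hk₀lt.le
      linarith [H.q_s_le]
    calc |(i : ℝ)| * q s = |(i : ℝ) * q s| := by rw [abs_mul, Nat.abs_cast]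
      _ = |(k : ℝ) - k₀| := by rw [e]
      _ ≤ |(k : ℝ)| + |(k₀ : ℝ)| := abs_sub _ _
      _ ≤ _ := by rw [Nat.abs_cast]; linarith
  have h8 : |(i : ℝ)| * (1 / q (s + 1)) ≤ 1 / (2 * (q s * P)) := by
    rw [mul_one_div, div_le_div_iff₀ hs1 (by positivity)]
    calc |(i : ℝ)| * (2 * (q s * P)) = 2 * P * (|(i : ℝ)| * q s) := by ring
      _ ≤ 2 * P * (5 * R * N) := by gcongr
      _ = N * (10 * R * P) := by ring
      _ ≤ N * Q ^ 15 := by gcongr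
      _ ≤ 1 * q (s + 1) := by linarith
  have h9 : distInt (x + k₀ * α) ≤ distInt (x + k * α) + distInt (i * (q s * α)) := by
    have e : x + k₀ * α = (x + k * α) - i * (q s * α) := by
      have : (k : ℝ) = k₀ + q s * i := by exact_mod_cast hki
      rw [this]; ring
    rw [e]; exact distInt_sub_le _ _
  have h11 : 1 / (2 * ζ * q s * ℓ) ≤ 1 / (2 * (q s * P)) := by
    apply one_div_le_one_div_of_le (by positivity)
    calc 2 * (q s * P) ≤ 2 * (q s * (ζ * ℓ)) := by gcongr
      _ = _ := by ring
  have h12 : 1 / (q s * P) = 2 * (1 / (2 * (q s * P))) := by field_simp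
  linarith

/-- If `q_{s+1}` is not much larger than `N`, then at most one time `|k| ≤ RN` is a close visit:
two of them would give a multiple of `α` too close to an integer. -/
theorem IsScale.exists_exceptional {q : ℕ → ℕ} {C K ζ : ℝ} {R N s u : ℕ}
    (H : IsScale q C K ζ R N s u) {α : ℝ} {p : ℕ → ℤ} (h : IsConvergents α p q)
    (hd : (q (s + 1) : ℝ) ≤ N * Real.log N ^ (15 / 16 : ℝ)) {r : ℝ}
    (hr : 4 * r * (N * Real.log N ^ (15 / 16 : ℝ)) < 1) (x : ℝ) :
    ∃ b : ℤ, ∀ k : ℤ, |k| ≤ R * N → k ≠ b → r ≤ distInt (x + k * α) := by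
  by_cases hb : ∃ b : ℤ, |b| ≤ R * N ∧ distInt (x + b * α) < r
  · obtain ⟨b, hb1, hb2⟩ := hb
    refine ⟨b, fun k hk hne => ?_⟩
    by_contra hlt
    have hs1 : (0 : ℝ) < q (s + 1) := by exact_mod_cast h.pos (s + 1)
    have h1 : 2 * |k - b| ≤ q (s + 1) := by
      have h2 : |k - b| ≤ 2 * (R * N) := by
        have := abs_sub k b; linarith
      have h3 : 4 * R * N < q (s + 1) := by exact_mod_cast H.lt_q_succ
      have h4 : (4 * R * N : ℤ) < q (s + 1) := by exact_mod_cast h3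
      linarith
    have h2 := distInt_mul_ge (h.pos (s + 1)) (h.coprime (s + 1)) (h.abs_le (s + 1))
      (sub_ne_zero.2 hne) h1
    have e : ((k - b : ℤ) : ℝ) * α = (x + k * α) - (x + b * α) := by push_cast; ring
    rw [e] at h2
    have h3 := distInt_sub_le (x + k * α) (x + b * α)
    have h4 : 1 / (2 * (q (s + 1) : ℝ)) < 2 * r := by linarith [not_le.1 hlt]
    rw [div_lt_iff₀ (by positivity)] at h4
    have hr0 : 0 < r := (distInt_nonneg _).trans_lt hb2
    have h5 : r * q (s + 1) ≤ r * (N * Real.log N ^ (15 / 16 : ℝ)) := by gcongr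
    linarith
  · push Not at hb
    exact ⟨0, fun k hk _ => hb k hk⟩

/-! ### Divergence of nearby orbits -/

theorem exists_sub_eq_mul_deriv {G : ℝ → ℝ} {x y : ℝ} (hxy : x ≠ y)
    (hG : ∀ t ∈ uIcc x y, DifferentiableAt ℝ G t) :
    ∃ θ ∈ uIcc x y, G x - G y = (x - y) * deriv G θ := by
  rcases lt_or_gt_of_ne hxy with h | h
  · rw [uIcc_of_le h.le] at hG ⊢
    obtain ⟨θ, hθ, he⟩ := exists_deriv_eq_slope G h
      (fun t ht => (hG t ht).continuousAt.continuousWithinAt)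
      (fun t ht => (hG t (Ioo_subset_Icc_self ht)).differentiableWithinAt)
    refine ⟨θ, Ioo_subset_Icc_self hθ, ?_⟩
    have : y - x ≠ 0 := by linarith
    rw [he]; field_simp; ring
  · rw [uIcc_of_ge h.le] at hG ⊢
    obtain ⟨θ, hθ, he⟩ := exists_deriv_eq_slope G h
      (fun t ht => (hG t ht).continuousAt.continuousWithinAt)
      (fun t ht => (hG t (Ioo_subset_Icc_self ht)).differentiableWithinAt)
    refine ⟨θ, Ioo_subset_Icc_self hθ, ?_⟩
    have : x - y ≠ 0 := by linarith
    rw [he]; field_simp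

theorem le_distInt_of_mem_uIcc {x y t : ℝ} (ht : t ∈ uIcc x y) (s : ℝ) :
    distInt (x + s) - |x - y| ≤ distInt (t + s) := by
  have h1 : |t - x| ≤ |y - x| := abs_sub_left_of_mem_uIcc ht
  have h2 := distInt_add_le (t + s) (x - t)
  have h3 := distInt_le_abs (x - t)
  rw [show t + s + (x - t) = x + s by ring] at h2
  rw [abs_sub_comm] at h1
  rw [abs_sub_comm y x] at h1
  linarith

/-- The mean value theorem for the difference of the Birkhoff sums of two points whose orbit
segments are not separated by the singularity. -/
theorem IsArnoldRoof.exists_sum_sub_eq {f : UnitAddCircle → ℝ} (hf : IsArnoldRoof f) {α x y : ℝ}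
    (hxy : x ≠ y) (W : Finset ℤ) (hW : ∀ k ∈ W, |x - y| < distInt (x + k * α)) :
    ∃ θ ∈ uIcc x y, ∑ k ∈ W, (f ((x + k * α : ℝ) : UnitAddCircle) -
      f ((y + k * α : ℝ) : UnitAddCircle)) =
        (x - y) * ∑ k ∈ W, deriv (fun z : ℝ => f z) (θ + k * α) := by
  have hd : ∀ t ∈ uIcc x y, ∀ k ∈ W, DifferentiableAt ℝ (fun z : ℝ => f z) (t + k * α) := by
    intro t ht k hk
    exact hf.differentiableAt_lift (by linarith [le_distInt_of_mem_uIcc ht (k * α), hW k hk])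
  have hd' : ∀ t ∈ uIcc x y, ∀ k ∈ W,
      DifferentiableAt ℝ (fun t : ℝ => (fun z : ℝ => f z) (t + k * α)) t := by
    intro t ht k hk
    exact (differentiableAt_comp_add_const (f := fun z : ℝ => f z)).2 (hd t ht k hk)
  obtain ⟨θ, hθ, he⟩ := exists_sub_eq_mul_deriv
    (G := fun t => ∑ k ∈ W, (fun z : ℝ => f z) (t + k * α)) hxy
    (fun t ht => DifferentiableAt.fun_sum fun k hk => hd' t ht k hk)
  refine ⟨θ, hθ, ?_⟩
  rw [Finset.sum_sub_distrib]
  rw [deriv_fun_sum (fun k hk => hd' θ hθ k hk)] at he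
  refine he.trans ?_
  congr 1
  refine Finset.sum_congr rfl fun k _ => ?_
  exact deriv_comp_add_const (f := fun z : ℝ => f z) (k * α) θ

/-- Away from at most one exceptional index, the near visits of all points between `x` and `y`
contribute little, provided `|x - y|` is of order `1 / (N log N)`. -/
theorem IsScale.exists_near_sum_le {q : ℕ → ℕ} {C K ζ : ℝ} {R N s u : ℕ}
    (H : IsScale q C K ζ R N s u) {α : ℝ} {p : ℕ → ℤ} (h : IsConvergents α p q)
    (hq : ∀ n, cfDenom α n = q n) (hC1 : 1 ≤ C)
    (hC : ∀ n, 3 ≤ n → (q (n + 1) : ℝ) ≤ C * (q n * Real.log (q n) ^ 3)) (hR : 1 ≤ R)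
    (hζ : 0 < ζ) (hζ1 : ζ ≤ 1) (hK1 : 1 + Real.log (8 * R) ≤ K) (hK2 : 1 + Real.log (16 * C) ≤ K)
    (hK3 : 20 * R ≤ K) {M X : ℝ} (hM : 1 < M) (hX : 0 < X) (hK4 : 4 * M * X < K)
    (hXζ : X ≤ 1 / (16 * ζ * R)) {c : ℝ} {s₀ : ℕ} (hs₀ : s₀ ≤ s) {x y : ℝ}
    (hx : (x : UnitAddCircle) ∈ slowPoints α q c s₀) (hxy : x ≠ y)
    (hδX : |x - y| ≤ X / (N * Real.log N)) :
    ∃ b : ℤ, ∀ (a : ℤ) (n : ℕ), -(R * N : ℤ) ≤ a → a + n ≤ R * N →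
      b ∉ Finset.Ico a (a + n) → (∀ k ∈ Finset.Ico a (a + n), |x - y| < distInt (x + k * α)) ∧
      ∀ θ ∈ uIcc x y, ∑ k ∈ (Finset.Ico a (a + n)).filter
        (fun k : ℤ => distInt (θ + k * α) < 1 / q u), 1 / distInt (θ + k * α) ≤
          2 / ((M - 1) * |x - y|) + 132 * R * ζ * (N * Real.log N) := by
  have hN := H.N_pos
  have hl1 := H.one_le_log
  set ℓ := Real.log N with hℓ
  have hl : 0 < ℓ := by linarith
  set δ := |x - y| with hδ
  have hδ0 : 0 < δ := abs_pos.2 (sub_ne_zero.2 hxy)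
  have hsq : (0 : ℝ) < q s := by exact_mod_cast h.pos s
  have hR0 : (1 : ℝ) ≤ R := by exact_mod_cast hR
  have hM1 : 0 < M - 1 := by linarith
  have hkabs : ∀ (a : ℤ) (n : ℕ), -(R * N : ℤ) ≤ a → a + n ≤ R * N →
      ∀ k ∈ Finset.Ico a (a + n), |k| ≤ R * N := by
    intro a n h1 h2 k hk
    have := Finset.mem_Ico.1 hk
    rw [abs_le]; constructor <;> linarith
  have hnle : ∀ (a : ℤ) (n : ℕ), -(R * N : ℤ) ≤ a → a + n ≤ R * N → n ≤ 2 * R * N := by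
    intro a n h1 h2
    have : (n : ℤ) ≤ 2 * R * N := by linarith
    exact_mod_cast this
  rcases le_or_gt (q (s + 1) : ℝ) (N * ℓ ^ (15 / 16 : ℝ)) with hd | hd
  · have hr : 4 * (M * δ) * (N * ℓ ^ (15 / 16 : ℝ)) < 1 := by
      have h1 : 4 * M * X < ℓ ^ (1 / 16 : ℝ) := by
        have h2 := H.le_rpow
        have h3 : ζ * ℓ ^ (1 / 16 : ℝ) ≤ 1 * ℓ ^ (1 / 16 : ℝ) := by gcongr
        linarith
      calc 4 * (M * δ) * (N * ℓ ^ (15 / 16 : ℝ)) ≤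
          4 * (M * (X / (N * ℓ))) * (N * ℓ ^ (15 / 16 : ℝ)) := by gcongr
        _ = 4 * M * X * (ℓ ^ (15 / 16 : ℝ) / ℓ) := by field_simp
        _ < ℓ ^ (1 / 16 : ℝ) * (ℓ ^ (15 / 16 : ℝ) / ℓ) := by gcongr
        _ = 1 := by
          rw [← mul_div_assoc, ← Real.rpow_add hl]; norm_num
          exact hl.ne'
    obtain ⟨b, hb⟩ := H.exists_exceptional h hd hr x
    refine ⟨b, fun a n h1 h2 hbn => ?_⟩
    have h3 : ∀ k ∈ Finset.Ico a (a + n), M * δ ≤ distInt (x + k * α) := fun k hk =>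
      hb k (hkabs a n h1 h2 k hk) (fun e => hbn (e ▸ hk))
    refine ⟨fun k hk => lt_of_lt_of_le (by nlinarith) (h3 k hk), fun θ hθ => ?_⟩
    refine H.near_sum_le_of_dense h hC1 hC hR hζ hK1 hK2 hd
      (hnle a n h1 h2) (by positivity) (fun k hk => ?_)
    have := le_distInt_of_mem_uIcc hθ (k * α)
    have := h3 k hk
    linarith
  · refine ⟨0, fun a n h1 h2 _ => ?_⟩
    have h3 : ∀ k ∈ Finset.Ico a (a + n), 1 / (2 * ζ * q s * ℓ) ≤ distInt (x + k * α) :=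
      fun k hk => H.distInt_ge_of_slow h hq hR hζ hζ1 hK3 hd hs₀ hx
        (hkabs a n h1 h2 k hk)
    have h4 : δ ≤ 1 / (4 * ζ * q s * ℓ) := by
      calc δ ≤ X / (N * ℓ) := hδX
        _ ≤ 1 / (16 * ζ * R) / (N * ℓ) := by gcongr
        _ = 1 / (4 * ζ * (4 * R * N) * ℓ) := by field_simp; norm_num
        _ ≤ _ := by
          apply one_div_le_one_div_of_le (by positivity)
          gcongr; exact H.q_s_le
    have h5 : 1 / (2 * ζ * q s * ℓ) = 2 * (1 / (4 * ζ * q s * ℓ)) := by field_simp; norm_num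
    refine ⟨fun k hk => ?_, fun θ hθ => ?_⟩
    · have := h3 k hk
      linarith
    · have h6 := H.near_sum_le_of_far h hR hζ hK1 (hnle a n h1 h2) (θ := θ)
        (fun k hk => by
          have := le_distInt_of_mem_uIcc hθ (k * α)
          have := h3 k hk
          linarith)
      have : 0 ≤ 2 / ((M - 1) * δ) := by positivity
      linarith

set_option maxHeartbeats 1000000 in
/-- For `y` at a suitable distance from a slow point `x`, the difference of the Birkhoff sums of `f`
at `x` and `y` changes linearly with slope `κ / N` over the times `|n| ≤ RN`, with a single
exceptional index `b`. -/
theorem IsArnoldRoof.exists_exceptional_index {f : UnitAddCircle → ℝ} (hf : IsArnoldRoof f)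
    {A B : ℝ} (hA : 0 < A) (hB : 0 < B) (hAB : A ≠ B)
    (hder : ∀ η : ℝ, 0 < η → ∃ C : ℝ, 0 ≤ C ∧ ∀ t, 0 < t → t < 1 →
      |deriv (fun x : ℝ => f x) t + A / t - B / (1 - t)| ≤ η * (1 / t + 1 / (1 - t)) + C)
    {α : ℝ} {p : ℕ → ℤ} {q : ℕ → ℕ} (h : IsConvergents α p q) (hq : ∀ n, cfDenom α n = q n)
    {C : ℝ} (hC1 : 1 ≤ C) (hC : ∀ n, 3 ≤ n → (q (n + 1) : ℝ) ≤ C * (q n * Real.log (q n) ^ 3))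
    (c : ℝ) (s₀ : ℕ) (κ : ℝ) {R : ℕ} (hR : 1 ≤ R) {η : ℝ} (hη : 0 < η) :
    ∃ ζ' : ℝ, 0 < ζ' ∧ ∀ᶠ N : ℕ in atTop, ∀ x y : ℝ,
      (x : UnitAddCircle) ∈ slowPoints α q c s₀ → x ≠ y →
      |(B - A) * (x - y) * (N * Real.log N) - κ| ≤ ζ' →
      ∃ b : ℤ, ∀ (a : ℤ) (n : ℕ), -(R * N : ℤ) ≤ a → a + n ≤ R * N →
        b ∉ Finset.Ico a (a + n) →
        |∑ k ∈ Finset.Ico a (a + n), (f ((x + k * α : ℝ) : UnitAddCircle) -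
          f ((y + k * α : ℝ) : UnitAddCircle)) - κ * (n / N)| ≤ η := by
  have hR0 : (1 : ℝ) ≤ R := by exact_mod_cast hR
  set L := |B - A| with hL
  have hL0 : 0 < L := abs_pos.2 (sub_ne_zero.2 hAB.symm)
  -- the constants are such that each of the error terms below is at most a fraction of `η`
  set κ' := |κ| + 1 with hκ'
  have hκ0 : 0 < κ' := by positivity
  set η₁ := min 1 (η * L / (32 * R * κ')) with hη₁
  have hη₁0 : 0 < η₁ := lt_min one_pos (by positivity)
  have hη₁1 : η₁ ≤ 1 := min_le_left _ _
  have hη₁2 : κ' / L * (4 * η₁ * R) ≤ η / 8 := by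
    calc κ' / L * (4 * η₁ * R) ≤ κ' / L * (4 * (η * L / (32 * R * κ')) * R) := by
          gcongr; exact min_le_right _ _
      _ = η / 8 := by field_simp; norm_num
  obtain ⟨C', hC'0, hC'⟩ := hder η₁ hη₁0
  set K₁ := A + B + 2 with hK₁
  have hK₁0 : 0 < K₁ := by positivity
  set M := 1 + 16 * K₁ / η with hM
  have hM1 : 0 < M - 1 := by rw [hM]; simp only [add_sub_cancel_left]; positivity
  have hM2 : 2 * K₁ / (M - 1) = η / 8 := by
    rw [hM]; simp only [add_sub_cancel_left]; field_simp; norm_num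
  set ζ := min (min 1 (η / (16 * R * κ'))) (min (η * L / (8 * κ' * (134 * R * K₁ + 1)))
    (L / (16 * R * κ'))) with hζdef
  have hζ : 0 < ζ :=
    lt_min (lt_min one_pos (by positivity)) (lt_min (by positivity) (by positivity))
  have hζ1 : ζ ≤ 1 := (min_le_left _ _).trans (min_le_left _ _)
  have hζ2 : 2 * R * ζ * κ' ≤ η / 8 := by
    calc 2 * R * ζ * κ' ≤ 2 * R * (η / (16 * R * κ')) * κ' := by
          gcongr; exact (min_le_left _ _).trans (min_le_right _ _)
      _ = η / 8 := by field_simp; norm_num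
  have hζ3 : κ' / L * ((134 * R * K₁ + 1) * ζ) ≤ η / 8 := by
    calc κ' / L * ((134 * R * K₁ + 1) * ζ) ≤
        κ' / L * ((134 * R * K₁ + 1) * (η * L / (8 * κ' * (134 * R * K₁ + 1)))) := by
          gcongr; exact (min_le_right _ _).trans (min_le_left _ _)
      _ = η / 8 := by field_simp
  have hζ4 : κ' / L ≤ 1 / (16 * ζ * R) := by
    rw [div_le_div_iff₀ hL0 (by positivity)]
    have h1 : ζ ≤ L / (16 * R * κ') := (min_le_right _ _).trans (min_le_right _ _)
    rw [le_div_iff₀ (by positivity)] at h1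
    linarith
  have hl8 : 0 ≤ Real.log (8 * R) := Real.log_nonneg (by linarith)
  have hl16 : 0 ≤ Real.log (16 * C) := Real.log_nonneg (by linarith)
  set K := |Real.log C - Real.log ζ| + (1 + Real.log (8 * R)) + (1 + Real.log (16 * C)) +
    20 * R + (8 * R + 4) + 2 * R * C' + 4 * M * κ' / L with hK
  have g1 := abs_nonneg (Real.log C - Real.log ζ)
  have g2 : 0 ≤ 2 * R * C' := by positivity
  have hM0 : 0 < M := by linarith
  have g3 : 0 ≤ 4 * M * κ' / L := by positivity
  have k1 : Real.log C - Real.log ζ ≤ K := by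
    have := le_abs_self (Real.log C - Real.log ζ); rw [hK]; linarith
  have k2 : 1 + Real.log (8 * R) ≤ K := by rw [hK]; linarith
  have k3 : 1 + Real.log (16 * C) ≤ K := by rw [hK]; linarith
  have k4 : 20 * R ≤ K := by rw [hK]; linarith
  have k5 : (8 * R + 4 : ℝ) ≤ K := by rw [hK]; linarith
  have k6 : 2 * R * C' ≤ K := by rw [hK]; linarith
  have k7 : 4 * M * (κ' / L) < K := by rw [hK, ← mul_div_assoc]; linarith
  clear_value K ζ M η₁
  refine ⟨min 1 (η / (8 * R)), lt_min one_pos (by positivity), ?_⟩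
  filter_upwards [eventually_isScale h hC1 hC (K := K) hζ hζ1 k1 hR s₀]
    with N ⟨s, u, hs₀, H⟩ x y hx hxy hκ
  have hN := H.N_pos
  have hl1 := H.one_le_log
  set ℓ := Real.log N with hℓ
  have hl : 0 < ℓ := by linarith
  set δ := |x - y| with hδ
  have hδ0 : 0 < δ := abs_pos.2 (sub_ne_zero.2 hxy)
  have hδL : L * δ * (N * ℓ) ≤ κ' := by
    have h1 : |(B - A) * (x - y) * (N * ℓ)| = L * δ * (N * ℓ) := by
      rw [abs_mul, abs_mul, abs_of_pos (show 0 < N * ℓ by positivity)]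
    rw [← h1]
    have h2 := abs_sub_abs_le_abs_sub ((B - A) * (x - y) * (N * ℓ)) κ
    have h3 := hκ.trans (min_le_left _ _)
    linarith
  have hδle : δ ≤ κ' / L / (N * ℓ) := by
    rw [le_div_iff₀ (by positivity), le_div_iff₀ hL0]; linarith only [hδL]
  have hKζ : K ≤ ζ * ℓ := H.le_mul_log hζ
  have hsq : (0 : ℝ) < q s := by exact_mod_cast h.pos s
  obtain ⟨b, hb⟩ := H.exists_near_sum_le h hq hC1 hC hR hζ hζ1 (M := M) (X := κ' / L)
    k2 k3 k4 (by linarith only [hM1]) (by positivity) k7 hζ4 hs₀ hx hxy hδle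
  refine ⟨b, fun a n h1 h2 hbn => ?_⟩
  obtain ⟨h3, h4⟩ := hb a n h1 h2 hbn
  obtain ⟨θ, hθ, he⟩ := hf.exists_sum_sub_eq hxy (Finset.Ico a (a + n)) h3
  have h5 := IsArnoldRoof.abs_sum_deriv_sub_le hA hB hη₁0 hC' (h.pos u) (h.coprime u) (h.abs_le u)
    θ a n (fun k hk => by linarith [le_distInt_of_mem_uIcc hθ (k * α), h3 k hk])
  have h6 := h4 θ hθ
  rw [he]
  set S := ∑ k ∈ Finset.Ico a (a + n), deriv (fun z : ℝ => f z) (θ + k * α) with hS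
  set Near := ∑ k ∈ (Finset.Ico a (a + n)).filter
        (fun k : ℤ => distInt (θ + k * α) < 1 / q u), 1 / distInt (θ + k * α)
  set ℓu := Real.log (q u) with hℓu
  have hn0 : (0 : ℝ) ≤ n := Nat.cast_nonneg n
  have hn : (n : ℝ) ≤ 2 * R * N := by
    have : (n : ℤ) ≤ 2 * R * N := by linarith
    exact_mod_cast this
  have hu0 : 0 ≤ ℓu := Real.log_natCast_nonneg _
  have hqu : (q u : ℝ) ≤ ζ * N := H.q_u_le
  have hqu0 : (0 : ℝ) ≤ q u := Nat.cast_nonneg _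
  have huℓ : ℓu ≤ ℓ := Real.log_le_log (by exact_mod_cast h.pos u)
    (hqu.trans (mul_le_of_le_one_left hN.le hζ1))
  have hNear0 : 0 ≤ Near := Finset.sum_nonneg fun k _ => one_div_nonneg.2 (distInt_nonneg _)
  have hT : |S - (B - A) * (n * ℓu)| ≤
      ((134 * R * K₁ + 1) * ζ + 4 * η₁ * R) * (N * ℓ) + K₁ * (2 / ((M - 1) * δ)) := by
    refine h5.trans ?_
    have e1 : (A + B + 2 * η₁) * (4 * n + q u * (ℓu + 4)) ≤ K₁ * (2 * ζ * (N * ℓ)) := by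
      have e2 : 4 * (n : ℝ) + q u * (ℓu + 4) ≤ 4 * (2 * R * N) + ζ * N * (ℓ + 4) := by gcongr
      have e3 : (8 * R + 4 : ℝ) ≤ ζ * ℓ := k5.trans hKζ
      have e4 : (8 * R + 4) * (N : ℝ) ≤ ζ * ℓ * N := by gcongr
      have e5 : ζ * (N : ℝ) ≤ N := mul_le_of_le_one_left hN.le hζ1
      have e6 : 4 * (n : ℝ) + q u * (ℓu + 4) ≤ 2 * ζ * (N * ℓ) := by linarith only [e2, e4, e5]
      have e7 : A + B + 2 * η₁ ≤ K₁ := by linarith only [hη₁1, hK₁]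
      gcongr
    have e2 : 2 * η₁ * (n * ℓu) ≤ 2 * η₁ * (2 * R * N * ℓ) := by gcongr
    have e3 : C' * n ≤ ζ * (N * ℓ) := by
      have e4 : 2 * R * C' ≤ ζ * ℓ := k6.trans hKζ
      calc C' * n ≤ C' * (2 * R * N) := by gcongr
        _ = 2 * R * C' * N := by ring
        _ ≤ ζ * ℓ * N := by gcongr
        _ = _ := by ring
    have e4 : (A + B + 2 * η₁) * Near ≤
        K₁ * (2 / ((M - 1) * δ) + 132 * R * ζ * (N * ℓ)) := by
      have e7 : A + B + 2 * η₁ ≤ K₁ := by linarith only [hη₁1, hK₁]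
      gcongr
    have e5 : K₁ * (2 * ζ * (N * ℓ)) ≤ K₁ * (2 * R * ζ * (N * ℓ)) := by
      have : 2 * ζ ≤ 2 * R * ζ := by
        have : ζ ≤ R * ζ := le_mul_of_one_le_left hζ.le hR0
        linarith only [this]
      gcongr
    linarith only [e1, e2, e3, e4, e5]
  have hT' : δ * |S - (B - A) * (n * ℓu)| ≤ 3 * (η / 8) := by
    have e0 : 0 ≤ (134 * R * K₁ + 1) * ζ + 4 * η₁ * R := by positivity
    calc δ * |S - (B - A) * (n * ℓu)| ≤ δ * (((134 * R * K₁ + 1) * ζ + 4 * η₁ * R) * (N * ℓ) +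
          K₁ * (2 / ((M - 1) * δ))) := by gcongr
      _ = (δ * (N * ℓ)) * ((134 * R * K₁ + 1) * ζ + 4 * η₁ * R) + 2 * K₁ / (M - 1) := by
          field_simp
      _ ≤ (κ' / L) * ((134 * R * K₁ + 1) * ζ + 4 * η₁ * R) + 2 * K₁ / (M - 1) := by
          gcongr
          rw [le_div_iff₀ hL0]; linarith only [hδL]
      _ ≤ _ := by rw [hM2, mul_add]; linarith only [hζ3, hη₁2]
  have hU : δ * L * (n * (ℓ - ℓu)) ≤ η / 8 := by
    have e1 : ℓ - ℓu ≤ ζ * ℓ := by have := H.le_log_q_u; linarith only [this]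
    calc δ * L * (n * (ℓ - ℓu)) ≤ δ * L * (2 * R * N * (ζ * ℓ)) := by
          have : 0 ≤ ℓ - ℓu := by linarith
          gcongr
      _ = 2 * R * ζ * (L * δ * (N * ℓ)) := by ring
      _ ≤ 2 * R * ζ * κ' := by gcongr
      _ ≤ _ := hζ2
  have hV : |(n / N : ℝ) * ((B - A) * (x - y) * (N * ℓ) - κ)| ≤ η / 4 := by
    rw [abs_mul, abs_of_nonneg (by positivity)]
    have e1 : (n / N : ℝ) ≤ 2 * R := by rw [div_le_iff₀ hN]; exact hn
    calc (n / N : ℝ) * |(B - A) * (x - y) * (N * ℓ) - κ| ≤ 2 * R * (η / (8 * R)) := by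
          gcongr
          exact hκ.trans (min_le_right _ _)
      _ = η / 4 := by field_simp; norm_num
  -- the error of the sum of derivatives, that of replacing `log q_u` by `log N`, and that of the
  -- slope
  have hsplit : (x - y) * S - κ * (n / N) = (x - y) * (S - (B - A) * (n * ℓu)) -
      (x - y) * (B - A) * (n * (ℓ - ℓu)) +
      (n / N : ℝ) * ((B - A) * (x - y) * (N * ℓ) - κ) := by
    field_simp; ring
  rw [hsplit]
  have w1 : |(x - y) * (S - (B - A) * (n * ℓu))| ≤ 3 * (η / 8) := by rw [abs_mul]; exact hT'
  have w2 : |(x - y) * (B - A) * (n * (ℓ - ℓu))| ≤ η / 8 := by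
    rw [abs_mul, abs_mul, abs_of_nonneg (show 0 ≤ n * (ℓ - ℓu) from
      mul_nonneg hn0 (by linarith))]
    exact hU
  have v1 := abs_le.1 w1
  have v2 := abs_le.1 w2
  have v3 := abs_le.1 hV
  rw [abs_le]
  constructor <;> linarith only [v1.1, v1.2, v2.1, v2.2, v3.1, v3.2]

/-- The time scale that belongs to a distance `δ`: a number `N` with `δ N log N ≈ κ`. -/
theorem exists_natCast_mul_log_near {κ ε : ℝ} (hκ : 0 < κ) (hε : 0 < ε) (N₀ : ℕ) :
    ∃ δ₀ : ℝ, 0 < δ₀ ∧ ∀ δ : ℝ, 0 < δ → δ < δ₀ →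
      ∃ N : ℕ, N₀ ≤ N ∧ |δ * (N * Real.log N) - κ| ≤ ε := by
  obtain ⟨N₁, hN₁⟩ := exists_nat_gt (3 * κ / ε)
  set m := max (max N₀ N₁) 3 with hm
  set g : ℕ → ℝ := fun n => n * Real.log n with hg
  have hgmono : ∀ i j : ℕ, i ≤ j → g i ≤ g j := by
    intro i j hij
    rcases Nat.eq_zero_or_pos i with rfl | hi
    · simp only [hg, Nat.cast_zero, zero_mul]
      exact mul_nonneg (Nat.cast_nonneg _) (Real.log_natCast_nonneg _)
    · have h1 : (i : ℝ) ≤ j := by exact_mod_cast hij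
      have h2 : (0 : ℝ) < i := by exact_mod_cast hi
      exact mul_le_mul h1 (Real.log_le_log h2 h1) (Real.log_natCast_nonneg _) (Nat.cast_nonneg _)
  have hgm : 0 ≤ g m := mul_nonneg (Nat.cast_nonneg _) (Real.log_natCast_nonneg _)
  refine ⟨κ / (g m + 1), by positivity, fun δ hδ hδ₀ => ?_⟩
  have hex : ∃ n : ℕ, κ < δ * g n := by
    obtain ⟨n, hn⟩ := exists_nat_gt (max 3 (κ / δ))
    refine ⟨n, ?_⟩
    have h1 : (3 : ℝ) < n := (le_max_left _ _).trans_lt hn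
    have h2 : κ / δ < n := (le_max_right _ _).trans_lt hn
    rw [div_lt_iff₀ hδ] at h2
    have h3 : 1 ≤ Real.log n := by
      rw [Real.le_log_iff_exp_le (by linarith)]
      linarith [Real.exp_one_lt_d9]
    have h4 : (n : ℝ) ≤ g n := by simp only [hg]; nlinarith
    calc κ < n * δ := h2
      _ ≤ g n * δ := by gcongr
      _ = _ := mul_comm _ _
  classical
  have hfind := Nat.find_spec hex
  have hlt : m < Nat.find hex := by
    by_contra hcon
    have h1 := hgmono _ _ (not_lt.1 hcon)
    have h2 : δ * (g m + 1) < κ := by rwa [lt_div_iff₀ (by positivity)] at hδ₀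
    have h3 : δ * g (Nat.find hex) ≤ δ * g m := by gcongr
    linarith
  obtain ⟨N, hN⟩ : ∃ N, Nat.find hex = N + 1 := ⟨Nat.find hex - 1, by omega⟩
  have hmN : m ≤ N := by omega
  have hle : δ * g N ≤ κ := not_lt.1 (Nat.find_min hex (by omega : N < Nat.find hex))
  rw [hN] at hfind
  have hN3 : 3 ≤ N := (le_max_right _ _).trans hmN
  have hN3' : (3 : ℝ) ≤ N := by exact_mod_cast hN3
  have hNN₁ : (N₁ : ℝ) ≤ N := by
    exact_mod_cast ((le_max_right _ _).trans (le_max_left _ _)).trans hmN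
  refine ⟨N, ((le_max_left _ _).trans (le_max_left _ _)).trans hmN, ?_⟩
  have hl : 1 ≤ Real.log N := by
    rw [Real.le_log_iff_exp_le (by linarith)]
    linarith [Real.exp_one_lt_d9]
  have hstep : g (N + 1) ≤ g N + 3 * Real.log N := by
    have h1 : Real.log (N + 1) ≤ Real.log N + 1 / N := by
      have e : (N : ℝ) + 1 = N * (1 + 1 / N) := by field_simp
      rw [e, Real.log_mul (by positivity) (by positivity)]
      have := Real.log_le_sub_one_of_pos (show (0 : ℝ) < 1 + 1 / N by positivity)
      linarith
    simp only [hg]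
    push_cast
    have h2 : ((N : ℝ) + 1) * Real.log (N + 1) ≤ (N + 1) * (Real.log N + 1 / N) := by gcongr
    have h3 : ((N : ℝ) + 1) * (1 / N) ≤ 2 := by
      rw [mul_one_div, div_le_iff₀ (by linarith)]; linarith
    nlinarith
  have h4 : δ * (3 * Real.log N) ≤ ε := by
    have h5 : 3 * κ < ε * N := by
      rw [div_lt_iff₀ hε] at hN₁; nlinarith
    have h6 : δ * Real.log N * N ≤ κ := by simp only [hg] at hle; linarith
    have h7 : 3 * (δ * Real.log N) * N ≤ ε * N := by linarith
    have := le_of_mul_le_mul_right h7 (by linarith)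
    linarith
  rw [abs_le]
  simp only [hg] at hle hfind hstep ⊢
  constructor
  · have : δ * (((N + 1 : ℕ) : ℝ) * Real.log ((N + 1 : ℕ) : ℝ)) ≤
      δ * (N * Real.log N + 3 * Real.log N) := by gcongr
    linarith
  · linarith

/-! ### Birkhoff sums on the circle -/

namespace SpecialFlow

variable {X : Type*}

theorem birkhoff_zero (T : Equiv.Perm X) (f : X → ℝ) (x : X) : birkhoff T f 0 x = 0 := by
  simp [birkhoff]

theorem birkhoff_sub_birkhoff (T : Equiv.Perm X) (f : X → ℝ) (x : X) {a a' : ℤ} (h : a ≤ a') :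
    birkhoff T f a' x - birkhoff T f a x = ∑ k ∈ Finset.Ico a a', f ((T ^ k) x) := by
  induction a', h using Int.leInduction with
  | base => simp
  | succ n hn ih =>
    have h1 : Finset.Ico a (n + 1) = insert n (Finset.Ico a n) := by
      ext k; simp only [Finset.mem_insert, Finset.mem_Ico]; omega
    rw [birkhoff_add_one, h1, Finset.sum_insert (by simp), ← ih]
    ring

theorem birkhoff_mono_add {T : Equiv.Perm X} {f : X → ℝ} {c : ℝ} (hc : ∀ x, c ≤ f x)
    (x : X) {a a' : ℤ} (h : a ≤ a') :
    birkhoff T f a x + c * (a' - a) ≤ birkhoff T f a' x := by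
  have h1 := birkhoff_sub_birkhoff T f x h
  have h2 : ∑ _k ∈ Finset.Ico a a', c ≤ ∑ k ∈ Finset.Ico a a', f ((T ^ k) x) :=
    Finset.sum_le_sum fun k _ => hc _
  rw [Finset.sum_const, Int.card_Ico, nsmul_eq_mul] at h2
  have h3 : (((a' - a).toNat : ℕ) : ℝ) = a' - a := by
    have : ((a' - a).toNat : ℤ) = a' - a := Int.toNat_of_nonneg (by linarith)
    exact_mod_cast this
  rw [h3] at h2
  linarith

theorem birkhoff_mono {T : Equiv.Perm X} {f : X → ℝ} (hf : ∀ x, 0 < f x) (x : X) {a a' : ℤ}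
    (h : a ≤ a') : birkhoff T f a x ≤ birkhoff T f a' x := by
  have := birkhoff_mono_add (T := T) (fun x => (hf x).le) x h
  linarith

/-- The difference of the Birkhoff sums of `f` at `x` and `y`. -/
def birkhoffDiff (T : Equiv.Perm X) (f : X → ℝ) (x y : X) (n : ℤ) : ℝ :=
  birkhoff T f n x - birkhoff T f n y

theorem birkhoffDiff_zero (T : Equiv.Perm X) (f : X → ℝ) (x y : X) :
    birkhoffDiff T f x y 0 = 0 := by
  simp [birkhoffDiff, birkhoff_zero]

theorem birkhoffDiff_sub (T : Equiv.Perm X) (f : X → ℝ) (x y : X) {a a' : ℤ} (h : a ≤ a') :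
    birkhoffDiff T f x y a' - birkhoffDiff T f x y a =
      ∑ k ∈ Finset.Ico a a', (f ((T ^ k) x) - f ((T ^ k) y)) := by
  rw [Finset.sum_sub_distrib, ← birkhoff_sub_birkhoff T f x h, ← birkhoff_sub_birkhoff T f y h]
  unfold birkhoffDiff; ring

/-- Over the times `|n| ≤ RN`, the sequence `D` grows with slope `κ / N` up to an error `η`, except
for a jump at the index `b`. -/
def IsAlmostLinear (D : ℤ → ℝ) (N R : ℕ) (κ η : ℝ) (b : ℤ) : Prop :=
  ∀ a a' : ℤ, -(R * N : ℤ) ≤ a → a ≤ a' → a' ≤ R * N → b ∉ Finset.Ico a a' →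
    |D a' - D a - κ * ((a' - a) / N)| ≤ η

theorem IsAlmostLinear.of_lt_zero {D : ℤ → ℝ} {N R : ℕ} {κ η : ℝ} {b : ℤ}
    (h : IsAlmostLinear D N R κ η b) (h0 : D 0 = 0) (hb : b < 0) {n : ℤ} (hn : 0 ≤ n)
    (hn' : n ≤ R * N) : |D n - κ * (n / N)| ≤ η := by
  have := h 0 n (by have : (0 : ℤ) ≤ R * N := by positivity
                    linarith) hn hn' (by simp; omega)
  simpa [h0] using this

theorem IsAlmostLinear.of_nonneg {D : ℤ → ℝ} {N R : ℕ} {κ η : ℝ} {b : ℤ}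
    (h : IsAlmostLinear D N R κ η b) (h0 : D 0 = 0) (hb : 0 ≤ b) {n : ℤ} (hn : n ≤ 0)
    (hn' : -(R * N : ℤ) ≤ n) : |D n - κ * (n / N)| ≤ η := by
  have := h n 0 hn' hn (by positivity) (by simp; omega)
  rw [h0, Int.cast_zero] at this
  rw [← abs_neg]
  refine le_trans (le_of_eq ?_) this
  congr 1; ring

end SpecialFlow

theorem circleRotation_zpow_apply (α x : ℝ) (k : ℤ) :
    (circleRotation α ^ k) (x : UnitAddCircle) = ((x + k * α : ℝ) : UnitAddCircle) := by
  have hone : ∀ z : ℝ, circleRotation α (z : UnitAddCircle) = ((z + α : ℝ) : UnitAddCircle) :=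
    fun z => rfl
  induction k with
  | zero => simp
  | succ i ih =>
    rw [add_comm, zpow_add, Equiv.Perm.mul_apply, ih, zpow_one, hone]
    push_cast; ring_nf
  | pred i ih =>
    rw [sub_eq_add_neg, add_comm, zpow_add, Equiv.Perm.mul_apply, ih, zpow_neg_one,
      Equiv.Perm.inv_eq_iff_eq, hone]
    push_cast; ring_nf

theorem exists_coe_eq_dist (x : ℝ) (y : UnitAddCircle) :
    ∃ y' : ℝ, (y' : UnitAddCircle) = y ∧ |x - y'| = dist (x : UnitAddCircle) y := by
  induction y using QuotientAddGroup.induction_on with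
  | H t =>
  refine ⟨t + round (x - t), ?_, ?_⟩
  · have h1 : ((round (x - t) : ℝ) : UnitAddCircle) = 0 := by
      rw [AddCircle.coe_eq_zero_iff]
      exact ⟨round (x - t), by simp⟩
    rw [AddCircle.coe_add, h1, add_zero]
  · rw [dist_eq_norm]
    have : ‖(x : UnitAddCircle) - (t : UnitAddCircle)‖ = distInt (x - t) := by
      rw [distInt, AddCircle.coe_sub]
    refine Eq.trans ?_ this.symm
    rw [distInt_eq]; congr 1; ring

open SpecialFlow

/-- The divergence of nearby orbits: the differences of Birkhoff sums are almost linear with one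
exceptional index. -/
theorem exists_isAlmostLinear {α : ℝ} (hD : α ∈ diophD) {f : UnitAddCircle → ℝ}
    (hf : IsArnoldRoof f) {p : ℕ → ℤ} {q : ℕ → ℕ} (hq : ∀ n, cfDenom α n = q n)
    (h : IsConvergents α p q) (c : ℝ) (s₀ : ℕ) {κ : ℝ} (hκ : 0 < κ) {R : ℕ} (hR : 1 ≤ R) {η : ℝ}
    (hη : 0 < η) (P : ℕ → Prop) (hP : ∀ᶠ N in atTop, P N) :
    ∃ δ₀ : ℝ, 0 < δ₀ ∧ ∀ x ∈ slowPoints α q c s₀, ∀ y, x ≠ y → dist x y < δ₀ →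
      ∃ N : ℕ, P N ∧ dist x y * N ≤ 1 ∧ ∃ κ' : ℝ, |κ'| = κ ∧ ∃ b : ℤ,
        IsAlmostLinear (birkhoffDiff (circleRotation α) f x y) N R κ' η b := by
  obtain ⟨C, hC1, hC⟩ := exists_growth_of_mem_diophD hD hq h
  obtain ⟨A, B, hA, hB, hAB, hder⟩ := hf.exists_deriv_asymptotics
  obtain ⟨ζ₁, hζ₁, h₁⟩ := hf.exists_exceptional_index hA hB hAB hder h hq hC1 hC c s₀ κ hR hη
  obtain ⟨ζ₂, hζ₂, h₂⟩ := hf.exists_exceptional_index hA hB hAB hder h hq hC1 hC c s₀ (-κ) hR hη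
  have hL0 : 0 < |B - A| := abs_pos.2 (sub_ne_zero.2 hAB.symm)
  have hlog : ∀ᶠ N : ℕ in atTop, (κ + ζ₁) / |B - A| ≤ Real.log N :=
    (Real.tendsto_log_atTop.comp tendsto_natCast_atTop_atTop).eventually_ge_atTop _
  obtain ⟨N₀, hN₀⟩ := eventually_atTop.1 ((h₁.and h₂).and
    (hP.and (hlog.and (eventually_ge_atTop 3))))
  obtain ⟨δ₁, hδ₁, hnear⟩ := exists_natCast_mul_log_near hκ (lt_min hζ₁ hζ₂) N₀
  refine ⟨δ₁ / |B - A|, by positivity, fun x hx y hxy hd => ?_⟩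
  induction x using QuotientAddGroup.induction_on with
  | H x =>
  change (x : UnitAddCircle) ∈ _ at hx
  obtain ⟨y', rfl, hy'⟩ := exists_coe_eq_dist x y
  have hne : x ≠ y' := fun e => hxy (by rw [e])
  have hd' : |x - y'| < δ₁ / |B - A| := by rw [hy']; exact hd
  rw [lt_div_iff₀ hL0] at hd'
  obtain ⟨N, hNN, hN⟩ := hnear (|x - y'| * |B - A|)
    (mul_pos (abs_pos.2 (sub_ne_zero.2 hne)) hL0) hd'
  obtain ⟨⟨g₁, g₂⟩, hPN, hlogN, hN3⟩ := hN₀ N hNN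
  have hsum : ∀ κ' : ℝ, ∀ b : ℤ, (∀ (a : ℤ) (n : ℕ), -(R * N : ℤ) ≤ a → a + n ≤ R * N →
        b ∉ Finset.Ico a (a + n) →
        |∑ k ∈ Finset.Ico a (a + n), (f ((x + k * α : ℝ) : UnitAddCircle) -
          f ((y' + k * α : ℝ) : UnitAddCircle)) - κ' * (n / N)| ≤ η) →
      IsAlmostLinear (birkhoffDiff (circleRotation α) f x y') N R κ' η b := by
    intro κ' b hb a a' h1 h2 h3 h4
    obtain ⟨n, hn⟩ : ∃ n : ℕ, a' = a + n := ⟨(a' - a).toNat, by omega⟩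
    subst hn
    rw [birkhoffDiff_sub _ _ _ _ h2]
    have := hb a n h1 h3 h4
    simp only [circleRotation_zpow_apply]
    push_cast
    simpa using this
  refine ⟨N, hPN, ?_, ?_⟩
  · have h1 := (abs_le.1 (hN.trans (min_le_left _ _))).2
    rw [div_le_iff₀ hL0] at hlogN
    have hlog0 : 0 < Real.log N := Real.log_pos (by exact_mod_cast (by omega : 1 < N))
    rw [← hy']
    by_contra hcon
    push Not at hcon
    have h2 : |B - A| * Real.log N < |x - y'| * N * (|B - A| * Real.log N) := by
      have := mul_lt_mul_of_pos_right hcon (mul_pos hL0 hlog0)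
      linarith
    linarith
  rw [← abs_mul] at hN
  rcases le_total 0 ((x - y') * (B - A)) with hs | hs
  · rw [abs_of_nonneg hs] at hN
    obtain ⟨b, hb⟩ := g₁ x y' hx hne (by
      rw [mul_comm (B - A)]; exact hN.trans (min_le_left _ _))
    exact ⟨κ, abs_of_pos hκ, b, hsum κ b hb⟩
  · rw [abs_of_nonpos hs] at hN
    obtain ⟨b, hb⟩ := g₂ x y' hx hne (by
      rw [mul_comm (B - A)]
      refine le_trans (le_of_eq ?_) (hN.trans (min_le_right _ _))
      rw [← abs_neg]; congr 1; ring)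
    exact ⟨-κ, by rw [abs_neg, abs_of_pos hκ], b, hsum (-κ) b hb⟩

/-! ### Divergence of Birkhoff sums -/

namespace SpecialFlow

/-- Among two adjacent windows one avoids a given index. -/
theorem exists_window (b : ℤ) {w : ℤ} (hw : 0 ≤ w) (e : ℤ) :
    ∃ a : ℤ, e ≤ a ∧ a + w ≤ e + 2 * w ∧ b ∉ Finset.Ico a (a + w) := by
  by_cases hb : b ∈ Finset.Ico e (e + w)
  · rw [Finset.mem_Ico] at hb
    exact ⟨e + w, by linarith, by linarith, by simp; omega⟩
  · exact ⟨e, le_rfl, by linarith, hb⟩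

theorem IsAlmostLinear.not_forall_lt {D : ℤ → ℝ} {N : ℕ} (hN : 0 < N) {κ η : ℝ} {b : ℤ}
    (h : IsAlmostLinear D N 20 κ η b) (hκ : |κ| = 1 / 100) (hη : η = 1 / 2000) {e : ℤ}
    (he : -(20 * N : ℤ) ≤ e) (he' : e + 10 * N ≤ 20 * N) :
    ¬ ∀ n, e ≤ n → n ≤ e + 10 * N → |D n| < 1 / 50 := by
  intro hall
  obtain ⟨a, h1, h2, h3⟩ := exists_window b (w := 5 * N) (by positivity) e
  have h4 := h a (a + 5 * N) (by push_cast; linarith) (by linarith) (by push_cast; linarith) h3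
  have hN0 : (N : ℝ) ≠ 0 := by positivity
  have e1 : ((a + 5 * N : ℤ) - a : ℝ) / N = 5 := by push_cast; field_simp; ring
  rw [e1] at h4
  have h5 := abs_lt.1 (hall a h1 (by linarith))
  have h6 := abs_lt.1 (hall (a + 5 * N) (by linarith) (by linarith))
  have h7 := abs_le.1 h4
  rcases abs_eq (show (0 : ℝ) ≤ 1 / 100 by norm_num) |>.1 hκ with hk | hk <;>
    rw [hk] at h7 <;> linarith [h7.1, h7.2, h5.1, h5.2, h6.1, h6.2]

end SpecialFlow

theorem cocycleDivergence_of_arnold {α : ℝ} (hD : α ∈ diophD) (hE : α ∈ diophE)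
    {f : UnitAddCircle → ℝ} (hf : IsArnoldRoof f) :
    SpecialFlow.CocycleDivergence (circleRotation α) f volume := by
  intro ε hε
  obtain ⟨p, q, hq, h⟩ := exists_isConvergents hD.1
  obtain ⟨c, hc, s₀, hvol⟩ := exists_slowPoints_compl_le hE hq h (half_pos hε)
  refine ⟨slowPoints α q c s₀, measurableSet_slowPoints _ _ _ _, ?_, ?_⟩
  · have h1 := measureReal_add_measureReal_compl (μ := volume)
      (measurableSet_slowPoints α q c s₀)
    have h2 : volume.real (slowPoints α q c s₀)ᶜ ≤ ε / 2 := by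
      rw [measureReal_def]
      exact ENNReal.toReal_le_of_le_ofReal (by positivity) hvol
    have h3 : volume.real (univ : Set UnitAddCircle) = 1 := by
      rw [measureReal_def, UnitAddCircle.measure_univ]; simp
    linarith
  obtain ⟨δ, hδ, hlin⟩ := exists_isAlmostLinear hD hf hq h c s₀ (κ := 1 / 100) (by norm_num)
    (R := 20) (by norm_num) (η := 1 / 2000) (by norm_num) (fun N => 0 < N)
    (eventually_gt_atTop 0)
  refine ⟨δ, hδ, fun x hx y _ hxy hd => ?_⟩
  obtain ⟨N, hN, -, κ, hκ, b, hb⟩ := hlin x hx y hxy hd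
  set D := birkhoffDiff (circleRotation α) f x y with hDdef
  set J := closeTimes (circleRotation α) f x y with hJ
  have hD0 : D 0 = 0 := birkhoffDiff_zero _ _ _ _
  have hN0 : (0 : ℝ) < N := by exact_mod_cast hN
  have hNz : (0 : ℤ) < N := by exact_mod_cast hN
  -- the interval of close times is shorter than `20 N`
  have hJsub : J ⊆ (Finset.Ioo (-(10 * N : ℤ)) (10 * N) : Finset ℤ) := by
    intro n hn
    rw [Finset.coe_Ioo]
    constructor
    · by_contra hcon
      refine hb.not_forall_lt hN hκ rfl (e := -(10 * N)) (by linarith) (by linarith)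
        fun m h1 h2 => hn m ?_
      rw [uIcc_of_ge (by linarith)]
      exact ⟨by linarith, by linarith⟩
    · by_contra hcon
      refine hb.not_forall_lt hN hκ rfl (e := 0) (by linarith) (by linarith)
        fun m h1 h2 => hn m ?_
      rw [uIcc_of_le (by linarith)]
      exact ⟨by linarith, by linarith⟩
  have hJcard : J.encard ≤ 20 * N := by
    refine (encard_le_encard hJsub).trans ?_
    rw [encard_coe_eq_coe_finsetCard, Int.card_Ioo]
    have : (10 * (N : ℤ) - -(10 * N) - 1).toNat ≤ 20 * N := by omega
    exact_mod_cast this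
  have hbound : ∀ n : ℤ, |D n - κ * (n / N)| ≤ 1 / 2000 → |n| ≤ N → |D n| < 1 / 50 := by
    intro n h1 h2
    have h3 : |κ * (n / N)| ≤ 1 / 100 := by
      rw [abs_mul, hκ, abs_div, abs_of_pos hN0]
      have : |(n : ℝ)| ≤ N := by exact_mod_cast h2
      have : |(n : ℝ)| / N ≤ 1 := by rwa [div_le_one hN0]
      linarith
    have h4 := abs_sub_abs_le_abs_sub (D n) (κ * (n / N))
    linarith
  have hbound' : ∀ n : ℤ, |D n - κ * (n / N)| ≤ 1 / 2000 → N ≤ 2 * |n| → 1 / 400 < |D n| := by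
    intro n h1 h2
    have h3 : 1 / 200 ≤ |κ * (n / N)| := by
      rw [abs_mul, hκ, abs_div, abs_of_pos hN0]
      have : (N : ℝ) ≤ 2 * |(n : ℝ)| := by exact_mod_cast h2
      have : 1 / 2 ≤ |(n : ℝ)| / N := by rw [le_div_iff₀ hN0]; linarith
      linarith
    have h4 := abs_sub_abs_le_abs_sub (κ * (n / N)) (D n)
    rw [abs_sub_comm] at h4
    linarith
  have hcard : ∀ K : Set ℤ, (K = Icc (((N + 1) / 2 : ℕ) : ℤ) N ∨
      K = Icc (-(N : ℤ)) (-(((N + 1) / 2 : ℕ) : ℤ))) → J.encard ≤ 300 * K.encard := by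
    intro K hK
    have h1 : ((N + 1 - (N + 1) / 2 : ℕ) : ℕ∞) ≤ K.encard := by
      rcases hK with rfl | rfl
      · rw [← Finset.coe_Icc, encard_coe_eq_coe_finsetCard, Int.card_Icc]
        have : N + 1 - (N + 1) / 2 ≤ ((N : ℤ) + 1 - ((N + 1) / 2 : ℕ)).toNat := by omega
        exact_mod_cast this
      · rw [← Finset.coe_Icc, encard_coe_eq_coe_finsetCard, Int.card_Icc]
        have : N + 1 - (N + 1) / 2 ≤ (-(((N + 1) / 2 : ℕ) : ℤ) + 1 - -(N : ℤ)).toNat := by omega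
        exact_mod_cast this
    calc J.encard ≤ 20 * N := hJcard
      _ ≤ 300 * ((N + 1 - (N + 1) / 2 : ℕ) : ℕ∞) := by
        have : 20 * N ≤ 300 * (N + 1 - (N + 1) / 2) := by omega
        exact_mod_cast this
      _ ≤ _ := by gcongr
  rcases lt_or_ge b 0 with hb0 | hb0
  · refine ⟨Icc (((N + 1) / 2 : ℕ) : ℤ) N, ordConnected_Icc, fun n hn m hm => ?_,
      hcard _ (Or.inl rfl), fun n hn => ?_⟩
    · rw [uIcc_of_le (by have := hn.1; omega)] at hm
      exact hbound m (hb.of_lt_zero hD0 hb0 hm.1 (by push_cast; linarith [hm.2, hn.2]))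
        (by rw [abs_of_nonneg hm.1]; exact hm.2.trans hn.2)
    · have h0 : 0 ≤ n := by have := hn.1; omega
      exact hbound' n (hb.of_lt_zero hD0 hb0 h0 (by push_cast; linarith [hn.2]))
        (by rw [abs_of_nonneg h0]; have := hn.1; omega)
  · refine ⟨Icc (-(N : ℤ)) (-(((N + 1) / 2 : ℕ) : ℤ)), ordConnected_Icc, fun n hn m hm => ?_,
      hcard _ (Or.inr rfl), fun n hn => ?_⟩
    · rw [uIcc_of_ge (by have := hn.2; omega)] at hm
      exact hbound m (hb.of_nonneg hD0 hb0 hm.2 (by push_cast; linarith [hm.1, hn.1]))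
        (by rw [abs_of_nonpos hm.2]; linarith [hm.1, hn.1])
    · have h0 : n ≤ 0 := by have := hn.2; omega
      exact hbound' n (hb.of_nonneg hD0 hb0 h0 (by push_cast; linarith [hn.1]))
        (by rw [abs_of_nonpos h0]; have := hn.2; omega)

/-! ### Orbits of the special flow in fibre coordinates -/

theorem circleRotation_zpow (α : ℝ) (x : UnitAddCircle) (k : ℤ) :
    (circleRotation α ^ k) x = x + ((k * α : ℝ) : UnitAddCircle) := by
  induction x using QuotientAddGroup.induction_on with
  | H x =>
  change (circleRotation α ^ k) (x : UnitAddCircle) = x + ((k * α : ℝ) : UnitAddCircle)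
  rw [circleRotation_zpow_apply, AddCircle.coe_add]

theorem le_dist_circleRotation_zpow (α : ℝ) (x y : UnitAddCircle) (n m : ℤ) :
    distInt ((n - m : ℤ) * α) - dist x y ≤
      dist ((circleRotation α ^ n) x) ((circleRotation α ^ m) y) := by
  have h1 : (((n - m : ℤ) * α : ℝ) : UnitAddCircle) =
      ((circleRotation α ^ n) x - (circleRotation α ^ m) y) - (x - y) := by
    rw [circleRotation_zpow, circleRotation_zpow]
    rw [Int.cast_sub, sub_mul, AddCircle.coe_sub]
    abel
  have h2 := norm_sub_le ((circleRotation α ^ n) x - (circleRotation α ^ m) y) (x - y)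
  rw [distInt, h1, dist_eq_norm, dist_eq_norm]
  linarith

theorem dist_circleRotation_zpow (α : ℝ) (x y : UnitAddCircle) (n : ℤ) :
    dist ((circleRotation α ^ n) x) ((circleRotation α ^ n) y) = dist x y := by
  rw [circleRotation_zpow, circleRotation_zpow, dist_add_right]

namespace SpecialFlow

section

variable {X : Type*} {T : Equiv.Perm X} {f : X → ℝ} {c : ℝ}

theorem IsIndex.le_of_birkhoff_le (hf : ∀ x, 0 < f x) {x : X} {u : ℝ} {n j : ℤ}
    (h : IsIndex T f x u n) (hj : birkhoff T f j x ≤ u) : j ≤ n := by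
  by_contra hlt
  have := birkhoff_mono (T := T) hf x (show n + 1 ≤ j by omega)
  linarith [h.2]

theorem IsIndex.lt_of_lt_birkhoff (hf : ∀ x, 0 < f x) {x : X} {u : ℝ} {n j : ℤ}
    (h : IsIndex T f x u n) (hj : u < birkhoff T f j x) : n < j := by
  by_contra hlt
  have := birkhoff_mono (T := T) hf x (show j ≤ n by omega)
  linarith [h.1]

/-- The pair `(x, s)`, where `s` need not lie in `[0, f x)`, represents the point `p` of the special
flow: the orbit of `p` is `t ↦ (T^n x, s + t - f^(n)(x))`, where `f^(n)(x) ≤ s + t < f^(n+1)(x)`. -/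
def Represents (T : Equiv.Perm X) (f : X → ℝ) (p : Space f) (x : X) (s : ℝ) : Prop :=
  ∀ t n, IsIndex T f x (s + t) n →
    (flow T f t p).1 = ((T ^ n) x, s + t - birkhoff T f n x)

theorem represents_self (hc0 : 0 < c) (hc : ∀ x, c ≤ f x) (p : Space f) :
    Represents T f p p.1.1 p.1.2 := by
  intro t n hn
  have hex : ∃ n : ℤ, IsIndex T f p.1.1 (p.1.2 + t) n := ⟨n, hn⟩
  have h1 : hex.choose = n :=
    (existsUnique_isIndex T f hc0 hc p.1.1 (p.1.2 + t)).unique hex.choose_spec hn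
  simp only [flow, dif_pos hex, h1]

theorem birkhoff_apply (T : Equiv.Perm X) (f : X → ℝ) (x : X) (n : ℤ) :
    birkhoff T f n (T x) = birkhoff T f (n + 1) x - f x := by
  induction n with
  | zero => rw [birkhoff_add_one, birkhoff_zero, birkhoff_zero]; simp
  | succ i ih =>
    rw [birkhoff_add_one, ih, birkhoff_add_one T f (i + 1), zpow_add_one, Equiv.Perm.mul_apply]
    ring
  | pred i ih =>
    have h1 := birkhoff_add_one T f (-i - 1) (T x)
    have h2 := birkhoff_add_one T f (-i) x
    rw [sub_add_cancel, ih, h2, ← Equiv.Perm.mul_apply, ← zpow_add_one, sub_add_cancel] at h1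
    rw [sub_add_cancel]
    linarith

/-- A point may be represented in the next fibre, at a negative height. -/
theorem represents_next (hc0 : 0 < c) (hc : ∀ x, c ≤ f x) (p : Space f) :
    Represents T f p (T p.1.1) (p.1.2 - f p.1.1) := by
  intro t n hn
  have h1 : IsIndex T f p.1.1 (p.1.2 + t) (n + 1) := by
    obtain ⟨h1, h2⟩ := hn
    rw [birkhoff_apply] at h1 h2
    exact ⟨by linarith, by linarith⟩
  rw [represents_self hc0 hc p t _ h1, birkhoff_apply, zpow_add_one, Equiv.Perm.mul_apply]
  congr 1; ring

/-- The fibre counts of two orbits at the same time differ by at most a constant times the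
difference of the Birkhoff sums. -/
theorem abs_sub_le_of_isIndex (hc0 : 0 < c) (hc : ∀ x, c ≤ f x) {x y : X} {s s' t : ℝ} {n m : ℤ}
    (hn : IsIndex T f x (s + t) n) (hm : IsIndex T f y (s' + t) m) {L : ℝ}
    (h1 : |birkhoffDiff T f x y n - (s - s')| ≤ L)
    (h2 : |birkhoffDiff T f x y (n + 1) - (s - s')| ≤ L) : c * (|((n - m : ℤ) : ℝ)| - 1) ≤ L := by
  have g1 := abs_le.1 h1
  have g2 := abs_le.1 h2
  unfold birkhoffDiff at g1 g2
  have := hn.1; have := hn.2; have := hm.1; have := hm.2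
  push_cast
  rcases lt_trichotomy n m with h | h | h
  · have := birkhoff_mono_add (T := T) hc y (show n + 1 ≤ m by omega)
    have hr : (n : ℝ) + 1 ≤ m := by exact_mod_cast h
    rw [abs_of_nonpos (by linarith)]
    push_cast at this
    linarith
  · subst h
    have := (abs_nonneg _).trans h1
    simp only [sub_self, abs_zero]
    linarith
  · have := birkhoff_mono_add (T := T) hc y (show m + 1 ≤ n by omega)
    have hr : (m : ℝ) + 1 ≤ n := by exact_mod_cast h
    rw [abs_of_nonneg (by linarith)]
    push_cast at this
    linarith

end

section

variable {α : ℝ} {f : UnitAddCircle → ℝ} {c : ℝ}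

/-- If the difference of Birkhoff sums at the larger of the two fibre counts almost cancels the
initial vertical distance, then the counts differ by at most one, and the `d^f`-distance of the
orbits is determined by what is left of the vertical distance: one of the three terms in the
definition of `d^f` is equal to `dist x y + |D - (s - s')|`, and in the other two the base points
are about `‖α‖` or `‖2α‖` apart. -/
theorem pseudoDist_flow_bounds (hc0 : 0 < c) (hc : ∀ x, c ≤ f x) {p q : Space f}
    {x y : UnitAddCircle} {s s' : ℝ} (hp : Represents (circleRotation α) f p x s)
    (hq : Represents (circleRotation α) f q y s') {t : ℝ} {n m : ℤ}
    (hn : IsIndex (circleRotation α) f x (s + t) n)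
    (hm : IsIndex (circleRotation α) f y (s' + t) m)
    (hj : |birkhoffDiff (circleRotation α) f x y (max n m) - (s - s')| < c) :
    pseudoDist (circleRotation α) (flow (circleRotation α) f t p) (flow (circleRotation α) f t q) ≤
      dist x y + |birkhoffDiff (circleRotation α) f x y (max n m) - (s - s')| ∧
    min (dist x y + |birkhoffDiff (circleRotation α) f x y (max n m) - (s - s')|)
      (min (distInt α) (distInt (2 * α)) - dist x y) ≤
    pseudoDist (circleRotation α) (flow (circleRotation α) f t p)
      (flow (circleRotation α) f t q) := by
  set T := circleRotation α with hT
  have hpe := hp t n hn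
  have hqe := hq t m hm
  have n1 := hn.1; have n2 := hn.2; have m1 := hm.1; have m2 := hm.2
  have e1 := birkhoff_add_one T f n x
  have e2 := birkhoff_add_one T f m y
  have hTz : ∀ (z : UnitAddCircle) (k : ℤ), T ((T ^ k) z) = (T ^ (k + 1)) z := fun z k => by
    rw [add_comm, zpow_one_add, Equiv.Perm.mul_apply]
  have hsep : ∀ i k : ℤ, (i - k = 1 ∨ i - k = -1 ∨ i - k = 2 ∨ i - k = -2) →
      min (distInt α) (distInt (2 * α)) - dist x y ≤ dist ((T ^ i) x) ((T ^ k) y) := by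
    intro i k hik
    have h1 := le_dist_circleRotation_zpow α x y i k
    rcases hik with h | h | h | h <;> rw [h] at h1 <;> push_cast at h1
    · rw [one_mul] at h1; linarith [min_le_left (distInt α) (distInt (2 * α))]
    · rw [neg_mul, one_mul, distInt_neg] at h1
      linarith [min_le_left (distInt α) (distInt (2 * α))]
    · linarith [min_le_right (distInt α) (distInt (2 * α))]
    · rw [neg_mul, distInt_neg] at h1
      linarith [min_le_right (distInt α) (distInt (2 * α))]
  have hval : pseudoDist T (flow T f t p) (flow T f t q) =
      min (dist ((T ^ n) x) ((T ^ m) y) +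
        |s + t - birkhoff T f n x - (s' + t - birkhoff T f m y)|)
      (min (dist ((T ^ (n + 1)) x) ((T ^ m) y) +
        |f ((T ^ n) x) - (s + t - birkhoff T f n x) + (s' + t - birkhoff T f m y)|)
        (dist ((T ^ n) x) ((T ^ (m + 1)) y) +
        |f ((T ^ m) y) - (s' + t - birkhoff T f m y) + (s + t - birkhoff T f n x)|)) := by
    simp only [pseudoDist, rho, hpe, hqe, hTz]
  rw [hval]
  have hab := abs_lt.1 hj
  unfold birkhoffDiff at hab
  have hcases : n = m ∨ n = m + 1 ∨ m = n + 1 := by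
    rcases le_total m n with h | h
    · rw [max_eq_left h] at hab
      by_contra hcon
      have := birkhoff_mono_add (T := T) hc y (show m + 1 + 1 ≤ n by omega)
      have hr : ((m : ℝ) + 1 + 1) ≤ n := by exact_mod_cast (show m + 1 + 1 ≤ n by omega)
      have h3 := birkhoff_mono_add (T := T) hc y (show m + 1 ≤ m + 1 + 1 by omega)
      push_cast at this h3
      have h4 : 0 ≤ c * ((n : ℝ) - (m + 1 + 1)) := mul_nonneg hc0.le (by linarith)
      linarith
    · rw [max_eq_right h] at hab
      by_contra hcon
      have := birkhoff_mono_add (T := T) hc x (show n + 1 + 1 ≤ m by omega)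
      have hr : ((n : ℝ) + 1 + 1) ≤ m := by exact_mod_cast (show n + 1 + 1 ≤ m by omega)
      have h3 := birkhoff_mono_add (T := T) hc x (show n + 1 ≤ n + 1 + 1 by omega)
      push_cast at this h3
      have h4 : 0 ≤ c * ((m : ℝ) - (n + 1 + 1)) := mul_nonneg hc0.le (by linarith)
      linarith
  rcases hcases with h | h | h
  · subst h
    simp only [max_self]
    have hE : s + t - birkhoff T f n x - (s' + t - birkhoff T f n y) =
        -(birkhoffDiff T f x y n - (s - s')) := by unfold birkhoffDiff; ring
    rw [hE, abs_neg, dist_circleRotation_zpow]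
    refine ⟨min_le_left _ _, le_min (min_le_left _ _) (le_min ?_ ?_)⟩
    · refine (min_le_right _ _).trans ((hsep (n + 1) n (by omega)).trans ?_)
      linarith [abs_nonneg (f ((T ^ n) x) - (s + t - birkhoff T f n x) +
        (s' + t - birkhoff T f n y))]
    · refine (min_le_right _ _).trans ((hsep n (n + 1) (by omega)).trans ?_)
      linarith [abs_nonneg (f ((T ^ n) y) - (s' + t - birkhoff T f n y) +
        (s + t - birkhoff T f n x))]
  · subst h
    rw [max_eq_left (by omega)]
    have hE : f ((T ^ m) y) - (s' + t - birkhoff T f m y) + (s + t - birkhoff T f (m + 1) x) =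
        -(birkhoffDiff T f x y (m + 1) - (s - s')) := by
      unfold birkhoffDiff; rw [e2]; ring
    rw [hE, abs_neg, dist_circleRotation_zpow]
    refine ⟨(min_le_right _ _).trans (min_le_right _ _),
      le_min ?_ (le_min ?_ (min_le_left _ _))⟩
    · refine (min_le_right _ _).trans ((hsep (m + 1) m (by omega)).trans ?_)
      linarith [abs_nonneg (s + t - birkhoff T f (m + 1) x - (s' + t - birkhoff T f m y))]
    · refine (min_le_right _ _).trans ((hsep (m + 1 + 1) m (by omega)).trans ?_)
      linarith [abs_nonneg (f ((T ^ (m + 1)) x) - (s + t - birkhoff T f (m + 1) x) +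
        (s' + t - birkhoff T f m y))]
  · subst h
    rw [max_eq_right (by omega)]
    have hE : f ((T ^ n) x) - (s + t - birkhoff T f n x) + (s' + t - birkhoff T f (n + 1) y) =
        birkhoffDiff T f x y (n + 1) - (s - s') := by
      unfold birkhoffDiff; rw [e1]; ring
    rw [hE, dist_circleRotation_zpow]
    refine ⟨(min_le_right _ _).trans (min_le_left _ _),
      le_min ?_ (le_min (min_le_left _ _) ?_)⟩
    · refine (min_le_right _ _).trans ((hsep n (n + 1) (by omega)).trans ?_)
      linarith [abs_nonneg (s + t - birkhoff T f n x - (s' + t - birkhoff T f (n + 1) y))]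
    · refine (min_le_right _ _).trans ((hsep n (n + 1 + 1) (by omega)).trans ?_)
      linarith [abs_nonneg (f ((T ^ (n + 1)) y) - (s' + t - birkhoff T f (n + 1) y) +
        (s + t - birkhoff T f n x))]

/-- If `|D - (s - s')|` lies in `[l, h]` on the index interval `[j₀, j₁]`, then the `d^f`-distance
is about that large while the orbits are in the corresponding fibres. -/
theorem pseudoDist_flow_mem (hc0 : 0 < c) (hc : ∀ x, c ≤ f x) {p q : Space f}
    {x y : UnitAddCircle} {s s' : ℝ} (hp : Represents (circleRotation α) f p x s)
    (hq : Represents (circleRotation α) f q y s') {j₀ j₁ : ℤ} {l h : ℝ} (hh : h < c)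
    (hD : ∀ j, j₀ ≤ j → j ≤ j₁ → l ≤ |birkhoffDiff (circleRotation α) f x y j - (s - s')| ∧
      |birkhoffDiff (circleRotation α) f x y j - (s - s')| ≤ h) {t : ℝ}
    (h0 : birkhoff (circleRotation α) f j₀ x ≤ s + t ∨ birkhoff (circleRotation α) f j₀ y ≤ s' + t)
    (h1 : s + t < birkhoff (circleRotation α) f (j₁ + 1) x)
    (h2 : s' + t < birkhoff (circleRotation α) f (j₁ + 1) y) :
    pseudoDist (circleRotation α) (flow (circleRotation α) f t p)
      (flow (circleRotation α) f t q) ≤ dist x y + h ∧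
    min l (min (distInt α) (distInt (2 * α)) - dist x y) ≤
      pseudoDist (circleRotation α) (flow (circleRotation α) f t p)
        (flow (circleRotation α) f t q) := by
  have hpos : ∀ x, 0 < f x := fun x => hc0.trans_le (hc x)
  obtain ⟨n, hn, -⟩ := existsUnique_isIndex (circleRotation α) f hc0 hc x (s + t)
  obtain ⟨m, hm, -⟩ := existsUnique_isIndex (circleRotation α) f hc0 hc y (s' + t)
  have hj1 : max n m ≤ j₁ := max_le (by have := hn.lt_of_lt_birkhoff hpos h1; omega)
    (by have := hm.lt_of_lt_birkhoff hpos h2; omega)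
  have hj0 : j₀ ≤ max n m := by
    rcases h0 with h0 | h0
    · exact (hn.le_of_birkhoff_le hpos h0).trans (le_max_left _ _)
    · exact (hm.le_of_birkhoff_le hpos h0).trans (le_max_right _ _)
  obtain ⟨g1, g2⟩ := hD _ hj0 hj1
  obtain ⟨b1, b2⟩ := pseudoDist_flow_bounds hc0 hc hp hq hn hm (g2.trans_lt hh)
  refine ⟨by linarith, le_trans (min_le_min_right _ ?_) b2⟩
  linarith [dist_nonneg (x := x) (y := y)]

/-- A time before the fibre `j` of one orbit is a time before the fibre `j + 1` of both. -/
theorem lt_birkhoff_add_one (hc : ∀ x, c ≤ f x) (hc0 : 0 < c) {x y : UnitAddCircle} {s s' t : ℝ}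
    {j : ℤ} (ht : s + t < birkhoff (circleRotation α) f j x)
    (hD : |birkhoffDiff (circleRotation α) f x y j - (s - s')| < c) :
    s + t < birkhoff (circleRotation α) f (j + 1) x ∧
      s' + t < birkhoff (circleRotation α) f (j + 1) y := by
  have h1 := birkhoff_add_one (circleRotation α) f j x
  have h2 := birkhoff_add_one (circleRotation α) f j y
  have h3 := hc ((circleRotation α ^ j) x)
  have h4 := hc ((circleRotation α ^ j) y)
  have h5 := abs_lt.1 hD
  unfold birkhoffDiff at h5
  exact ⟨by linarith, by linarith⟩

/-- If the orbit of `p` is in the middle of a high fibre and that of `q` is `d^f`-close to it, then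
the orbit of `q` is in a fibre of comparable height; if the fibre counts agree, then the difference
of Birkhoff sums almost cancels the initial vertical distance. -/
theorem lt_apply_of_pseudoDist_lt {p q : Space f} {x y : UnitAddCircle} {s s' : ℝ}
    (hp : Represents (circleRotation α) f p x s) (hq : Represents (circleRotation α) f q y s')
    {t : ℝ} {n m : ℤ} (hm : IsIndex (circleRotation α) f y (s' + t) m)
    (hF : 1 / 50 ≤ f ((circleRotation α ^ n) x))
    (ht : s + t = birkhoff (circleRotation α) f n x + f ((circleRotation α ^ n) x) / 2)
    (hd : pseudoDist (circleRotation α) (flow (circleRotation α) f t p)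
      (flow (circleRotation α) f t q) < 1 / 100) :
    f ((circleRotation α ^ n) x) / 2 - 1 / 100 < f ((circleRotation α ^ m) y) ∧
      (n = m → |birkhoffDiff (circleRotation α) f x y n - (s - s')| < 1 / 100) := by
  set T := circleRotation α
  have hn : IsIndex T f x (s + t) n := ⟨by linarith, by rw [birkhoff_add_one]; linarith⟩
  have hpe := hp t n hn
  have hqe := hq t m hm
  have m1 := hm.1; have m2 := hm.2
  rw [birkhoff_add_one] at m2
  simp only [pseudoDist, rho, hpe, hqe, min_lt_iff] at hd
  rcases hd with hd | hd | hd
  · have h1 := abs_lt.1 (lt_of_le_of_lt (le_add_of_nonneg_left dist_nonneg) hd)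
    refine ⟨by linarith, fun e => ?_⟩
    subst e
    unfold birkhoffDiff
    rw [abs_lt]; exact ⟨by linarith, by linarith⟩
  · have h1 := abs_lt.1 (lt_of_le_of_lt (le_add_of_nonneg_left dist_nonneg) hd)
    linarith
  · have h1 := abs_lt.1 (lt_of_le_of_lt (le_add_of_nonneg_left dist_nonneg) hd)
    linarith

end

end SpecialFlow

/-! ### Growth of Birkhoff sums along slow orbits -/

/-- A Birkhoff sum over a rotation whose orbit is not too close to `0` grows linearly: the sum over
a block of length `Q`, the denominator of a convergent, is `O(Q)`. -/
theorem sum_range_le_of_slow {f : UnitAddCircle → ℝ} (hf : ∀ x, 0 < f x) {C : ℝ} (hC0 : 0 < C)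
    (hC : ∀ t : ℝ, 0 < distInt t → f t ≤ C * (1 - Real.log (distInt t))) {β : ℝ} {p : ℤ} {Q : ℕ}
    (hQ : 0 < Q) (hc : IsCoprime p (Q : ℤ)) (ha : |Q * β - p| ≤ 1 / Q) {Λ : ℝ} (hΛ : 0 ≤ Λ)
    (hΛQ : 3 * Λ ≤ Q) {x : ℝ} {n : ℕ}
    (hx : ∀ k : ℕ, k < n + Q → 0 < distInt (x + k * β) ∧ -Real.log (distInt (x + k * β)) ≤ Λ) :
    ∑ k ∈ Finset.range n, f ((x + k * β : ℝ) : UnitAddCircle) ≤ 5 * C * (n + Q) := by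
  have hQ' : (0 : ℝ) < Q := by exact_mod_cast hQ
  have hblock : ∀ i : ℕ, i * Q < n → ∑ k ∈ Finset.range Q,
      f ((x + ((i * Q + k : ℕ) : ℝ) * β : ℝ) : UnitAddCircle) ≤ 5 * C * Q := by
    intro i hi
    set z : ℝ := x + (i * Q : ℕ) * β with hz
    have ez : ∀ k : ℕ, x + ((i * Q + k : ℕ) : ℝ) * β = z + k * β := fun k => by
      rw [hz]; push_cast; ring
    have hzk : ∀ k < Q, 0 < distInt (z + k * β) ∧ -Real.log (distInt (z + k * β)) ≤ Λ := by
      intro k hk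
      rw [← ez]; exact hx _ (by omega)
    simp only [ez]
    have hfr : ∀ t : ℝ, 0 < distInt t → distInt t ≤ Int.fract t := fun t _ => by
      rw [distInt_eq_min]; exact min_le_left _ _
    have g1 := sum_range_neg_log_le hQ hc ha z hΛ fun k hk => by
      obtain ⟨h1, h2⟩ := hzk k hk
      have := Real.log_le_log h1 (hfr _ h1)
      linarith
    have g2 := sum_range_neg_log_le (α := -β) (p := -p) hQ hc.neg_left (by
        rw [← abs_neg]; refine le_trans (le_of_eq ?_) ha; congr 1; push_cast; ring)
      (-z) hΛ fun k hk => by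
        obtain ⟨h1, h2⟩ := hzk k hk
        rw [← distInt_neg] at h1 h2
        have e : -(z + k * β) = -z + k * -β := by ring
        rw [e] at h1 h2
        have := Real.log_le_log h1 (hfr _ h1)
        linarith
    calc ∑ k ∈ Finset.range Q, f ((z + k * β : ℝ) : UnitAddCircle)
        ≤ ∑ k ∈ Finset.range Q, C * (1 + (-Real.log (Int.fract (z + k * β)) +
            -Real.log (Int.fract (-z + k * -β)))) := by
          refine Finset.sum_le_sum fun k hk => ?_
          obtain ⟨h1, h2⟩ := hzk k (Finset.mem_range.1 hk)
          refine (hC _ h1).trans (mul_le_mul_of_nonneg_left ?_ hC0.le)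
          have hf0 := fract_pos_of_distInt_pos h1
          have e : -z + k * -β = -(z + k * β) := by ring
          have hneg : Int.fract (-z + k * -β) = 1 - Int.fract (z + k * β) := by
            rw [e, Int.fract_neg hf0.ne']
          have hlt := Int.fract_lt_one (z + k * β)
          rw [hneg, distInt_eq_min]
          have l1 := Real.log_nonpos hf0.le hlt.le
          have l2 := Real.log_nonpos (show 0 ≤ 1 - Int.fract (z + k * β) by linarith)
            (by linarith)
          rcases min_choice (Int.fract (z + k * β)) (1 - Int.fract (z + k * β)) with h | h <;>
            rw [h] <;> linarith
      _ = C * (Q + (∑ k ∈ Finset.range Q, -Real.log (Int.fract (z + k * β)) +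
            ∑ k ∈ Finset.range Q, -Real.log (Int.fract (-z + k * -β)))) := by
          rw [← Finset.mul_sum, Finset.sum_add_distrib, Finset.sum_add_distrib]
          simp
      _ ≤ C * (5 * Q) := mul_le_mul_of_nonneg_left (by linarith) hC0.le
      _ = 5 * C * Q := by ring
  refine (sum_range_le_of_blocks (u := fun k : ℕ => f ((x + k * β : ℝ) : UnitAddCircle))
    (fun k => (hf _).le) hQ (by positivity) hblock).trans (le_of_eq ?_)
  field_simp

/-- For `α ∈ 𝒟` the denominators of the convergents do not leave large gaps. -/
theorem exists_convergent_near {α : ℝ} (hD : α ∈ diophD) {p : ℕ → ℤ} {q : ℕ → ℕ}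
    (hq : ∀ n, cfDenom α n = q n) (h : IsConvergents α p q) :
    ∃ C : ℝ, 0 < C ∧ ∀ X : ℕ, q 3 ≤ X → ∃ u, q u ≤ X ∧ X < q (u + 1) ∧
      (q (u + 1) : ℝ) ≤ C * (q u : ℝ) ^ 4 := by
  obtain ⟨C, hC1, hC⟩ := exists_growth_of_mem_diophD hD hq h
  refine ⟨C, by linarith, fun X hX => ?_⟩
  obtain ⟨u, hu1, hu2⟩ := h.exists_lt_le (X := X)
    (by exact_mod_cast (h.mono (show 0 ≤ 3 by omega)).trans hX)
  norm_cast at hu1 hu2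
  have hu : 3 ≤ u := by
    by_contra hlt
    have := h.mono (show u + 1 ≤ 3 by omega)
    omega
  refine ⟨u, hu1, hu2, (hC u hu).trans ?_⟩
  have hqu : (0 : ℝ) < q u := by exact_mod_cast h.pos u
  have hlog : Real.log (q u) ≤ q u := (Real.log_le_self hqu.le)
  have hlog0 : 0 ≤ Real.log (q u) := Real.log_natCast_nonneg _
  have := pow_le_pow_left₀ hlog0 hlog 3
  calc C * (q u * Real.log (q u) ^ 3) ≤ C * (q u * (q u : ℝ) ^ 3) := by gcongr
    _ = C * (q u : ℝ) ^ 4 := by ring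

theorem exists_div_pow_le_distInt_mul {α : ℝ} (hD : α ∈ diophD) {p : ℕ → ℤ} {q : ℕ → ℕ}
    (hq : ∀ n, cfDenom α n = q n) (h : IsConvergents α p q) :
    ∃ c : ℝ, 0 < c ∧ ∀ k : ℤ, k ≠ 0 → c / (|k| : ℝ) ^ 4 ≤ distInt (k * α) := by
  obtain ⟨C, hC0, hC⟩ := exists_convergent_near hD hq h
  have hq3 : (1 : ℝ) ≤ q 3 := by exact_mod_cast h.pos 3
  refine ⟨1 / (2 * C * (2 * q 3) ^ 4), by positivity, fun k hk => ?_⟩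
  have hk1 : 1 ≤ k.natAbs := by omega
  obtain ⟨u, hu1, hu2, hu3⟩ := hC (2 * k.natAbs * q 3) (by nlinarith [h.pos 3])
  have hle : 2 * |k| ≤ q (u + 1) := by
    have h1 : 2 * k.natAbs ≤ 2 * k.natAbs * q 3 := Nat.le_mul_of_pos_right _ (h.pos 3)
    rw [Int.abs_eq_natAbs]
    exact_mod_cast h1.trans hu2.le
  have hk0 : (0 : ℝ) < |(k : ℝ)| := by positivity
  have hna : ((k.natAbs : ℕ) : ℝ) = |(k : ℝ)| := by rw [Nat.cast_natAbs]; push_cast; rfl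
  have hqu : (q u : ℝ) ≤ 2 * |(k : ℝ)| * q 3 := by rw [← hna]; exact_mod_cast hu1
  have hqp : (0 : ℝ) < q (u + 1) := by exact_mod_cast h.pos _
  refine le_trans ?_ (distInt_mul_ge (h.pos (u + 1)) (h.coprime _) (h.abs_le _) hk hle)
  rw [div_div]
  apply one_div_le_one_div_of_le (by positivity)
  calc 2 * (q (u + 1) : ℝ) ≤ 2 * (C * (q u : ℝ) ^ 4) := by gcongr
    _ ≤ 2 * (C * (2 * |(k : ℝ)| * q 3) ^ 4) := by gcongr
    _ = 2 * C * (2 * q 3) ^ 4 * |(k : ℝ)| ^ 4 := by ring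

/-- Between `N ^ (1/5)` and `N` there is the denominator of a convergent. -/
theorem eventually_exists_convergent {α : ℝ} (hD : α ∈ diophD) {p : ℕ → ℤ} {q : ℕ → ℕ}
    (hq : ∀ n, cfDenom α n = q n) (h : IsConvergents α p q) :
    ∀ᶠ N : ℕ in atTop, ∃ u, q u ≤ N ∧ (N : ℝ) ≤ (q u : ℝ) ^ 5 := by
  obtain ⟨C, hC0, hC⟩ := exists_convergent_near hD hq h
  filter_upwards [eventually_ge_atTop (q 3), eventually_ge_atTop (⌈C ^ 5⌉₊)] with N h3 hN
  obtain ⟨u, hu1, hu2, hu3⟩ := hC N h3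
  refine ⟨u, hu1, ?_⟩
  have hqu : (0 : ℝ) < q u := by exact_mod_cast h.pos u
  have hlt : (N : ℝ) < q (u + 1) := by exact_mod_cast hu2
  have hCN : C ^ 5 ≤ N := Nat.ceil_le.1 hN
  rcases le_total C (q u) with h1 | h1
  · calc (N : ℝ) ≤ C * (q u : ℝ) ^ 4 := hlt.le.trans hu3
      _ ≤ q u * (q u : ℝ) ^ 4 := by gcongr
      _ = (q u : ℝ) ^ 5 := by ring
  · exfalso
    have : C * (q u : ℝ) ^ 4 ≤ C * C ^ 4 := by gcongr
    have e : C * C ^ 4 = C ^ 5 := by ring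
    linarith

theorem exists_mem_Ico_distInt_le {α : ℝ} {p : ℤ} {Q : ℕ} (hQ : 0 < Q) (hc : IsCoprime p (Q : ℤ))
    (ha : |Q * α - p| ≤ 1 / Q) (x : ℝ) (e : ℤ) :
    ∃ n : ℤ, e ≤ n ∧ n < e + Q ∧ distInt (x + n * α) ≤ 2 / Q := by
  obtain ⟨k, hk, hd⟩ := exists_distInt_le hQ hc ha (x + e * α)
  refine ⟨e + k, by omega, by omega, ?_⟩
  rw [show x + ((e + k : ℤ) : ℝ) * α = x + e * α + k * α by push_cast; ring]
  exact hd

/-- The Birkhoff sums of the roof over `O(N)` iterates are `O(N)` on slow orbits; the implied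
constant does not depend on the slowness, only the size of the admissible `N` does. -/
theorem IsArnoldRoof.exists_birkhoff_le {α : ℝ} (hD : α ∈ diophD) {f : UnitAddCircle → ℝ}
    (hf : IsArnoldRoof f) {p : ℕ → ℤ} {q : ℕ → ℕ} (hq : ∀ n, cfDenom α n = q n)
    (h : IsConvergents α p q) (R : ℕ) :
    ∃ C : ℝ, 0 < C ∧ ∀ c : ℝ, 0 < c → ∀ᶠ N : ℕ in atTop, ∀ x : ℝ,
      (∀ k : ℤ, c / (|(k : ℝ)| + 1) ^ 2 ≤ distInt (x + k * α)) → ∀ n : ℤ, |n| ≤ R * N →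
        |SpecialFlow.birkhoff (circleRotation α) f n x| ≤ C * N := by
  obtain ⟨C, hC0, hC⟩ := hf.exists_le_log
  refine ⟨5 * C * (R + 1), by positivity, fun c hc => ?_⟩
  -- `Λ N` bounds `-log ‖x + k α‖` for `|k| ≤ (R + 2) N`
  set Λ : ℕ → ℝ := fun N => |Real.log c| + 2 * Real.log ((R + 3) * N) with hΛdef
  have hev : ∀ᶠ N : ℕ in atTop, 3 * Λ N ≤ (N : ℝ) ^ (1 / 5 : ℝ) := by
    have h1 : Tendsto (fun N : ℕ => (N : ℝ)) atTop atTop := tendsto_natCast_atTop_atTop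
    have h2 := (isLittleO_log_rpow_atTop (show (0 : ℝ) < 1 / 5 by norm_num)).bound
      (show (0 : ℝ) < 1 / 12 by norm_num)
    have h3 := (tendsto_rpow_atTop (show (0 : ℝ) < 1 / 5 by norm_num)).eventually_ge_atTop
      (6 * |Real.log c| + 12 * Real.log (R + 3))
    filter_upwards [h1.eventually h2, h1.eventually h3, eventually_ge_atTop 1] with N g1 g2 hN
    have hN0 : (0 : ℝ) < N := by exact_mod_cast hN
    rw [Real.norm_of_nonneg (Real.log_natCast_nonneg _),
      Real.norm_of_nonneg (by positivity)] at g1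
    have : Real.log ((R + 3) * N) = Real.log (R + 3) + Real.log N :=
      Real.log_mul (by positivity) (by positivity)
    simp only [hΛdef, this]
    linarith
  filter_upwards [hev, eventually_exists_convergent hD hq h, eventually_ge_atTop 1]
    with N hN ⟨u, hu1, hu2⟩ hN1 x hx n hn
  have hN0 : (1 : ℝ) ≤ N := by exact_mod_cast hN1
  have hQN : (q u : ℝ) ≤ N := by exact_mod_cast hu1
  have hΛ0 : 0 ≤ Λ N := by
    have : 0 ≤ Real.log ((R + 3) * N) := Real.log_nonneg (by
      have : (0 : ℝ) ≤ R := by positivity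
      nlinarith)
    simp only [hΛdef]; positivity
  have hΛQ : 3 * Λ N ≤ q u := by
    refine hN.trans ?_
    calc (N : ℝ) ^ (1 / 5 : ℝ) ≤ ((q u : ℝ) ^ 5) ^ (1 / 5 : ℝ) := by gcongr
      _ = q u := by
        rw [← Real.rpow_natCast, ← Real.rpow_mul (by positivity)]; norm_num
  have hslow : ∀ k : ℤ, |k| ≤ (R + 2) * N → 0 < distInt (x + k * α) ∧
      -Real.log (distInt (x + k * α)) ≤ Λ N := by
    intro k hk
    have hk' : |(k : ℝ)| ≤ (R + 2) * N := by exact_mod_cast hk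
    have h1 := hx k
    have h0 : 0 < c / (|(k : ℝ)| + 1) ^ 2 := by positivity
    refine ⟨h0.trans_le h1, ?_⟩
    have h2 := Real.log_le_log h0 h1
    rw [Real.log_div hc.ne' (by positivity), Real.log_pow] at h2
    have h3 : Real.log (|(k : ℝ)| + 1) ≤ Real.log ((R + 3) * N) :=
      Real.log_le_log (by positivity) (by linarith)
    have h4 := neg_abs_le (Real.log c)
    simp only [hΛdef]
    push_cast at h2
    linarith
  have hQn : ∀ n' : ℕ, n' ≤ R * N → 5 * C * ((n' : ℝ) + q u) ≤ 5 * C * (R + 1) * N := by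
    intro n' hn'
    have : (n' : ℝ) ≤ R * N := by exact_mod_cast hn'
    rw [mul_assoc (5 * C)]
    apply mul_le_mul_of_nonneg_left _ (by positivity)
    linarith
  rcases le_total 0 n with h0 | h0
  · obtain ⟨n', rfl⟩ := Int.eq_ofNat_of_zero_le h0
    have hn' : n' ≤ R * N := by rw [abs_of_nonneg h0] at hn; exact_mod_cast hn
    have e := SpecialFlow.birkhoff_sub_birkhoff (circleRotation α) f (x : UnitAddCircle) h0
    rw [SpecialFlow.birkhoff_zero, sub_zero] at e
    have e2 := sum_Ico_add_natCast
      (fun k : ℤ => f ((circleRotation α ^ k) (x : UnitAddCircle))) 0 n'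
    rw [zero_add] at e2
    have hnn : 0 ≤ SpecialFlow.birkhoff (circleRotation α) f (n' : ℤ) x := by
      rw [e]; exact Finset.sum_nonneg fun k _ => (hf.pos _).le
    rw [abs_of_nonneg hnn, e, e2]
    simp only [circleRotation_zpow_apply, zero_add, Int.cast_natCast]
    refine (sum_range_le_of_slow hf.pos hC0 hC (h.pos u) (h.coprime u) (h.abs_le u) hΛ0 hΛQ
      (fun k hk => ?_)).trans (hQn n' hn')
    refine mod_cast hslow k ?_
    rw [abs_of_nonneg (by positivity)]
    have : k ≤ (R + 2) * N := by nlinarith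
    exact_mod_cast this
  · obtain ⟨n', hn'e⟩ : ∃ n' : ℕ, n = -n' := ⟨n.natAbs, by omega⟩
    subst hn'e
    have hn' : n' ≤ R * N := by rw [abs_of_nonpos h0, neg_neg] at hn; exact_mod_cast hn
    have e := SpecialFlow.birkhoff_sub_birkhoff (circleRotation α) f (x : UnitAddCircle) h0
    rw [SpecialFlow.birkhoff_zero, zero_sub] at e
    have e2 := sum_Ico_add_natCast
      (fun k : ℤ => f ((circleRotation α ^ k) (x : UnitAddCircle))) (-n') n'
    rw [neg_add_cancel, ← Finset.sum_range_reflect] at e2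
    have hnn : 0 ≤ -SpecialFlow.birkhoff (circleRotation α) f (-n' : ℤ) x := by
      rw [e]; exact Finset.sum_nonneg fun k _ => (hf.pos _).le
    rw [← abs_neg, abs_of_nonneg hnn, e, e2]
    have e3 : ∀ k ∈ Finset.range n', f ((circleRotation α ^ (-n' + (n' - 1 - k : ℕ) : ℤ))
        (x : UnitAddCircle)) = f ((x - α + k * -α : ℝ) : UnitAddCircle) := by
      intro k hk
      rw [Finset.mem_range] at hk
      rw [circleRotation_zpow_apply]
      have : (-n' + (n' - 1 - k : ℕ) : ℤ) = -1 - k := by omega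
      rw [this]; congr 2; push_cast; ring
    rw [Finset.sum_congr rfl e3]
    refine (sum_range_le_of_slow hf.pos hC0 hC (p := -p u) (h.pos u) (h.coprime u).neg_left
      (by
        rw [← abs_neg]; refine le_trans (le_of_eq ?_) (h.abs_le u); congr 1; push_cast; ring)
      hΛ0 hΛQ (fun k hk => ?_)).trans (hQn n' hn')
    have e4 : x - α + k * -α = x + ((-1 - k : ℤ) : ℝ) * α := by push_cast; ring
    rw [e4]
    refine hslow _ ?_
    have : k + 1 ≤ (R + 2) * N := by nlinarith
    have h5 : |(-1 - k : ℤ)| = (k + 1 : ℕ) := by rw [abs_of_nonpos (by omega)]; push_cast; ring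
    rw [h5]; exact_mod_cast this

/-! ### Separation of close orbits of the flow -/

theorem tendsto_add_mul_log_pow_mul_rpow (A B : ℝ) {γ : ℝ} (hγ : 0 < γ) :
    Tendsto (fun N : ℕ => (A + B * Real.log N) ^ 4 * (N : ℝ) ^ (-γ)) atTop (𝓝 0) := by
  have h1 : (fun t : ℝ => A + B * Real.log t) =o[atTop] fun t => t ^ (γ / 4) := by
    refine Asymptotics.IsLittleO.add ?_ ?_
    · refine Asymptotics.isLittleO_const_left.2 (Or.inr ?_)
      exact tendsto_norm_atTop_atTop.comp (tendsto_rpow_atTop (by positivity))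
    · exact (isLittleO_log_rpow_atTop (by positivity)).const_mul_left B
  have h2 := (h1.pow (show 0 < 4 by norm_num)).tendsto_div_nhds_zero
  refine (h2.comp tendsto_natCast_atTop_atTop).congr fun N => ?_
  have hN : (0 : ℝ) ≤ N := by positivity
  simp only [Function.comp]
  rw [← Real.rpow_natCast ((N : ℝ) ^ (γ / 4)), ← Real.rpow_mul hN, Real.rpow_neg hN,
    div_eq_mul_inv]
  congr 3; push_cast; ring

theorem IsArnoldRoof.exists_le_log_norm {f : UnitAddCircle → ℝ} (hf : IsArnoldRoof f) :
    ∃ C : ℝ, 0 < C ∧ ∀ z : UnitAddCircle, 0 < ‖z‖ → f z ≤ C * (1 - Real.log ‖z‖) := by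
  obtain ⟨C, hC0, hC⟩ := hf.exists_le_log
  refine ⟨C, hC0, fun z hz => ?_⟩
  induction z using QuotientAddGroup.induction_on with
  | H t => exact hC t hz

theorem IsArnoldRoof.exists_log_norm_le {f : UnitAddCircle → ℝ} (hf : IsArnoldRoof f) :
    ∃ a r : ℝ, 0 < a ∧ 0 < r ∧ ∀ z : UnitAddCircle, 0 < ‖z‖ → ‖z‖ < r →
      a * -Real.log ‖z‖ ≤ f z := by
  obtain ⟨a, b, r, ha, hb, hr, hr3, h⟩ := hf.exists_log_bounds
  refine ⟨a, r, ha, hr, fun z hz hzr => ?_⟩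
  induction z using QuotientAddGroup.induction_on with
  | H t => exact (h t hz hzr).1

theorem slowPoints_le_norm {α : ℝ} {q : ℕ → ℕ} {c : ℝ} {s₀ : ℕ} {x : UnitAddCircle}
    (hx : x ∈ slowPoints α q c s₀) (k : ℤ) :
    c / (|(k : ℝ)| + 1) ^ 2 ≤ ‖(circleRotation α ^ k) x‖ := by
  induction x using QuotientAddGroup.induction_on with
  | H t =>
    have h := (mem_slowPoints_iff.1 hx).1 k
    rwa [distInt, ← circleRotation_zpow_apply] at h

namespace SpecialFlow

theorem IsAlmostLinear.abs_le {D : ℤ → ℝ} {N R : ℕ} (hN : 0 < N) {κ η : ℝ} {b : ℤ}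
    (h : IsAlmostLinear D N R κ η b) (h0 : D 0 = 0) {M : ℝ} (hM0 : 0 ≤ M)
    (hM : |b| ≤ R * N → |D (b + 1) - D b| ≤ M) {n : ℤ} (hn : |n| ≤ R * N) :
    |D n| ≤ 2 * (|κ| * R + η) + M := by
  have hN0 : (0 : ℝ) < N := by exact_mod_cast hN
  have hR0 : (0 : ℤ) ≤ R * N := by positivity
  have key : ∀ a a' : ℤ, -(R * N : ℤ) ≤ a → a ≤ a' → a' ≤ R * N → a' - a ≤ R * N →
      b ∉ Finset.Ico a a' → |D a' - D a| ≤ |κ| * R + η := by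
    intro a a' h1 h2 h3 h4 h5
    have g := h a a' h1 h2 h3 h5
    have g1 := abs_sub_abs_le_abs_sub (D a' - D a) (κ * ((a' - a) / N))
    have g2 : |κ * (((a' : ℝ) - a) / N)| ≤ |κ| * R := by
      rw [abs_mul]
      apply mul_le_mul_of_nonneg_left _ (abs_nonneg _)
      have i1 : (0 : ℝ) ≤ a' - a := by exact_mod_cast (sub_nonneg.2 h2)
      have i2 : (a' : ℝ) - a ≤ R * N := by exact_mod_cast h4
      rw [abs_of_nonneg (by positivity), div_le_iff₀ hN0]; exact i2
    linarith
  have hK : 0 ≤ |κ| * R + η := (abs_nonneg _).trans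
    (key 0 0 (by linarith) le_rfl hR0 (by simpa using hR0) (by simp))
  have hn' := _root_.abs_le.1 hn
  rcases le_total 0 n with hn0 | hn0
  · by_cases hb : b ∈ Finset.Ico 0 n
    · rw [Finset.mem_Ico] at hb
      have g1 := key 0 b (by linarith) hb.1 (by linarith) (by linarith) (by simp)
      have g2 := key (b + 1) n (by linarith) (by linarith) (by linarith) (by linarith) (by simp)
      have g3 := hM (by rw [abs_of_nonneg hb.1]; linarith)
      rw [h0] at g1
      rw [_root_.abs_le] at g1 g2 g3 ⊢
      constructor <;> linarith
    · have g1 := key 0 n (by linarith) hn0 (by linarith) (by linarith) hb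
      rw [h0, sub_zero] at g1
      linarith
  · by_cases hb : b ∈ Finset.Ico n 0
    · rw [Finset.mem_Ico] at hb
      have g1 := key n b (by linarith) hb.1 (by linarith) (by linarith) (by simp)
      have g2 := key (b + 1) 0 (by linarith) (by linarith) (by linarith) (by linarith) (by simp)
      have g3 := hM (by rw [abs_of_nonpos hb.2.le]; linarith)
      rw [h0] at g2
      rw [_root_.abs_le] at g1 g2 g3 ⊢
      constructor <;> linarith
    · have g1 := key n 0 (by linarith) hn0 (by linarith) (by linarith) hb
      rw [h0, zero_sub, abs_neg] at g1
      linarith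

end SpecialFlow

open SpecialFlow

/-- When `p` is in the middle of a fibre over a point very close to the singularity, then `q` can
only be `d^f`-close to `p` if it has crossed the same number of fibres: a fibre of comparable height
is met by the orbit of `q` only if its base point is close to the singularity as well, while
`O(log N)` steps of the rotation do not bring a point back so close to itself. -/
theorem IsArnoldRoof.eventually_abs_birkhoffDiff_sub_lt {α : ℝ} (hD : α ∈ diophD)
    {f : UnitAddCircle → ℝ} (hf : IsArnoldRoof f) {p : ℕ → ℤ} {q : ℕ → ℕ}
    (hq : ∀ n, cfDenom α n = q n) (h : IsConvergents α p q) {c' : ℝ} (hc' : 0 < c') (s₀ : ℕ)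
    {R : ℕ} {κ η : ℝ} :
    ∀ᶠ N : ℕ in atTop, ∀ (P Q : Space f) (x y : UnitAddCircle) (s s' : ℝ),
      x ∈ slowPoints α q c' s₀ → y ∈ slowPoints α q c' s₀ → dist x y * N ≤ 1 →
      Represents (circleRotation α) f P x s → Represents (circleRotation α) f Q y s' →
      |s - s'| ≤ 1 → ∀ κ' : ℝ, |κ'| = κ → ∀ b : ℤ,
      IsAlmostLinear (birkhoffDiff (circleRotation α) f x y) N R κ' η b →
      ∀ n : ℤ, -(R * N : ℤ) ≤ n → n + 1 ≤ R * N →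
      ‖(circleRotation α ^ n) x‖ ≤ 2 * (N : ℝ) ^ (-(1 / 5) : ℝ) → ∀ t : ℝ,
      s + t = birkhoff (circleRotation α) f n x + f ((circleRotation α ^ n) x) / 2 →
      pseudoDist (circleRotation α) (flow (circleRotation α) f t P)
        (flow (circleRotation α) f t Q) < 1 / 100 →
      |birkhoffDiff (circleRotation α) f x y n - (s - s')| < 1 / 100 := by
  obtain ⟨c, hc0, hc⟩ := hf.exists_pos_le
  obtain ⟨C, hC0, hC⟩ := hf.exists_le_log_norm
  obtain ⟨a, r, ha, hr, har⟩ := hf.exists_log_norm_le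
  obtain ⟨c₃, hc₃, hlow⟩ := exists_div_pow_le_distInt_mul hD hq h
  set γ := a / (20 * C) with hγdef
  have hγ : 0 < γ := by positivity
  -- `|n - m| ≤ A + B log N` for the fibre counts `n`, `m` at the same time
  set M : ℕ → ℝ := fun N => C * (1 + |Real.log c'| + 2 * Real.log (R + 1) + 2 * Real.log N)
    with hMdef
  set L : ℕ → ℝ := fun N => 2 * (κ * R + η) + M N + 1 with hLdef
  obtain ⟨A, B, hAB⟩ : ∃ A B : ℝ, ∀ N : ℕ, 1 + L N / c = A + B * Real.log N :=
    ⟨1 + (2 * (κ * R + η) + C * (1 + |Real.log c'| + 2 * Real.log (R + 1)) + 1) / c, 2 * C / c,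
      fun N => by simp only [hLdef, hMdef]; ring⟩
  have t1 := tendsto_add_mul_log_pow_mul_rpow A B (show (0 : ℝ) < 1 by norm_num)
  have t2 := (tendsto_add_mul_log_pow_mul_rpow A B (show (0 : ℝ) < 1 / 5 by norm_num)).const_mul 2
  have t3 := (tendsto_add_mul_log_pow_mul_rpow A B hγ).const_mul (Real.exp 1)
  have t4 := (t1.add t2).add t3
  simp only [mul_zero, add_zero] at t4
  have t4' : ∀ᶠ N : ℕ in atTop, ∀ k : ℝ, 0 < k → k ≤ A + B * Real.log N →
      (N : ℝ) ^ (-1 : ℝ) + 2 * (N : ℝ) ^ (-(1 / 5) : ℝ) + Real.exp 1 * (N : ℝ) ^ (-γ) <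
        c₃ / k ^ 4 := by
    filter_upwards [t4.eventually (gt_mem_nhds hc₃)] with N hN k hk hk'
    rw [lt_div_iff₀ (by positivity), mul_comm]
    refine lt_of_le_of_lt ?_ hN
    calc _ ≤ (A + B * Real.log N) ^ 4 * ((N : ℝ) ^ (-1 : ℝ) + 2 * (N : ℝ) ^ (-(1 / 5) : ℝ) +
          Real.exp 1 * (N : ℝ) ^ (-γ)) := by gcongr
      _ = _ := by ring
  have t5 : Tendsto (fun N : ℕ => 2 * (N : ℝ) ^ (-(1 / 5) : ℝ)) atTop (𝓝 0) := by
    have := ((tendsto_rpow_neg_atTop (show (0 : ℝ) < 1 / 5 by norm_num)).comp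
      tendsto_natCast_atTop_atTop).const_mul 2
    simpa using this
  have t6 : Tendsto (fun N : ℕ => Real.log N) atTop atTop :=
    Real.tendsto_log_atTop.comp tendsto_natCast_atTop_atTop
  filter_upwards [t4', t5.eventually (gt_mem_nhds hr),
    t6.eventually_ge_atTop ((a / 2 * Real.log 2 + 1 / 100) / (a / 20)), eventually_ge_atTop 1]
    with N g4 g5 g6 hN1 P Q x y s s' hx hy hxy hP hQ hs κ' hκ b hlin n hn hn' hnx t ht hd
  set T := circleRotation α with hT
  set D := birkhoffDiff T f x y with hDdef
  have hN1' : (1 : ℝ) ≤ N := by exact_mod_cast hN1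
  have hN0 : (0 : ℝ) < N := by linarith
  have hlogN : 0 ≤ Real.log N := Real.log_natCast_nonneg _
  have hposx : ∀ k : ℤ, 0 < ‖(T ^ k) x‖ := fun k =>
    lt_of_lt_of_le (by positivity) (slowPoints_le_norm hx k)
  have hposy : ∀ k : ℤ, 0 < ‖(T ^ k) y‖ := fun k =>
    lt_of_lt_of_le (by positivity) (slowPoints_le_norm hy k)
  obtain ⟨m, hm, -⟩ := existsUnique_isIndex T f hc0 hc y (s' + t)
  -- the height of the fibre
  have hF : (a / 20) * Real.log N ≤ f ((T ^ n) x) / 2 - 1 / 100 := by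
    have h1 := har _ (hposx n) (lt_of_le_of_lt hnx g5)
    have h2 := Real.log_le_log (hposx n) hnx
    rw [Real.log_mul (by norm_num) (by positivity), Real.log_rpow hN0] at h2
    rw [div_le_iff₀ (by positivity)] at g6
    have h3 : a * ((1 / 5) * Real.log N - Real.log 2) ≤ a * -Real.log ‖(T ^ n) x‖ :=
      mul_le_mul_of_nonneg_left (by linarith) ha.le
    linarith
  have hF0 : 1 / 50 ≤ f ((T ^ n) x) := by
    have : 0 ≤ (a / 20) * Real.log N := by positivity
    linarith
  obtain ⟨hFm, hres⟩ := lt_apply_of_pseudoDist_lt hP hQ hm hF0 ht hd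
  refine hres ?_
  by_contra hne
  -- the base point of the fibre of the second orbit is close to the singularity
  have hnear : ‖(T ^ m) y‖ ≤ Real.exp 1 * (N : ℝ) ^ (-γ) := by
    have h1 := hC _ (hposy m)
    have h2 : γ * Real.log N * C = a / 20 * Real.log N := by rw [hγdef]; field_simp
    have h3 : γ * Real.log N < 1 - Real.log ‖(T ^ m) y‖ := by
      refine lt_of_mul_lt_mul_left (a := C) ?_ hC0.le
      linarith
    rw [← Real.log_le_log_iff (hposy m) (by positivity), Real.log_mul (by positivity)
      (by positivity), Real.log_exp, Real.log_rpow hN0]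
    linarith
  -- the numbers of crossed fibres are logarithmically close
  have hM0 : 0 ≤ M N := by
    have : 0 ≤ Real.log (R + 1) := Real.log_nonneg (by
      have : (0 : ℝ) ≤ R := by positivity
      linarith)
    simp only [hMdef]; positivity
  have hfM : ∀ z ∈ slowPoints α q c' s₀, ∀ k : ℤ, |k| ≤ R * N → f ((T ^ k) z) ≤ M N := by
    intro z hz k hk
    have h1 := slowPoints_le_norm hz k
    have h0 : 0 < c' / (|(k : ℝ)| + 1) ^ 2 := by positivity
    have h2 := Real.log_le_log h0 h1
    rw [Real.log_div hc'.ne' (by positivity), Real.log_pow] at h2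
    have hk' : |(k : ℝ)| ≤ R * N := by exact_mod_cast hk
    have h3 : Real.log (|(k : ℝ)| + 1) ≤ Real.log ((R + 1) * N) :=
      Real.log_le_log (by positivity) (by linarith)
    rw [Real.log_mul (by positivity) (by positivity)] at h3
    have h4 := neg_abs_le (Real.log c')
    push_cast at h2
    refine (hC _ (h0.trans_le h1)).trans ?_
    simp only [hMdef]
    exact mul_le_mul_of_nonneg_left (by linarith) hC0.le
  have hDle : ∀ k : ℤ, |k| ≤ R * N → |D k| ≤ 2 * (κ * R + η) + M N := by
    intro k hk
    rw [← hκ]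
    refine hlin.abs_le hN1 (birkhoffDiff_zero _ _ _ _) hM0 (fun hb => ?_) hk
    have h1 := birkhoff_add_one T f b x
    have h2 := birkhoff_add_one T f b y
    have h3 : D (b + 1) - D b = f ((T ^ b) x) - f ((T ^ b) y) := by
      simp only [hDdef, birkhoffDiff]; linarith
    rw [h3, abs_le]
    have i1 := hfM x hx b hb
    have i2 := hfM y hy b hb
    have i3 := hf.pos ((T ^ b) x)
    have i4 := hf.pos ((T ^ b) y)
    constructor <;> linarith
  have hDL : ∀ k : ℤ, |k| ≤ R * N → |D k - (s - s')| ≤ L N := by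
    intro k hk
    have := abs_sub (D k) (s - s')
    have := hDle k hk
    simp only [hLdef]
    linarith
  have hnidx : IsIndex T f x (s + t) n := by
    constructor
    · rw [ht]; linarith
    · rw [ht, birkhoff_add_one]; linarith
  have hcount := abs_sub_le_of_isIndex hc0 hc hnidx hm (hDL n (abs_le.2 ⟨hn, by linarith⟩))
    (hDL (n + 1) (abs_le.2 ⟨by linarith, hn'⟩))
  have hk0 : n - m ≠ 0 := sub_ne_zero.2 hne
  have hcount' : |((n - m : ℤ) : ℝ)| ≤ A + B * Real.log N := by
    rw [← hAB]
    have : |((n - m : ℤ) : ℝ)| - 1 ≤ L N / c := by rw [le_div_iff₀ hc0]; linarith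
    linarith
  -- a return so close to itself takes the rotation longer
  have h1 := hlow _ hk0
  have h2 := le_dist_circleRotation_zpow α x y n m
  have h3 : dist ((T ^ n) x) ((T ^ m) y) ≤ ‖(T ^ n) x‖ + ‖(T ^ m) y‖ := by
    rw [dist_eq_norm]; exact norm_sub_le _ _
  have hxyN : dist x y ≤ (N : ℝ) ^ (-1 : ℝ) := by
    rw [Real.rpow_neg_one, ← one_div, le_div_iff₀ hN0]; exact hxy
  have hkpos : 0 < |((n - m : ℤ) : ℝ)| := abs_pos.2 (by exact_mod_cast hk0)
  have h4 := g4 _ hkpos hcount'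
  linarith

/-- The orbits do not stay `d^f`-close over a time in which `6 m N` fibres are crossed, if `m` is
so large that the difference of Birkhoff sums varies by more than `1 / 50` over `m N` steps. -/
theorem IsArnoldRoof.eventually_exists_le_pseudoDist {α : ℝ} (hD : α ∈ diophD)
    {f : UnitAddCircle → ℝ} (hf : IsArnoldRoof f) {p : ℕ → ℤ} {q : ℕ → ℕ}
    (hq : ∀ n, cfDenom α n = q n) (h : IsConvergents α p q) {c' : ℝ} (hc' : 0 < c') (s₀ : ℕ)
    {R m : ℕ} (hm : 1 ≤ m) {κ η : ℝ} (hκm : 1 / 50 + η ≤ κ * m) :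
    ∀ᶠ N : ℕ in atTop, ∀ (P Q : Space f) (x y : UnitAddCircle) (s s' : ℝ),
      x ∈ slowPoints α q c' s₀ → y ∈ slowPoints α q c' s₀ → dist x y * N ≤ 1 →
      Represents (circleRotation α) f P x s → Represents (circleRotation α) f Q y s' →
      |s - s'| ≤ 1 → ∀ κ' : ℝ, |κ'| = κ → ∀ b : ℤ,
      IsAlmostLinear (birkhoffDiff (circleRotation α) f x y) N R κ' η b →
      ∀ e : ℤ, -(R * N : ℤ) ≤ e → e + 6 * m * N ≤ R * N → ∃ n, e ≤ n ∧ n + 1 ≤ e + 6 * m * N ∧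
        1 / 100 ≤ pseudoDist (circleRotation α)
          (flow (circleRotation α) f (birkhoff (circleRotation α) f n x +
            f ((circleRotation α ^ n) x) / 2 - s) P)
          (flow (circleRotation α) f (birkhoff (circleRotation α) f n x +
            f ((circleRotation α ^ n) x) / 2 - s) Q) := by
  filter_upwards [hf.eventually_abs_birkhoffDiff_sub_lt hD hq h hc' s₀ (R := R) (κ := κ) (η := η),
    eventually_exists_convergent hD hq h, eventually_ge_atTop 1]
    with N hN ⟨u, hu1, hu2⟩ hN1 P Q x y s s' hx hy hxy hP hQ hs κ' hκ b hlin e he he'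
  by_contra hcon
  push Not at hcon
  have hN0 : (0 : ℝ) < N := by exact_mod_cast hN1
  have hQ0 : (0 : ℝ) < q u := by exact_mod_cast h.pos u
  have hmN : (q u : ℤ) ≤ m * N := by
    have : N ≤ m * N := Nat.le_mul_of_pos_left _ hm
    exact_mod_cast hu1.trans this
  have hmN0 : (0 : ℤ) ≤ m * N := by positivity
  have hdeep : (2 : ℝ) / q u ≤ 2 * (N : ℝ) ^ (-(1 / 5) : ℝ) := by
    have : (N : ℝ) ^ (1 / 5 : ℝ) ≤ q u := by
      calc (N : ℝ) ^ (1 / 5 : ℝ) ≤ ((q u : ℝ) ^ 5) ^ (1 / 5 : ℝ) := by gcongr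
        _ = q u := by
          rw [← Real.rpow_natCast, ← Real.rpow_mul (by positivity)]; norm_num
    rw [Real.rpow_neg hN0.le, div_eq_mul_inv]
    gcongr
  have hvisit : ∀ i : ℤ, ∃ n, i ≤ n ∧ n < i + q u ∧
      ‖(circleRotation α ^ n) x‖ ≤ 2 * (N : ℝ) ^ (-(1 / 5) : ℝ) := by
    intro i
    induction x using QuotientAddGroup.induction_on with
    | H t =>
      obtain ⟨n, h1, h2, h3⟩ := exists_mem_Ico_distInt_le (h.pos u) (h.coprime u) (h.abs_le u) t i
      refine ⟨n, h1, h2, le_trans (le_of_eq ?_) (h3.trans hdeep)⟩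
      rw [distInt, ← circleRotation_zpow_apply]
  -- two visits to the singularity, at least `m N` steps apart, in a window that avoids `b`
  obtain ⟨i, hi1, hi2, hib⟩ := exists_window b (w := 3 * (m * N)) (by positivity) e
  obtain ⟨n₁, a1, a2, a3⟩ := hvisit i
  obtain ⟨n₂, b1, b2, b3⟩ := hvisit (i + 2 * (m * N))
  have hval : ∀ n, e ≤ n → n + 1 ≤ e + 6 * m * N →
      ‖(circleRotation α ^ n) x‖ ≤ 2 * (N : ℝ) ^ (-(1 / 5) : ℝ) →
      |birkhoffDiff (circleRotation α) f x y n - (s - s')| < 1 / 100 := fun n h1 h2 h3 =>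
    hN P Q x y s s' hx hy hxy hP hQ hs κ' hκ b hlin n (by linarith) (by linarith) h3 _
      (by ring) (hcon n h1 h2)
  have v1 := abs_lt.1 (hval n₁ (by linarith) (by linarith) a3)
  have v2 := abs_lt.1 (hval n₂ (by linarith) (by linarith) b3)
  have hlt := hlin n₁ n₂ (by linarith) (by linarith) (by linarith) (by
    rw [Finset.mem_Ico] at hib ⊢
    intro hb
    exact hib ⟨by linarith [hb.1], by linarith [hb.2]⟩)
  have hgap : (m : ℝ) ≤ ((n₂ : ℝ) - n₁) / N := by
    rw [le_div_iff₀ hN0]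
    have : (m * N : ℤ) ≤ n₂ - n₁ := by linarith
    exact_mod_cast this
  have hk0 : 0 ≤ κ := hκ ▸ abs_nonneg _
  have hbig : κ * m ≤ |κ' * (((n₂ : ℝ) - n₁) / N)| := by
    rw [abs_mul, hκ, abs_of_nonneg ((Nat.cast_nonneg _).trans hgap)]
    gcongr
  have := abs_sub_abs_le_abs_sub (κ' * (((n₂ : ℝ) - n₁) / N))
    (birkhoffDiff (circleRotation α) f x y n₂ - birkhoffDiff (circleRotation α) f x y n₁)
  rw [abs_sub_comm (κ' * (((n₂ : ℝ) - n₁) / N))] at this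
  have hsmall : |birkhoffDiff (circleRotation α) f x y n₂ -
      birkhoffDiff (circleRotation α) f x y n₁| < 1 / 50 := by
    rw [abs_lt]; constructor <;> linarith
  linarith

namespace SpecialFlow

/-- On one side of time `0`, the one that does not contain the exceptional index, the two orbits
drift apart at a linear rate: they stay close while about `N` fibres are crossed, and are at a
distance greater than `c₀` during the second half of this time. -/
theorem exists_far_interval {α : ℝ} {f : UnitAddCircle → ℝ} {c c₀ : ℝ} (hc : ∀ x, c ≤ f x)
    (h₀ : 0 < c₀) (h₁ : c₀ ≤ 1 / 2000) (h₂ : 40 * c₀ ≤ c)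
    (h₃ : 8 * c₀ ≤ min (distInt α) (distInt (2 * α))) {P Q : Space f} {x y : UnitAddCircle}
    {s s' : ℝ} (hP : Represents (circleRotation α) f P x s)
    (hQ : Represents (circleRotation α) f Q y s') (hs : s < f x) (hs' : s' < f y)
    (hmax : 0 ≤ max s s') (hss : |s - s'| < c₀ / 4) (hxy : dist x y < c₀ / 4) {N R : ℕ}
    (hN : 3 ≤ N) (hR : 1 ≤ R) {κ : ℝ} (hκ : |κ| = 4 * c₀) {b : ℤ}
    (hb : IsAlmostLinear (birkhoffDiff (circleRotation α) f x y) N R κ (c₀ / 4) b) :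
    ∃ t₀ t₁ : ℝ, t₀ + c * N / 3 ≤ t₁ ∧ ∀ t ∈ Ico t₀ t₁,
      t ∈ closeInterval (flow (circleRotation α) f) (pseudoDist (circleRotation α)) P Q ∧
      c₀ < pseudoDist (circleRotation α) (flow (circleRotation α) f t P)
        (flow (circleRotation α) f t Q) := by
  set T := circleRotation α with hT
  set D := birkhoffDiff T f x y with hDdef
  have hc0 : 0 < c := by linarith
  have hf : ∀ x, 0 < f x := fun x => hc0.trans_le (hc x)
  have hD0 : D 0 = 0 := birkhoffDiff_zero _ _ _ _
  have hN3 : (3 : ℝ) ≤ N := by exact_mod_cast hN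
  have hN0 : (0 : ℝ) < N := by linarith
  have hNR : (N : ℤ) ≤ R * N := by
    have : N ≤ R * N := Nat.le_mul_of_pos_left _ hR
    exact_mod_cast this
  have hss' := abs_lt.1 hss
  -- the middle index
  obtain ⟨M, hM1, hM2⟩ : ∃ M : ℤ, (N : ℤ) ≤ 2 * M ∧ 2 * M ≤ N + 1 :=
    ⟨((N + 1) / 2 : ℤ), by omega, by omega⟩
  have hM3 : c * N / 3 ≤ c * ((N : ℝ) - M) := by
    have : (2 : ℝ) * M ≤ N + 1 := by exact_mod_cast hM2
    have : (N : ℝ) / 3 ≤ N - M := by linarith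
    have := mul_le_mul_of_nonneg_left this hc0.le
    linarith
  have hupper : ∀ j : ℤ, |j| ≤ N → |D j - κ * (j / N)| ≤ c₀ / 4 → |D j - (s - s')| ≤ 5 * c₀ := by
    intro j hj h
    have g1 : |κ * (j / N)| ≤ 4 * c₀ := by
      rw [abs_mul, hκ, abs_div, abs_of_pos hN0]
      have : |(j : ℝ)| ≤ N := by exact_mod_cast hj
      have : |(j : ℝ)| / N ≤ 1 := by rwa [div_le_one hN0]
      have := mul_le_mul_of_nonneg_left this (show 0 ≤ 4 * c₀ by linarith)
      linarith
    rw [abs_le] at *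
    constructor <;> linarith
  have hlower : ∀ j : ℤ, N ≤ 2 * |j| → |D j - κ * (j / N)| ≤ c₀ / 4 →
      3 / 2 * c₀ ≤ |D j - (s - s')| := by
    intro j hj h
    have g1 : 2 * c₀ ≤ |κ * (j / N)| := by
      rw [abs_mul, hκ, abs_div, abs_of_pos hN0]
      have : (N : ℝ) ≤ 2 * |(j : ℝ)| := by exact_mod_cast hj
      have : 1 / 2 ≤ |(j : ℝ)| / N := by rw [le_div_iff₀ hN0]; linarith
      have := mul_le_mul_of_nonneg_left this (show 0 ≤ 4 * c₀ by linarith)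
      linarith
    have g2 := abs_sub_abs_le_abs_sub (κ * (j / N)) (D j)
    rw [abs_sub_comm (κ * (j / N))] at g2
    have g3 := abs_sub_abs_le_abs_sub (D j) (s - s')
    linarith
  have hmin : c₀ < min (3 / 2 * c₀) (min (distInt α) (distInt (2 * α)) - dist x y) :=
    lt_min (by linarith) (by linarith)
  -- heights in the next fibre are negative, but only slightly so
  have hs1 : -(c₀ / 4) ≤ s := by
    rcases le_max_iff.1 hmax with h | h <;> linarith
  have hb1 : birkhoff T f 1 x = f x := by
    have := birkhoff_add_one T f 0 x
    simpa [birkhoff_zero] using this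
  have hb1' : birkhoff T f 1 y = f y := by
    have := birkhoff_add_one T f 0 y
    simpa [birkhoff_zero] using this
  rcases lt_or_ge b 0 with hb0 | hb0
  · have hlin : ∀ j : ℤ, 0 ≤ j → j ≤ N → |D j - κ * (j / N)| ≤ c₀ / 4 := fun j h1 h2 =>
      hb.of_lt_zero hD0 hb0 h1 (h2.trans hNR)
    have hup : ∀ j : ℤ, 0 ≤ j → j ≤ N → |D j - (s - s')| ≤ 5 * c₀ := fun j h1 h2 =>
      hupper j (by rwa [abs_of_nonneg h1]) (hlin j h1 h2)
    have hend : ∀ t, s + t < birkhoff T f N x →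
        s + t < birkhoff T f (N + 1) x ∧ s' + t < birkhoff T f (N + 1) y := fun t ht =>
      lt_birkhoff_add_one hc hc0 ht ((hup N (by positivity) le_rfl).trans_lt (by linarith))
    have hmono := birkhoff_mono_add (T := T) hc x (show M ≤ N by omega)
    have hMone := birkhoff_mono (T := T) hf x (show 1 ≤ M by omega)
    push_cast at hmono
    refine ⟨birkhoff T f M x - s, birkhoff T f N x - s, by linarith, fun t ht => ⟨?_, ?_⟩⟩
    · intro u hu
      rw [uIcc_of_le (by linarith [ht.1])] at hu
      obtain ⟨e1, e2⟩ := hend u (by linarith [hu.2, ht.2])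
      have := (pseudoDist_flow_mem hc0 hc hP hQ (j₀ := 0) (j₁ := N) (l := 0) (h := 5 * c₀)
        (t := u)
        (by linarith) (fun j h1 h2 => ⟨abs_nonneg _, hup j h1 h2⟩) (by
          rw [birkhoff_zero, birkhoff_zero]
          rcases le_max_iff.1 hmax with h | h
          · left; linarith [hu.1]
          · right; linarith [hu.1]) e1 e2).1
      refine lt_of_le_of_lt this (by linarith)
    · obtain ⟨e1, e2⟩ := hend t (by linarith [ht.2])
      exact hmin.trans_le (pseudoDist_flow_mem hc0 hc hP hQ (j₀ := M) (j₁ := N)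
        (h := 5 * c₀) (by linarith) (fun j h1 h2 =>
          ⟨hlower j (by rw [abs_of_nonneg (by omega)]; omega) (hlin j (by omega) h2),
            hup j (by omega) h2⟩) (Or.inl (by linarith [ht.1])) e1 e2).2
  · have hlin : ∀ j : ℤ, j ≤ 0 → -(N : ℤ) ≤ j → |D j - κ * (j / N)| ≤ c₀ / 4 := fun j h1 h2 =>
      hb.of_nonneg hD0 hb0 h1 (by linarith)
    have hup : ∀ j : ℤ, j ≤ 0 → -(N : ℤ) ≤ j → |D j - (s - s')| ≤ 5 * c₀ := fun j h1 h2 =>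
      hupper j (by rw [abs_of_nonpos h1]; linarith) (hlin j h1 h2)
    have hmono := birkhoff_mono_add (T := T) hc x (show -(N : ℤ) ≤ -M by omega)
    have hMone := birkhoff_mono_add (T := T) hc x (show -M ≤ 0 by omega)
    rw [birkhoff_zero] at hMone
    push_cast at hmono hMone
    have hM4 : c ≤ c * (0 - -(M : ℝ)) := by
      have h1 : (1 : ℝ) ≤ M := by exact_mod_cast (by omega : 1 ≤ M)
      rw [zero_sub, neg_neg]
      exact le_mul_of_one_le_right hc0.le h1
    refine ⟨birkhoff T f (-N) x - s, birkhoff T f (-M) x - s, by linarith,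
      fun t ht => ⟨?_, ?_⟩⟩
    · intro u hu
      rw [uIcc_of_ge (by linarith [ht.2])] at hu
      have := (pseudoDist_flow_mem hc0 hc hP hQ (j₀ := -N) (j₁ := 0) (l := 0) (h := 5 * c₀)
        (t := u)
        (by linarith) (fun j h1 h2 => ⟨abs_nonneg _, hup j h2 h1⟩)
        (Or.inl (by linarith [hu.1, ht.1])) (by rw [zero_add, hb1]; linarith [hu.2])
        (by rw [zero_add, hb1']; linarith [hu.2])).1
      exact lt_of_le_of_lt this (by linarith)
    · obtain ⟨e1, e2⟩ := lt_birkhoff_add_one (α := α) hc hc0 (x := x) (y := y) (s := s) (s' := s')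
        (t := t) (j := -M) (by linarith [ht.2])
        ((hup (-M) (by omega) (by omega)).trans_lt (by linarith))
      exact hmin.trans_le (pseudoDist_flow_mem hc0 hc hP hQ (j₀ := -N) (j₁ := -M)
        (h := 5 * c₀) (by linarith) (fun j h1 h2 =>
          ⟨hlower j (by rw [abs_of_nonpos (by omega)]; omega) (hlin j (by omega) h1),
          hup j (by omega) h1⟩) (Or.inl (by linarith [ht.1])) e1 e2).2

end SpecialFlow

open SpecialFlow

/-- Parabolic divergence for pairs of points that are represented over slow points `x ≠ y`. The
constants `c₀` and `c₁` do not depend on the slowness of these points. -/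
theorem IsArnoldRoof.exists_divergence {α : ℝ} (hD : α ∈ diophD) {f : UnitAddCircle → ℝ}
    (hf : IsArnoldRoof f) {p : ℕ → ℤ} {q : ℕ → ℕ} (hq : ∀ n, cfDenom α n = q n)
    (h : IsConvergents α p q) :
    ∃ c₀ ∈ Ioo (0 : ℝ) 1, ∃ c₁ ∈ Ioo (0 : ℝ) 1, ∀ c' : ℝ, 0 < c' → ∀ s₀ : ℕ,
      ∃ δ : ℝ, 0 < δ ∧ ∀ (P Q : Space f) (x y : UnitAddCircle) (s s' : ℝ),
        x ∈ slowPoints α q c' s₀ → y ∈ slowPoints α q c' s₀ → x ≠ y → dist x y < δ →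
        |s - s'| < δ → Represents (circleRotation α) f P x s →
        Represents (circleRotation α) f Q y s' → s < f x → s' < f y → 0 ≤ max s s' →
        ENNReal.ofReal c₁ * volume
            (closeInterval (flow (circleRotation α) f) (pseudoDist (circleRotation α)) P Q) <
          volume {t ∈ closeInterval (flow (circleRotation α) f)
            (pseudoDist (circleRotation α)) P Q |
              c₀ < pseudoDist (circleRotation α) (flow (circleRotation α) f t P)
                (flow (circleRotation α) f t Q)} := by
  obtain ⟨c, hc0, hc⟩ := hf.exists_pos_le
  obtain ⟨Cf, hCf0, hCf⟩ := hf.exists_le_log_norm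
  obtain ⟨cd, hcd, hlow⟩ := exists_div_pow_le_distInt_mul hD hq h
  have ha : 0 < min (distInt α) (distInt (2 * α)) := by
    have h1 := hlow 1 one_ne_zero
    have h2 := hlow 2 two_ne_zero
    push_cast at h1 h2
    rw [one_mul] at h1
    exact lt_min (lt_of_lt_of_le (by positivity) h1) (lt_of_lt_of_le (by positivity) h2)
  obtain ⟨c₀, h₀, h₁, h₂, h₃⟩ : ∃ c₀ : ℝ, 0 < c₀ ∧ c₀ ≤ 1 / 2000 ∧ 40 * c₀ ≤ c ∧
      8 * c₀ ≤ min (distInt α) (distInt (2 * α)) := by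
    refine ⟨min (1 / 2000) (min (c / 40) (min (distInt α) (distInt (2 * α)) / 8)),
      by positivity, min_le_left _ _, ?_, ?_⟩
    · have : min (1 / 2000) (min (c / 40) (min (distInt α) (distInt (2 * α)) / 8)) ≤ c / 40 :=
        (min_le_right _ _).trans (min_le_left _ _)
      linarith
    · have : min (1 / 2000) (min (c / 40) (min (distInt α) (distInt (2 * α)) / 8)) ≤
          min (distInt α) (distInt (2 * α)) / 8 := (min_le_right _ _).trans (min_le_right _ _)
      linarith
  -- over `m N` steps `D` varies by more than `1 / 50`
  obtain ⟨m, hm⟩ := exists_nat_ge ((1 / 50 + c₀ / 4) / (4 * c₀))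
  have hκm : 1 / 50 + c₀ / 4 ≤ 4 * c₀ * m := by
    rw [div_le_iff₀ (by positivity)] at hm; linarith
  have hm1 : 1 ≤ m := by
    by_contra hcon
    have : m = 0 := by omega
    rw [this] at hκm
    norm_num at hκm
    linarith
  obtain ⟨C, hC0, hC⟩ := hf.exists_birkhoff_le hD hq h (7 * m)
  have hc₁ : 0 < c / (12 * (C + 1)) := by positivity
  refine ⟨c₀, ⟨h₀, by linarith⟩, min (1 / 2) (c / (12 * (C + 1))),
    ⟨lt_min (by norm_num) hc₁, lt_of_le_of_lt (min_le_left _ _) (by norm_num)⟩, fun c' hc' s₀ => ?_⟩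
  have hexit := hf.eventually_exists_le_pseudoDist hD hq h hc' s₀ (R := 7 * m) hm1 hκm
  have hS : ∀ᶠ N : ℕ in atTop, Cf * (1 - Real.log c') ≤ N :=
    tendsto_natCast_atTop_atTop.eventually_ge_atTop _
  obtain ⟨δ₀, hδ₀, hlin⟩ := exists_isAlmostLinear hD hf hq h c' s₀ (κ := 4 * c₀)
    (by positivity) (R := 7 * m) (by omega) (η := c₀ / 4) (by positivity) _
    (hexit.and ((hC c' hc').and (hS.and (eventually_ge_atTop 3))))
  refine ⟨min δ₀ (c₀ / 4), by positivity,
    fun P Q x y s s' hx hy hxy hd hss hP hQ hs hs' hmax => ?_⟩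
  have hd1 : dist x y < c₀ / 4 := hd.trans_le (min_le_right _ _)
  have hss1 : |s - s'| < c₀ / 4 := hss.trans_le (min_le_right _ _)
  obtain ⟨N, ⟨hexN, hCN, hSN, hN3⟩, hdN, κ, hκ, b, hb⟩ :=
    hlin x hx y hxy (hd.trans_le (min_le_left _ _))
  set T := circleRotation α with hT
  set I := closeInterval (flow T f) (pseudoDist T) P Q with hI
  obtain ⟨t₀, t₁, ht, hfar⟩ := exists_far_interval hc h₀ h₁ h₂ h₃ hP hQ hs hs' hmax hss1 hd1 hN3
    (by omega) hκ hb
  have hN1 : (1 : ℝ) ≤ N := by exact_mod_cast (by omega : 1 ≤ N)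
  have hmN : (N : ℤ) ≤ m * N := by
    have : N ≤ m * N := Nat.le_mul_of_pos_left _ hm1
    exact_mod_cast this
  have hmN0 : (1 : ℤ) ≤ m * N := by linarith [(by exact_mod_cast (by omega : 1 ≤ N) : (1 : ℤ) ≤ N)]
  have hsS : s ≤ N := by
    have h1 := slowPoints_le_norm hx 0
    simp only [Int.cast_zero, abs_zero, zero_add, one_pow, div_one, zpow_zero,
      Equiv.Perm.coe_one, id] at h1
    have h2 := hCf x (hc'.trans_le h1)
    have h3 := mul_le_mul_of_nonneg_left
      (sub_le_sub_left (Real.log_le_log hc' h1) 1) hCf0.le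
    linarith
  have hs1 : -1 ≤ s := by
    have := abs_lt.1 hss1
    rcases le_max_iff.1 hmax with h | h <;> linarith
  have hbirk : ∀ n : ℤ, |n| ≤ (7 * m : ℕ) * N → |birkhoff T f n x| ≤ C * N := by
    intro n hn
    induction x using QuotientAddGroup.induction_on with
    | H z => exact hCN z (mem_slowPoints_iff.1 hx).1 n hn
  -- the orbits have separated after at most `7 m N` fibres in both directions
  have hsub : I ⊆ Icc (-((C + 1) * N)) ((C + 1) * N) := by
    obtain ⟨n₁, a1, a2, a3⟩ := hexN P Q x y s s' hx hy hdN hP hQ (by linarith) κ hκ b hb 1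
      (by push_cast; linarith) (by push_cast; linarith)
    obtain ⟨n₂, b1, b2, b3⟩ := hexN P Q x y s s' hx hy hdN hP hQ (by linarith) κ hκ b hb
      (-(6 * m * N)) (by push_cast; linarith) (by push_cast; linarith)
    have e1 := birkhoff_add_one T f n₁ x
    have e2 := birkhoff_add_one T f n₂ x
    have k1 := hc ((T ^ n₁) x)
    have k2 := hc ((T ^ n₂) x)
    have i1 := birkhoff_mono (T := T) hf.pos x (show 1 ≤ n₁ by omega)
    have i2 := birkhoff_mono (T := T) hf.pos x (show n₂ + 1 ≤ 0 by linarith)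
    have i3 := birkhoff_add_one T f 0 x
    simp only [birkhoff_zero, zpow_zero, Equiv.Perm.coe_one, id, zero_add] at i2 i3
    have j1 := abs_le.1 (hbirk (n₁ + 1) (by
      rw [abs_of_nonneg (by omega)]; push_cast; linarith))
    have j2 := abs_le.1 (hbirk n₂ (by
      rw [abs_of_nonpos (by linarith)]; push_cast; linarith))
    have hs2 : -(c / 2) ≤ s := by
      have := abs_lt.1 hss1
      rcases le_max_iff.1 hmax with h | h <;> linarith
    intro t hmem
    constructor
    · by_contra hlt
      refine absurd (hmem (birkhoff T f n₂ x + f ((T ^ n₂) x) / 2 - s) ?_) (not_lt.2 b3)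
      rw [uIcc_of_ge (by linarith)]
      constructor <;> linarith
    · by_contra hlt
      refine absurd (hmem (birkhoff T f n₁ x + f ((T ^ n₁) x) / 2 - s) ?_) (not_lt.2 a3)
      rw [uIcc_of_le (by linarith)]
      constructor <;> linarith
  have hvolI : volume I ≤ ENNReal.ofReal (2 * (C + 1) * N) := by
    refine (measure_mono hsub).trans ?_
    rw [Real.volume_Icc]
    apply ENNReal.ofReal_le_ofReal; linarith
  have hvolG : ENNReal.ofReal (c * N / 3) ≤
      volume {t ∈ I | c₀ < pseudoDist T (flow T f t P) (flow T f t Q)} := by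
    calc ENNReal.ofReal (c * N / 3) ≤ ENNReal.ofReal (t₁ - t₀) :=
          ENNReal.ofReal_le_ofReal (by linarith)
      _ = volume (Ico t₀ t₁) := Real.volume_Ico.symm
      _ ≤ _ := measure_mono fun t ht => hfar t ht
  refine lt_of_lt_of_le ?_ hvolG
  calc ENNReal.ofReal (min (1 / 2) (c / (12 * (C + 1)))) * volume I
      ≤ ENNReal.ofReal (c / (12 * (C + 1))) * ENNReal.ofReal (2 * (C + 1) * N) :=
        mul_le_mul' (ENNReal.ofReal_le_ofReal (min_le_right _ _)) hvolI
    _ = ENNReal.ofReal (c * N / 6) := by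
        rw [← ENNReal.ofReal_mul hc₁.le]; congr 1; field_simp; ring
    _ < ENNReal.ofReal (c * N / 3) := by
        rw [ENNReal.ofReal_lt_ofReal_iff (by positivity)]
        have : 0 < c * N := by positivity
        linarith

/-! ### Parabolic divergence -/

namespace SpecialFlow

theorem flow_eq_of_represents {X : Type*} {T : Equiv.Perm X} {f : X → ℝ} {c : ℝ} (hc0 : 0 < c)
    (hc : ∀ x, c ≤ f x) {p q : Space f} {x : X} {s s' : ℝ} (hp : Represents T f p x s)
    (hq : Represents T f q x s') : flow T f (s' - s) p = q := by
  obtain ⟨n, hn, -⟩ := existsUnique_isIndex T f hc0 hc x s'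
  have h1 := hp (s' - s) n (by rwa [add_sub_cancel])
  have h2 := hq 0 n (by rwa [add_zero])
  have h3 := represents_self (T := T) hc0 hc q 0 0
    ⟨by rw [birkhoff_zero, add_zero]; exact q.2.1, by
      rw [birkhoff_add_one, birkhoff_zero, zero_add, add_zero]; exact q.2.2⟩
  rw [birkhoff_zero] at h3
  refine Subtype.ext ?_
  rw [h1, add_sub_cancel]
  rw [add_zero] at h2
  rw [← h2, h3]
  ext <;> simp

theorem measurableSet_space {X : Type*} [MeasurableSpace X] {f : X → ℝ} (hf : Measurable f) :
    MeasurableSet {p : X × ℝ | 0 ≤ p.2 ∧ p.2 < f p.1} :=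
  (measurableSet_le measurable_const measurable_snd).inter
    (measurableSet_lt measurable_snd (hf.comp measurable_fst))

theorem measure_fst_preimage {X : Type*} [MeasurableSpace X] (μ : Measure X) [SFinite μ]
    {f : X → ℝ} (hf : Measurable f) {W : Set X} (hW : MeasurableSet W) :
    measure μ f {p | p.1.1 ∈ W} = ∫⁻ x in W, ENNReal.ofReal (f x) ∂μ := by
  have himg : (Subtype.val '' {p : Space f | p.1.1 ∈ W}) =
      {p : X × ℝ | 0 ≤ p.2 ∧ p.2 < f p.1} ∩ Prod.fst ⁻¹' W := by
    ext p
    constructor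
    · rintro ⟨q, hq, rfl⟩
      exact ⟨q.2, hq⟩
    · rintro ⟨h1, h2⟩
      exact ⟨⟨p, h1⟩, h2, rfl⟩
  refine ((MeasurableEmbedding.subtype_coe (measurableSet_space hf)).comap_apply _ _).trans
    ((congrArg (μ.prod volume) himg).trans ?_)
  rw [Measure.prod_apply ((measurableSet_space hf).inter (measurable_fst hW)),
    ← lintegral_indicator hW]
  refine lintegral_congr fun x => ?_
  by_cases hx : x ∈ W
  · rw [indicator_of_mem hx]
    have : Prod.mk x ⁻¹' ({p : X × ℝ | 0 ≤ p.2 ∧ p.2 < f p.1} ∩ Prod.fst ⁻¹' W) =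
        Ico 0 (f x) := by
      ext s; simp [hx]
    rw [this, Real.volume_Ico, sub_zero]
  · rw [indicator_of_notMem hx]
    have : Prod.mk x ⁻¹' ({p : X × ℝ | 0 ≤ p.2 ∧ p.2 < f p.1} ∩ Prod.fst ⁻¹' W) = ∅ := by
      ext s; simp [hx]
    rw [this, measure_empty]

end SpecialFlow

open SpecialFlow

/-- Most points of the special flow lie over base points `x` such that `x` and `x + α` are slow. -/
theorem IsArnoldRoof.exists_slowPoints_measure_gt {α : ℝ} (hE : α ∈ diophE)
    {f : UnitAddCircle → ℝ} (hf : IsArnoldRoof f) {p : ℕ → ℤ} {q : ℕ → ℕ}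
    (hq : ∀ n, cfDenom α n = q n) (h : IsConvergents α p q) {ε : ℝ} (hε : 0 < ε) :
    ∃ c : ℝ, 0 < c ∧ ∃ s₀ : ℕ,
      MeasurableSet {P : Space f | P.1.1 ∈ slowPoints α q c s₀ ∩
        circleRotation α ⁻¹' slowPoints α q c s₀} ∧
      1 - ε < (SpecialFlow.measure volume f).real {P : Space f | P.1.1 ∈ slowPoints α q c s₀ ∩
        circleRotation α ⁻¹' slowPoints α q c s₀} := by
  have hfm := hf.measurable
  have htot : ∫⁻ x, ENNReal.ofReal (f x) = 1 := by
    rw [← ofReal_integral_eq_lintegral_ofReal hf.integrable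
      (Eventually.of_forall fun x => (hf.pos x).le), hf.integral_eq_one, ENNReal.ofReal_one]
  obtain ⟨δ, hδ, hsmall⟩ := exists_pos_setLIntegral_lt_of_measure_lt
    (μ := (volume : Measure UnitAddCircle)) (f := fun x => ENNReal.ofReal (f x))
    (by rw [htot]; exact ENNReal.one_ne_top)
    (ε := ENNReal.ofReal ε) (by simpa using hε)
  obtain ⟨ε', hε', hεδ⟩ : ∃ ε' : ℝ, 0 < ε' ∧ ENNReal.ofReal ε' + ENNReal.ofReal ε' < δ := by
    obtain ⟨r, hr0, hr⟩ := ENNReal.lt_iff_exists_nnreal_btwn.1 hδ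
    have hr0' : (0 : ℝ) < r := by exact_mod_cast hr0
    refine ⟨r / 2, by positivity, ?_⟩
    rw [← ENNReal.ofReal_add (by positivity) (by positivity), add_halves]
    rwa [ENNReal.ofReal_coe_nnreal]
  obtain ⟨c, hc, s₀, hvol⟩ := exists_slowPoints_compl_le hE hq h hε'
  set W := slowPoints α q c s₀ ∩ circleRotation α ⁻¹' slowPoints α q c s₀ with hWdef
  have hrot : MeasurePreserving (circleRotation α) (volume : Measure UnitAddCircle) volume :=
    measurePreserving_add_right volume (α : UnitAddCircle)
  have hW0 := measurableSet_slowPoints α q c s₀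
  have hW : MeasurableSet W := hW0.inter (hrot.measurable hW0)
  have hWc : volume Wᶜ < δ := by
    refine lt_of_le_of_lt ?_ hεδ
    rw [hWdef, compl_inter]
    refine (measure_union_le _ _).trans (add_le_add hvol ?_)
    rw [← preimage_compl, hrot.measure_preimage hW0.compl.nullMeasurableSet]
    exact hvol
  have hmeasZ : MeasurableSet {P : Space f | P.1.1 ∈ W} :=
    (measurable_fst.comp measurable_subtype_coe) hW
  refine ⟨c, hc, s₀, hmeasZ, ?_⟩
  rw [measureReal_def, measure_fst_preimage _ hfm hW]
  have hsplit := lintegral_add_compl (μ := volume) (fun x => ENNReal.ofReal (f x)) hW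
  rw [htot] at hsplit
  have h1 := hsmall _ hWc
  set a := ∫⁻ x in W, ENNReal.ofReal (f x)
  set b := ∫⁻ x in Wᶜ, ENNReal.ofReal (f x)
  have ha : a ≠ ⊤ := fun e => by rw [e, top_add] at hsplit; exact ENNReal.top_ne_one hsplit
  have hb : b ≠ ⊤ := ne_top_of_lt h1
  have h2 := congrArg ENNReal.toReal hsplit
  rw [ENNReal.toReal_add ha hb, ENNReal.toReal_one] at h2
  have h3 : b.toReal < ε := (ENNReal.lt_ofReal_iff_toReal_lt hb).1 h1
  linarith

theorem hasPD_of_arnold {α : ℝ} (hD : α ∈ diophD) (hE : α ∈ diophE) {f : UnitAddCircle → ℝ}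
    (hf : IsArnoldRoof f) :
    HasPD (SpecialFlow.measure volume f) (flow (circleRotation α) f)
      (pseudoDist (circleRotation α)) := by
  obtain ⟨p, q, hq, h⟩ := exists_isConvergents hD.1
  obtain ⟨c, hc0, hc⟩ := hf.exists_pos_le
  obtain ⟨c₀, hc₀, c₁, hc₁, hdiv⟩ := hf.exists_divergence hD hq h
  refine ⟨c₀, hc₀, c₁, hc₁, fun ε hε => ?_⟩
  obtain ⟨c', hc', s₀, hZ, hmeas⟩ := hf.exists_slowPoints_measure_gt hE hq h hε
  obtain ⟨δ, hδ, hsep⟩ := hdiv c' hc' s₀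
  refine ⟨_, hZ, hmeas, δ, hδ, fun P hP Q hQ hPQ hne => ?_⟩
  have rP := represents_self (T := circleRotation α) hc0 hc P
  have rQ := represents_self (T := circleRotation α) hc0 hc Q
  have hlt : dist P.1.1 Q.1.1 + |P.1.2 - Q.1.2| < δ ∨
      dist (circleRotation α P.1.1) Q.1.1 + |f P.1.1 - P.1.2 + Q.1.2| < δ ∨
      dist P.1.1 (circleRotation α Q.1.1) + |f Q.1.1 - Q.1.2 + P.1.2| < δ := by
    simpa only [pseudoDist, rho, min_lt_iff] using hPQ
  -- the representatives that realize the minimum in the definition of `d^f`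
  obtain ⟨x, y, s, s', hx, hy, hd, hp, hq, hs, hs', hmax⟩ : ∃ (x y : UnitAddCircle) (s s' : ℝ),
      x ∈ slowPoints α q c' s₀ ∧ y ∈ slowPoints α q c' s₀ ∧ dist x y + |s - s'| < δ ∧
      Represents (circleRotation α) f P x s ∧ Represents (circleRotation α) f Q y s' ∧
      s < f x ∧ s' < f y ∧ 0 ≤ max s s' := by
    rcases hlt with hlt | hlt | hlt
    · exact ⟨_, _, _, _, hP.1, hQ.1, hlt, rP, rQ, P.2.2, Q.2.2, le_max_of_le_left P.2.1⟩
    · refine ⟨_, _, _, _, hP.2, hQ.1, ?_, represents_next hc0 hc P, rQ, ?_, Q.2.2,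
        le_max_of_le_right Q.2.1⟩
      · rw [← abs_neg] at hlt
        refine lt_of_eq_of_lt ?_ hlt
        congr 2; ring
      · linarith [hf.pos (circleRotation α P.1.1), P.2.2]
    · refine ⟨_, _, _, _, hP.1, hQ.2, ?_, rP, represents_next hc0 hc Q, P.2.2, ?_,
        le_max_of_le_left P.2.1⟩
      · refine lt_of_eq_of_lt ?_ hlt
        congr 2; ring
      · linarith [hf.pos (circleRotation α Q.1.1), Q.2.2]
  have hss : |s - s'| < δ := by linarith [dist_nonneg (x := x) (y := y)]
  refine hsep P Q x y s s' hx hy ?_ (by linarith [abs_nonneg (s - s')]) hss hp hq hs hs' hmax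
  rintro rfl
  exact hne (s' - s) (by rwa [abs_sub_comm]) (flow_eq_of_represents hc0 hc hp hq)

theorem mainTheorem5 (α : ℝ) (hD : α ∈ diophD) (hE : α ∈ diophE)
    (f : UnitAddCircle → ℝ) (hf : IsArnoldRoof f) :
    HasPD (SpecialFlow.measure volume f) (SpecialFlow.flow (circleRotation α) f)
        (SpecialFlow.pseudoDist (circleRotation α)) ∧
      SpecialFlow.CocycleDivergence (circleRotation α) f volume :=
  ⟨hasPD_of_arnold hD hE hf, cocycleDivergence_of_arnold hD hE hf⟩

end
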